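/- **Conventions.** A multi-linkoid diagram is a generic smooth immersion of finitely many unit intervals and oriented circles into the oriented sphere $S^2$ (finitely many transverse double points, no triple points, endpoints not on other points of the diagram) with over/under information at each double point; intervals are oriented from the head (image of $0$) to the leg (image of $1$). Multi-linkoids are the classes of diagrams under reparametrization, isotopy of $S^2$, and Reidemeister moves supported in disks disjoint from the endpoints. The crossing number $c(\mu)$ of a multi-linkoid $\mu$ is the least number of crossings of a diagram representing $\mu$. Let $P_3=\{0,1,2\}$ be the quandle in which $1^0=2$, $2^0=1$ and $x^y=x$ in all other cases. The co-orientation normal of a strand points to its left. A $(P_3,P_3)$-coloring $c$ of a diagram $D$ assigns elements of $P_3$ to the arcs (pieces of strands between undercrossings and endpoints) and to the regions (components of $S^2\setminus D$) such that: at a crossing with over-arc colored $y$ whose normal points from an under-arc colored $x$ to the other under-arc, the latter is colored $x^y$; if the normal of an arc colored $a$ points from a region colored $r$ to a region colored $r'$, then $r'=r^a$; and if $r$ is the color of the region around an endpoint of an arc colored $a$, then $r^a=r$. The color of a crossing is $(y,x_1,x_2)$, where $y$ is the color of the region from which both normals point away, $x_1$ the color of the under-arc adjacent to that region, and $x_2$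 the color of the over-arc. For $\phi:P_3^3\to\mathbb Z_2\oplus\mathbb Z$, the weight $W_\phi(D,c)$ is the sum over the crossings of $\pm\phi(y,x_1,x_2)$, the sign being that of the crossing. Here let $$\phi(a,b,c)=\begin{cases}1\oplus 0 & (a,b,c)=(0,1,0),(0,2,0),\\ 0\oplus 1 & (a,b,c)=(1,0,2),(2,0,1),\\ 0\oplus(-1) & (a,b,c)=(1,0,1),(2,0,2),\\ 0\oplus 0&\text{otherwise.}\end{cases}$$ For $n\ge 0$ let $M_n$ be the multi-linkoid with the following diagram on the unit sphere: one embedded circle, the equator, and $n$ disjoint trivial knotoid diagrams, short arcs of distinct meridians running from the head on the left side of the circle to the leg on its right side, such that the circle passes under each of them exactly once, in a positive crossing. **Theorem.** The map $\phi$ is a quandle 3-cocycle of $P_3$, that is, $$-\phi(x_0,x_2,x_3)+\phi(x_0^{x_1},x_2,x_3)+\phi(x_0,x_1,x_3)-\phi(x_0^{x_2},x_1^{x_2},x_3)-\phi(x_0,x_1,x_2)+\phi(x_0^{x_3},x_1^{x_3},x_2^{x_3})=0$$ and $\phi(y,x,x)=\phi(x,x,y)=0$ for all arguments. For every $n\ge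 0$ the crossing number of $M_n$ is exactly $n$, and it is determined by the shadow quandle cocycle invariant: for every diagram $D$ representing $M_n$, 1. $D$ has a $(P_3,P_3)$-coloring $c$ with $W_\phi(D,c)=0\oplus n$; 2. every $(P_3,P_3)$-coloring $c$ of $D$, with weight $W_\phi(D,c)=\alpha\oplus\beta$, satisfies $\alpha+|\beta|\le c(M_n)$, where $\alpha\in\mathbb Z_2$ is read as the integer $0$ or $1$. Thus $c(M_n)=n$ is the maximum of $\alpha+|\beta|$ over the weights of the colorings of any diagram of $M_n$. -/

import Mathlib

open Set Filter Topology
open scoped ContDiff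

noncomputable section

namespace MLinkoid

/-! Multi-linkoid diagrams on the oriented unit sphere of Euclidean 3-space. -/

abbrev E3 : Type := EuclideanSpace ℝ (Fin 3)

/-- The surface carrying the diagrams: the unit sphere. -/
def S2 : Set E3 := Metric.sphere 0 1

/-- The determinant of three vectors. For tangent vectors `v`, `w` at a point `x` of the sphere
(oriented by the outward normal) it is positive iff `w` points to the left of `v`. -/
def orient (x v w : E3) : ℝ :=
  Matrix.det !![x 0, x 1, x 2; v 0, v 1, v 2; w 0, w 1, w 2]

/-- Components of a multi-linkoid with `m` intervals (`inl`) and `k` circles (`inr`). -/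
abbrev Comp (m k : ℕ) : Type := Fin m ⊕ Fin k

/-- A component together with a parameter. -/
abbrev Pt (m k : ℕ) : Type := Comp m k × ℝ

/-- The parameters that run through each point of the component exactly once:
an interval component is `[0,1]`, a circle component is `ℝ/ℤ`, represented by `[0,1)`. -/
def params {m k : ℕ} : Comp m k → Set ℝ
  | .inl _ => Icc 0 1
  | .inr _ => Ico 0 1

/-- All meaningful parameters: `[0,1]` for an interval, every real for a circle
(circles are parametrized by functions of period one). -/
def allParams {m k : ℕ} : Comp m k → Set ℝ
  | .inl _ => Icc 0 1
  | .inr _ => univ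

/-- The parameters of points that are not endpoints of the component. -/
def innerParams {m k : ℕ} : Comp m k → Set ℝ
  | .inl _ => Ioo 0 1
  | .inr _ => univ

/-- The representative of a parameter in `params`. -/
def rep {m k : ℕ} : Comp m k → ℝ → ℝ
  | .inl _, t => t
  | .inr _, t => Int.fract t

/-- The points of the domain of a diagram. -/
def points (m k : ℕ) : Set (Pt m k) := {p | p.2 ∈ params p.1}

/-- A multi-linkoid diagram on the sphere: a generic smooth immersion of `m` unit intervals and `k`
circles with crossing information. An interval component is a smooth function on `ℝ` of which only
the restriction to `[0,1]` matters; a circle component is a smooth function of period one.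
A crossing is recorded as the pair (point of the over-strand, point of the under-strand). -/
structure Diagram (m k : ℕ) where
  curve : Comp m k → ℝ → E3
  crossings : Finset (Pt m k × Pt m k)
  smooth : ∀ i, ContDiff ℝ ∞ (curve i)
  periodic : ∀ j t, curve (.inr j) (t + 1) = curve (.inr j) t
  mem_sphere : ∀ i, ∀ t ∈ params i, curve i t ∈ S2
  immersion : ∀ i, ∀ t ∈ params i, deriv (curve i) t ≠ 0
  /-- double points are transverse -/
  transverse : ∀ p ∈ points m k, ∀ q ∈ points m k, p ≠ q → curve p.1 p.2 = curve q.1 q.2 →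
    orient (curve p.1 p.2) (deriv (curve p.1) p.2) (deriv (curve q.1) q.2) ≠ 0
  no_triple : ∀ p ∈ points m k, ∀ q ∈ points m k, ∀ r ∈ points m k, p ≠ q → p ≠ r → q ≠ r →
    ¬ (curve p.1 p.2 = curve q.1 q.2 ∧ curve p.1 p.2 = curve r.1 r.2)
  /-- endpoints are not double points -/
  endpoint_simple : ∀ (i : Fin m) (t : ℝ), t = 0 ∨ t = 1 → ∀ q ∈ points m k, q ≠ (.inl i, t) →
    curve q.1 q.2 ≠ curve (.inl i) t
  crossing_double : ∀ c ∈ crossings, c.1 ∈ points m k ∧ c.2 ∈ points m k ∧ c.1 ≠ c.2 ∧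
    curve c.1.1 c.1.2 = curve c.2.1 c.2.2
  double_crossing : ∀ p ∈ points m k, ∀ q ∈ points m k, p ≠ q → curve p.1 p.2 = curve q.1 q.2 →
    (p, q) ∈ crossings ∨ (q, p) ∈ crossings
  crossing_asymm : ∀ p q, (p, q) ∈ crossings → (q, p) ∉ crossings

namespace Diagram

variable {m k : ℕ}

/-- The point of the sphere at a point of the domain. -/
def pos (D : Diagram m k) (p : Pt m k) : E3 := D.curve p.1 p.2

/-- The velocity at a point of the domain. -/
def vel (D : Diagram m k) (p : Pt m k) : E3 := deriv (D.curve p.1) p.2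

/-- The image of the immersion. -/
def image (D : Diagram m k) : Set E3 := D.pos '' points m k

def IsOver (D : Diagram m k) (i : Comp m k) (t : ℝ) : Prop := ∃ c ∈ D.crossings, c.1 = (i, rep i t)

def IsUnder (D : Diagram m k) (i : Comp m k) (t : ℝ) : Prop := ∃ c ∈ D.crossings, c.2 = (i, rep i t)

/-- A crossing is positive iff (over direction, under direction) is a positive frame. -/
def Positive (D : Diagram m k) (c : Pt m k × Pt m k) : Prop :=
  0 < orient (D.pos c.1) (D.vel c.1) (D.vel c.2)

end Diagram

/-! Equivalence of diagrams. -/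

/-- `D'` is `D` precomposed with an orientation preserving diffeomorphism of the domain, which may
permute the intervals and permute the circles. -/
def Reparam {m k : ℕ} (D D' : Diagram m k) : Prop :=
  ∃ (e : Equiv.Perm (Fin m)) (e' : Equiv.Perm (Fin k)) (ρ : Comp m k → ℝ → ℝ),
    (∀ i, ContDiff ℝ ∞ (ρ i)) ∧ (∀ i t, 0 < deriv (ρ i) t) ∧
    (∀ i, ρ (.inl i) 0 = 0 ∧ ρ (.inl i) 1 = 1) ∧
    (∀ j t, ρ (.inr j) (t + 1) = ρ (.inr j) t + 1) ∧
    (∀ i, ∀ t ∈ allParams i, D'.curve i t = D.curve (Sum.map e e' i) (ρ i t)) ∧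
    ∀ p ∈ points m k, ∀ q ∈ points m k, (p, q) ∈ D'.crossings ↔
      ((Sum.map e e' p.1, rep p.1 (ρ p.1 p.2)), (Sum.map e e' q.1, rep q.1 (ρ q.1 q.2)))
        ∈ D.crossings

/-- A smooth ambient isotopy of the sphere, `H t` being a diffeomorphism of the sphere with inverse
`G t`. Smooth maps on the sphere are represented by smooth extensions to the complement of the
origin, such as the radial ones. -/
structure AmbientIsotopy where
  H : ℝ → E3 → E3
  G : ℝ → E3 → E3
  smooth_H : ContDiffOn ℝ ∞ (fun q : ℝ × E3 => H q.1 q.2) (univ ×ˢ {0}ᶜ)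
  smooth_G : ContDiffOn ℝ ∞ (fun q : ℝ × E3 => G q.1 q.2) (univ ×ˢ {0}ᶜ)
  mapsTo_H : ∀ t, MapsTo (H t) S2 S2
  mapsTo_G : ∀ t, MapsTo (G t) S2 S2
  left_inv : ∀ t, ∀ x ∈ S2, G t (H t x) = x
  right_inv : ∀ t, ∀ x ∈ S2, H t (G t x) = x
  start : ∀ x ∈ S2, H 0 x = x

/-- `D'` is the image of `D` under an ambient isotopy of the sphere. -/
def Isotopic {m k : ℕ} (D D' : Diagram m k) : Prop :=
  ∃ Φ : AmbientIsotopy, (∀ i, ∀ t ∈ params i, D'.curve i t = Φ.H 1 (D.curve i t)) ∧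
    D'.crossings = D.crossings

/-- An orientation preserving diffeomorphism of the plane onto an open disk of the sphere. -/
structure DiskChart where
  toFun : ℝ × ℝ → E3
  invFun : E3 → ℝ × ℝ
  target : Set E3
  smooth_toFun : ContDiff ℝ ∞ toFun
  isOpen_target : IsOpen target
  range_eq : range toFun = target ∩ S2
  smooth_invFun : ContDiffOn ℝ ∞ invFun target
  left_inv : ∀ p, invFun (toFun p) = p
  orient_pos : ∀ p, 0 < orient (toFun p) (fderiv ℝ toFun p (1, 0)) (fderiv ℝ toFun p (0, 1))

/-- `D'` arises from `D` by replacing, in an open disk of the sphere, the picture formed by the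
strands `σ a` (`a < r`) by the picture formed by the strands `σ' a`. Here `a ↦ comp a` and `θ a`
tell which piece of `D` the strand `a` is (its direction may agree with that of `D` or not).
The disk contains nothing else of the diagram, and `D`, `D'` agree outside. Whenever distinct
strands cross, in `D` or in `D'`, the one with the larger height passes over. There is no condition
on a crossing of a strand with itself. Since the strands lie in `(0,1)`, endpoints stay out of the
disk. -/
def LocalMove {m k : ℕ} (r : ℕ) (σ σ' : Fin r → ℝ → ℝ × ℝ) (D D' : Diagram m k) : Prop :=
  ∃ (h : DiskChart) (comp : Fin r → Comp m k) (θ : Fin r → ℝ → ℝ) (height : Fin r → ℕ),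
    (∀ a, ContDiff ℝ ∞ (θ a)) ∧ (∀ a u, deriv (θ a) u ≠ 0) ∧ (∀ a u, θ a u ∈ Ioo (0 : ℝ) 1) ∧
    (∀ a b u v, comp a = comp b → θ a u = θ b v → a = b ∧ u = v) ∧
    Function.Injective height ∧
    (∀ a u, D.curve (comp a) (θ a u) = h.toFun (σ a u)) ∧
    (∀ a u, D'.curve (comp a) (θ a u) = h.toFun (σ' a u)) ∧
    (∀ p ∈ points m k, (∀ a u, p ≠ (comp a, θ a u)) →
      D'.pos p = D.pos p ∧ D.pos p ∉ range h.toFun) ∧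
    (∀ p q, ((∀ a u, p ≠ (comp a, θ a u)) ∨ (∀ a u, q ≠ (comp a, θ a u))) →
      ((p, q) ∈ D'.crossings ↔ (p, q) ∈ D.crossings)) ∧
    (∀ a b u v, a ≠ b → ((comp a, θ a u), (comp b, θ b v)) ∈ D.crossings → height b < height a) ∧
    (∀ a b u v, a ≠ b → ((comp a, θ a u), (comp b, θ b v)) ∈ D'.crossings → height b < height a)

/-- First Reidemeister move: an embedded strand gets a kink, namely a nodal cubic. Both curves agree
outside a compact set. -/
def R1 {m k : ℕ} (D D' : Diagram m k) : Prop :=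
  ∃ p : ℝ → ℝ, ContDiff ℝ ∞ p ∧ (∀ t, 0 < deriv p t) ∧ (∀ t, 2 ≤ |t| → p t = t ^ 3 - t) ∧
    LocalMove 1 ![fun t => (t ^ 2, p t)] ![fun t => (t ^ 2, t ^ 3 - t)] D D'

/-- Second Reidemeister move: the graph of a positive function, which does not meet the axis, is
replaced by a parabola that meets it twice. Both curves agree outside a compact set. -/
def R2 {m k : ℕ} (D D' : Diagram m k) : Prop :=
  ∃ f : ℝ → ℝ, ContDiff ℝ ∞ f ∧ (∀ t, 0 < f t) ∧ (∀ t, 2 ≤ |t| → f t = t ^ 2 - 1) ∧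
    LocalMove 2 ![fun t => (t, 0), fun t => (t, f t)]
      ![fun t => (t, 0), fun t => (t, t ^ 2 - 1)] D D'

/-- Third Reidemeister move: a strand passing above the crossing point of the two diagonals is
replaced by one passing below it. Both curves agree outside a compact set. -/
def R3 {m k : ℕ} (D D' : Diagram m k) : Prop :=
  ∃ f : ℝ → ℝ, ContDiff ℝ ∞ f ∧ (∀ t, |deriv f t| < 1) ∧ 0 < f 0 ∧ (∀ t, 2 ≤ |t| → f t = 0) ∧
    LocalMove 3 ![fun t => (t, t), fun t => (t, -t), fun t => (t, f t)]
      ![fun t => (t, t), fun t => (t, -t), fun t => (t, -f t)] D D'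

def Step {m k : ℕ} (D D' : Diagram m k) : Prop :=
  Reparam D D' ∨ Isotopic D D' ∨ R1 D D' ∨ R2 D D' ∨ R3 D D'

/-- Multi-linkoids with `m` intervals and `k` circles: classes of diagrams under the equivalence
relation generated by isotopy and Reidemeister moves (and reparametrization). -/
def MultiLinkoid (m k : ℕ) : Type :=
  Quotient (Relation.EqvGen.setoid (Step (m := m) (k := k)))

/-- The multi-linkoid represented by a diagram. -/
def Diagram.linkoid {m k : ℕ} (D : Diagram m k) : MultiLinkoid m k := Quotient.mk _ D

/-- The crossing number: the least number of crossings of a representing diagram. -/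
def MultiLinkoid.crossingNumber {m k : ℕ} (μ : MultiLinkoid m k) : ℕ :=
  sInf {N | ∃ D : Diagram m k, D.linkoid = μ ∧ D.crossings.card = N}

/-! Quandles, cocycles and shadow colorings. -/

/-- The quandle operation written `x ^ y` on paper; in Mathlib it is the action of `y` on `x`. -/
def qop {X : Type*} [Quandle X] (x y : X) : X := Shelf.act y x

/-- The three element quandle `P₃`. -/
inductive P3 : Type
  | zero | one | two
  deriving DecidableEq

/-- The action of `y` on `x`: zero exchanges one and two, the other elements act trivially. -/
def P3.act : P3 → P3 → P3
  | .zero, .one => .two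
  | .zero, .two => .one
  | _, x => x

instance : Quandle P3 where
  act := P3.act
  self_distrib := by intro x y z; cases x <;> cases y <;> cases z <;> rfl
  invAct := P3.act
  left_inv := by intro x y; cases x <;> cases y <;> rfl
  right_inv := by intro x y; cases x <;> cases y <;> rfl
  fix := by intro x; cases x <;> rfl

/-- Quandle 3-cocycles of `X` with values in `A`, given on the generators. -/
def IsQuandle3Cocycle {X A : Type*} [Quandle X] [AddCommGroup A] (f : X → X → X → A) : Prop :=
  (∀ x₀ x₁ x₂ x₃ : X,
    - f x₀ x₂ x₃ + f (qop x₀ x₁) x₂ x₃ + f x₀ x₁ x₃ - f (qop x₀ x₂) (qop x₁ x₂) x₃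
      - f x₀ x₁ x₂ + f (qop x₀ x₃) (qop x₁ x₃) (qop x₂ x₃) = 0) ∧
  ∀ x y : X, f y x x = 0 ∧ f x x y = 0

/-- The 3-cocycle of Oshiro on `P₃` with values in `ℤ₂ ⊕ ℤ`. -/
def φ : P3 → P3 → P3 → ZMod 2 × ℤ
  | .zero, .one, .zero => (1, 0)
  | .zero, .two, .zero => (1, 0)
  | .one, .zero, .two => (0, 1)
  | .two, .zero, .one => (0, 1)
  | .one, .zero, .one => (0, -1)
  | .two, .zero, .two => (0, -1)
  | _, _, _ => 0

/-- The region to the right of the direction `v` at `x` has color `y`: along every path that leaves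
`x` to the right, transversally to `v`, the color of the points is eventually `y`. -/
def RightColor {X : Type*} (region : E3 → X) (x v : E3) (y : X) : Prop :=
  ∀ (α : ℝ → E3) (w : E3), (∀ s, α s ∈ S2) → α 0 = x → HasDerivWithinAt α w (Ici 0) 0 →
    orient x v w < 0 → ∀ᶠ s in 𝓝[>] (0 : ℝ), region (α s) = y

/-- The region to the left of the direction `v` at `x` has color `y`. -/
def LeftColor {X : Type*} (region : E3 → X) (x v : E3) (y : X) : Prop :=
  ∀ (α : ℝ → E3) (w : E3), (∀ s, α s ∈ S2) → α 0 = x → HasDerivWithinAt α w (Ici 0) 0 →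
    0 < orient x v w → ∀ᶠ s in 𝓝[>] (0 : ℝ), region (α s) = y

/-- An `(X,X)`-coloring (shadow coloring) of a diagram. The co-orientation normal of a strand points
to its left. Regions are the connected components of the complement of the diagram in the sphere,
arcs are the pieces of the strands between consecutive undercrossings.
Values of `region` off the complement and of `arc` at undercrossings are irrelevant. -/
structure Coloring (X : Type*) [Quandle X] {m k : ℕ} (D : Diagram m k) where
  /-- the color of the region containing a point of the complement -/
  region : E3 → X
  /-- the color of the arc at a parameter -/
  arc : Comp m k → ℝ → X
  /-- the color (specified region, specified under-arc, over-arc) of a crossing;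
  it is determined by `region` and `arc` -/
  color : Pt m k × Pt m k → X × X × X
  region_const : ∀ x ∈ S2 \ D.image, ∀ y ∈ connectedComponentIn (S2 \ D.image) x,
    region y = region x
  arc_periodic : ∀ j t, arc (.inr j) (t + 1) = arc (.inr j) t
  arc_const : ∀ i s t, s ≤ t → Icc s t ⊆ allParams i → (∀ u ∈ Icc s t, ¬ D.IsUnder i u) →
    arc i s = arc i t
  /-- at a point that is neither a crossing nor an endpoint, the colors of the regions on the two
  sides are related by the color of the arc -/
  side : ∀ i, ∀ t ∈ innerParams i, ¬ D.IsOver i t → ¬ D.IsUnder i t →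
    ∃ y, RightColor region (D.curve i t) (deriv (D.curve i) t) y ∧
      LeftColor region (D.curve i t) (deriv (D.curve i) t) (qop y (arc i t))
  /-- the color of the region around an endpoint is fixed by the color of the arc there -/
  endpoint : ∀ (i : Fin m) (t : ℝ), t = 0 ∨ t = 1 →
    ∃ y, (∀ᶠ x in 𝓝[S2 \ D.image] (D.curve (.inl i) t), region x = y) ∧
      qop y (arc (.inl i) t) = y
  color_over : ∀ c ∈ D.crossings, (color c).2.2 = arc c.1.1 c.1.2
  /-- at a positive crossing the under-strand runs from the right to the left of the over-strand, so
  the specified under-arc is the incoming one; the specified region is to its right -/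
  color_pos : ∀ c ∈ D.crossings, D.Positive c →
    (∀ᶠ t in 𝓝[<] c.2.2, arc c.2.1 t = (color c).2.1 ∧
      RightColor region (D.curve c.2.1 t) (deriv (D.curve c.2.1) t) (color c).1) ∧
    ∀ᶠ t in 𝓝[>] c.2.2, arc c.2.1 t = qop (color c).2.1 (color c).2.2
  /-- at a negative crossing the specified under-arc is the outgoing one -/
  color_neg : ∀ c ∈ D.crossings, ¬ D.Positive c →
    (∀ᶠ t in 𝓝[>] c.2.2, arc c.2.1 t = (color c).2.1 ∧
      RightColor region (D.curve c.2.1 t) (deriv (D.curve c.2.1) t) (color c).1) ∧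
    ∀ᶠ t in 𝓝[<] c.2.2, arc c.2.1 t = qop (color c).2.1 (color c).2.2

open Classical in
/-- The `f`-weight of a colored diagram: the sum of the local weights of the crossings. -/
def Coloring.weight {X A : Type*} [Quandle X] [AddCommGroup A] {m k : ℕ} {D : Diagram m k}
    (c : Coloring X D) (f : X → X → X → A) : A :=
  ∑ v ∈ D.crossings,
    if D.Positive v then f (c.color v).1 (c.color v).2.1 (c.color v).2.2
    else - f (c.color v).1 (c.color v).2.1 (c.color v).2.2

/-- The integer `α + |β|` attached to `α ⊕ β`, the element `α` of `ℤ₂` being read as `0` or `1`. -/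
def size (w : ZMod 2 × ℤ) : ℤ := (w.1.val : ℤ) + |w.2|

/-! The diagrams `M n`. -/

/-- The circle of `M n` is the equator, run through eastwards; the `a`-th interval descends from
north to south along the meridian of longitude `2 π a / n`. -/
def mCurve (n : ℕ) : Comp n 1 → ℝ → E3
  | .inl a, t => !₂[Real.cos (2 * Real.pi * ((a : ℝ) / n)) * Real.cos (1 / 2 - t),
      Real.sin (2 * Real.pi * ((a : ℝ) / n)) * Real.cos (1 / 2 - t), Real.sin (1 / 2 - t)]
  | .inr _, t => !₂[Real.cos (2 * Real.pi * t), Real.sin (2 * Real.pi * t), 0]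

/-- Each interval crosses over the circle once, at its midpoint. -/
def mCrossing (n : ℕ) (a : Fin n) : Pt n 1 × Pt n 1 :=
  ((.inl a, 1 / 2), (.inr 0, (a : ℝ) / n))

theorem two_pi_inj {a b : ℝ} (ha : a ∈ Ico (0 : ℝ) 1) (hb : b ∈ Ico (0 : ℝ) 1)
    (hc : Real.cos (2 * Real.pi * a) = Real.cos (2 * Real.pi * b))
    (hs : Real.sin (2 * Real.pi * a) = Real.sin (2 * Real.pi * b)) : a = b := by
  have h1 : Real.cos (2 * Real.pi * (a - b)) = 1 := by
    rw [mul_sub, Real.cos_sub, hc, hs]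
    nlinarith [Real.sin_sq_add_cos_sq (2 * Real.pi * b)]
  have hp := Real.pi_pos
  have h2 := (Real.cos_eq_one_iff_of_lt_of_lt
    (by nlinarith [ha.1, ha.2, hb.1, hb.2]) (by nlinarith [ha.1, ha.2, hb.1, hb.2])).1 h1
  have h3 : a - b = 0 := by
    rcases mul_eq_zero.1 h2 with h | h
    · linarith
    · exact h
  linarith

theorem div_mem_Ico {n : ℕ} (a : Fin n) : (a : ℝ) / n ∈ Ico (0 : ℝ) 1 := by
  have hn : (0 : ℝ) < n := by exact_mod_cast a.pos
  refine ⟨by positivity, ?_⟩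
  rw [div_lt_one hn]
  exact_mod_cast a.2

theorem half_sub_mem {t : ℝ} (ht : t ∈ Icc (0 : ℝ) 1) :
    (1 / 2 - t) ∈ Ioo (-(Real.pi / 2)) (Real.pi / 2) := by
  have := Real.pi_gt_three
  constructor <;> linarith [ht.1, ht.2]

theorem mCurve_double {n : ℕ} {p q : Pt n 1} (hp : p ∈ points n 1) (hq : q ∈ points n 1)
    (hpq : p ≠ q) (h : mCurve n p.1 p.2 = mCurve n q.1 q.2) :
    ∃ a, (p = (mCrossing n a).1 ∧ q = (mCrossing n a).2) ∨
      (p = (mCrossing n a).2 ∧ q = (mCrossing n a).1) := by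
  have key : ∀ (a : Fin n) (j : Fin 1) (t s : ℝ), t ∈ Icc (0 : ℝ) 1 → s ∈ Ico (0 : ℝ) 1 →
      mCurve n (.inl a) t = mCurve n (.inr j) s →
      ((Sum.inl a, t) : Pt n 1) = (mCrossing n a).1 ∧
        ((Sum.inr j, s) : Pt n 1) = (mCrossing n a).2 := by
    intro a j t s ht hs h
    have h0 := congrArg (fun x : E3 => x 0) h
    have h1 := congrArg (fun x : E3 => x 1) h
    have h2 := congrArg (fun x : E3 => x 2) h
    simp [mCurve] at h0 h1 h2
    have hm := half_sub_mem ht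
    have h3 : (1 / 2 - t : ℝ) = 0 := by
      have := Real.injOn_sin (Ioo_subset_Icc_self hm) (show (0 : ℝ) ∈ _ by
        constructor <;> linarith [Real.pi_pos]) (by simpa using h2)
      exact this
    have h4 : t = 1 / 2 := by linarith
    subst h4
    simp at h0 h1
    have := two_pi_inj (div_mem_Ico a) hs h0 h1
    subst this
    have hj : j = 0 := Subsingleton.elim _ _
    subst hj
    simp [mCrossing]
  obtain ⟨i, t⟩ := p
  obtain ⟨j, s⟩ := q
  change s ∈ params j at hq
  change t ∈ params i at hp
  rcases i with a | a <;> rcases j with b | b <;> simp only [params] at hp hq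
  · exfalso
    simp only at h
    have h0 := congrArg (fun x : E3 => x 0) h
    have h1 := congrArg (fun x : E3 => x 1) h
    have h2 := congrArg (fun x : E3 => x 2) h
    simp [mCurve] at h0 h1 h2
    have hm := half_sub_mem hp
    have h3 := Real.injOn_sin (Ioo_subset_Icc_self hm) (Ioo_subset_Icc_self (half_sub_mem hq))
      (by simpa using h2)
    have h4 : t = s := by linarith
    subst h4
    have hc : Real.cos (1 / 2 - t) ≠ 0 := (Real.cos_pos_of_mem_Ioo hm).ne'
    rw [one_div] at hc
    have h5 := two_pi_inj (div_mem_Ico a) (div_mem_Ico b)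
      (by simpa [hc] using h0) (by simpa [hc] using h1)
    have hn : (n : ℝ) ≠ 0 := by exact_mod_cast a.pos.ne'
    have h6 : (a : ℝ) = b := by field_simp at h5; exact h5
    have h7 : a = b := Fin.ext (by exact_mod_cast h6)
    exact hpq (by rw [h7])
  · exact ⟨a, Or.inl (key a b t s hp hq h)⟩
  · exact ⟨b, Or.inr (key b a s t hq hp h.symm).symm⟩
  · exfalso
    simp only at h
    have h0 := congrArg (fun x : E3 => x 0) h
    have h1 := congrArg (fun x : E3 => x 1) h
    simp [mCurve] at h0 h1
    have h4 := two_pi_inj hp hq h0 h1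
    subst h4
    exact hpq (by rw [Subsingleton.elim a b])

theorem mCurve_contDiff (n : ℕ) (i : Comp n 1) : ContDiff ℝ ∞ (mCurve n i) := by
  rw [contDiff_euclidean]
  rcases i with a | a <;> intro c <;> fin_cases c <;> simp [mCurve] <;> fun_prop

theorem deriv_coord {f : ℝ → E3} (hf : Differentiable ℝ f) (t : ℝ) (c : Fin 3) :
    deriv f t c = deriv (fun u => f u c) t := by
  have h := (EuclideanSpace.proj (𝕜 := ℝ) c).hasFDerivAt.comp_hasDerivAt t (hf t).hasDerivAt
  exact h.deriv.symm

theorem mCurve_coord_deriv (n : ℕ) (i : Comp n 1) (t : ℝ) (c : Fin 3) :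
    deriv (mCurve n i) t c = deriv (fun u => mCurve n i u c) t :=
  deriv_coord ((mCurve_contDiff n i).differentiable (by simp)) t c

theorem mCurve_deriv_inl (n : ℕ) (a : Fin n) (t : ℝ) : deriv (mCurve n (.inl a)) t =
    !₂[Real.cos (2 * Real.pi * ((a : ℝ) / n)) * Real.sin (1 / 2 - t),
      Real.sin (2 * Real.pi * ((a : ℝ) / n)) * Real.sin (1 / 2 - t), - Real.cos (1 / 2 - t)] := by
  have hs : HasDerivAt (fun u : ℝ => 1 / 2 - u) (-1) t := by
    exact (hasDerivAt_id t).const_sub (1 / 2)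
  ext c
  rw [mCurve_coord_deriv]
  fin_cases c
  · simpa [mCurve] using (hs.cos.const_mul (Real.cos (2 * Real.pi * ((a : ℝ) / n)))).deriv
  · simpa [mCurve] using (hs.cos.const_mul (Real.sin (2 * Real.pi * ((a : ℝ) / n)))).deriv
  · simpa [mCurve] using hs.sin.deriv

theorem mCurve_deriv_inr (n : ℕ) (j : Fin 1) (t : ℝ) : deriv (mCurve n (.inr j)) t =
    !₂[- Real.sin (2 * Real.pi * t) * (2 * Real.pi),
      Real.cos (2 * Real.pi * t) * (2 * Real.pi), 0] := by
  have hs : HasDerivAt (fun u : ℝ => 2 * Real.pi * u) (2 * Real.pi) t := by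
    simpa using (hasDerivAt_id t).const_mul (2 * Real.pi)
  ext c
  rw [mCurve_coord_deriv]
  fin_cases c
  · simpa [mCurve] using hs.cos.deriv
  · simpa [mCurve] using hs.sin.deriv
  · simp [mCurve]

theorem mCrossing_mem (n : ℕ) (a : Fin n) :
    (mCrossing n a).1 ∈ points n 1 ∧ (mCrossing n a).2 ∈ points n 1 := by
  refine ⟨?_, div_mem_Ico a⟩
  change (1 / 2 : ℝ) ∈ Icc (0 : ℝ) 1
  constructor <;> norm_num

theorem mCrossing_eq (n : ℕ) (a : Fin n) :
    mCurve n (mCrossing n a).1.1 (mCrossing n a).1.2 =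
      mCurve n (mCrossing n a).2.1 (mCrossing n a).2.2 := by
  simp [mCrossing, mCurve]

theorem mCrossing_orient (n : ℕ) (a : Fin n) :
    orient (mCurve n (mCrossing n a).1.1 (mCrossing n a).1.2)
      (deriv (mCurve n (mCrossing n a).1.1) (mCrossing n a).1.2)
      (deriv (mCurve n (mCrossing n a).2.1) (mCrossing n a).2.2) = 2 * Real.pi := by
  simp only [mCrossing, mCurve_deriv_inl, mCurve_deriv_inr]
  simp [mCurve, orient, Matrix.det_fin_three]
  linear_combination (2 * Real.pi) * Real.sin_sq_add_cos_sq (2 * Real.pi * ((a : ℝ) / n))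

theorem orient_swap (x v w : E3) : orient x w v = - orient x v w := by
  simp [orient, Matrix.det_fin_three]
  ring

open Classical in
/-- The diagram `M n`: `n` trivial knotoid diagrams and one circle that runs under each of them once,
with positive crossings, all heads (parameter `0`) lying on the left side of the circle and all legs
(parameter `1`) on its right side. -/
def M (n : ℕ) : Diagram n 1 where
  curve := mCurve n
  crossings := Finset.univ.image (mCrossing n)
  smooth := mCurve_contDiff n
  periodic := by
    intro j t
    simp [mCurve, mul_add]
  mem_sphere := by
    rintro (a | a) t _ <;>
      rw [S2, mem_sphere_zero_iff_norm, EuclideanSpace.norm_eq, Real.sqrt_eq_one,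
        Fin.sum_univ_three] <;> simp [mCurve, mul_pow]
    linear_combination Real.cos (2⁻¹ - t) ^ 2 *
      Real.sin_sq_add_cos_sq (2 * Real.pi * ((a : ℝ) / n)) + Real.sin_sq_add_cos_sq (2⁻¹ - t)
  immersion := by
    rintro (a | a) t ht h
    · rw [mCurve_deriv_inl] at h
      have h2 := congrArg (fun x : E3 => x 2) h
      simp at h2
      have := Real.cos_pos_of_mem_Ioo (half_sub_mem ht)
      rw [one_div] at this
      linarith
    · rw [mCurve_deriv_inr] at h
      have h0 := congrArg (fun x : E3 => x 0) h
      have h1 := congrArg (fun x : E3 => x 1) h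
      simp [Real.pi_ne_zero] at h0 h1
      have := Real.sin_sq_add_cos_sq (2 * Real.pi * t)
      rw [h0, h1] at this
      norm_num at this
  transverse := by
    intro p hp q hq hpq h
    have hpi := Real.pi_pos
    obtain ⟨a, ⟨rfl, rfl⟩ | ⟨rfl, rfl⟩⟩ := mCurve_double hp hq hpq h
    · rw [mCrossing_orient]
      positivity
    · rw [h, orient_swap, mCrossing_orient]
      exact neg_ne_zero.2 (by positivity)
  no_triple := by
    rintro p hp q hq r hr hpq hpr hqr ⟨h1, h2⟩
    obtain ⟨a, ⟨rfl, rfl⟩ | ⟨rfl, rfl⟩⟩ := mCurve_double hp hq hpq h1 <;>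
    obtain ⟨b, ⟨e, rfl⟩ | ⟨e, rfl⟩⟩ := mCurve_double hp hr hpr h2
    · simp [mCrossing] at e
      subst e
      exact hqr rfl
    · simp [mCrossing] at e
    · simp [mCrossing] at e
    · obtain ⟨c, ⟨e1, e2⟩ | ⟨e1, e2⟩⟩ := mCurve_double hq hr hqr (h1.symm.trans h2) <;>
        simp [mCrossing] at e1 e2
  endpoint_simple := by
    intro i t ht q hq hne h
    have hp : ((.inl i, t) : Pt n 1) ∈ points n 1 := by
      change t ∈ Icc (0 : ℝ) 1
      rcases ht with rfl | rfl <;> simp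
    obtain ⟨a, ⟨_, e⟩ | ⟨_, e⟩⟩ := mCurve_double hq hp hne h
    · simp [mCrossing] at e
    · simp [mCrossing] at e
      rcases ht with rfl | rfl <;> norm_num at e
  crossing_double := by
    intro c hc
    obtain ⟨a, -, rfl⟩ := Finset.mem_image.1 hc
    exact ⟨(mCrossing_mem n a).1, (mCrossing_mem n a).2, by simp [mCrossing], mCrossing_eq n a⟩
  double_crossing := by
    intro p hp q hq hpq h
    obtain ⟨a, ⟨rfl, rfl⟩ | ⟨rfl, rfl⟩⟩ := mCurve_double hp hq hpq h
    · exact Or.inl (Finset.mem_image.2 ⟨a, Finset.mem_univ _, rfl⟩)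
    · exact Or.inr (Finset.mem_image.2 ⟨a, Finset.mem_univ _, rfl⟩)
  crossing_asymm := by
    intro p q h h'
    obtain ⟨a, -, e⟩ := Finset.mem_image.1 h
    obtain ⟨b, -, e'⟩ := Finset.mem_image.1 h'
    have h1 : p = (mCrossing n a).1 := by rw [e]
    have h2 : p = (mCrossing n b).2 := by rw [e']
    rw [h1] at h2
    simp [mCrossing] at h2

end MLinkoid

end

open Set Filter Topology
open scoped ContDiff

noncomputable section

namespace MLinkoid

/-! Parity of the number of crossings between two components. -/

/-! The cocycle identities are a finite check. The rest combines a parity invariant with a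
telescoping sum.

Crossing number. For each interval, the number of crossings in which it passes over the circle is
preserved modulo 2 by every move: a kink creates only self-crossings, a second move creates two
crossings with the same strand on top, a third move keeps one crossing for every pair of strands,
and a reparametrization at most permutes the intervals. In `M n` all these numbers are one. So in
every equivalent diagram each interval owns a crossing over the circle, which gives at least `n`
crossings (`Step.oddLinked_iff`, `OddLinked.le_card`).

Bound on the weight. Attach to a point of a strand the number `clash`, which is 1 if the region on
its right and its arc carry the two distinct nonzero colors, and 0 otherwise. Passing under a strand
does not change it; passing over a strand changes it by exactly the signed integer part of `φ` at
that crossing (`clash_over`, `clash_under`, `Coloring.state_crossing`). Hence `β` is the sum over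
the components of the net change of `clash`, which is 0 on a circle and -1, 0 or 1 on an interval.
If `α = 1`, some crossing has specified region 0, over-arc 0 and a nonzero under-arc. Whether region
and arc are 0 is constant along a component, so the two strands of this crossing belong to different
components and one of them is an interval. Along it the right region is always 0, so its `clash`
vanishes and it contributes nothing to `β`: the gain in `α` is paid for.

Attaining the bound. Color the regions 1 and 2 by the parity of the winding number of the circle,
the circle 0, and every interval 1 or 2, exchanging these at each passage under the circle, with
`clash` 1 at the leg. No region is 0, so `α = 0`. The net change of `clash` along an interval is
congruent modulo 2 to its number of passages over the circle, which is odd, and it equals 1 minus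
the value near the head; so it is 1 (`totalJump_checkColoring`), and `β = n`.

Two analytic ingredients support this: smooth coordinates in which both strands at a crossing are
coordinate axes (`Transverse`), and a two-valued function that changes across a closed curve
(`exists_checkerboard`). -/

theorem isQuandle3Cocycle_φ : IsQuandle3Cocycle φ := by
  refine ⟨?_, ?_⟩
  · intro a b c d
    cases a <;> cases b <;> cases c <;> cases d <;> rfl
  · intro x y
    cases x <;> cases y <;> exact ⟨rfl, rfl⟩

open Classical in
/-- The crossings in which the component `i` passes over the component `j`. -/
def Diagram.between {m k : ℕ} (D : Diagram m k) (i j : Comp m k) : Finset (Pt m k × Pt m k) :=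
  D.crossings.filter fun v => v.1.1 = i ∧ v.2.1 = j

theorem Diagram.mem_between {m k : ℕ} {D : Diagram m k} {i j : Comp m k}
    {v : Pt m k × Pt m k} : v ∈ D.between i j ↔ v ∈ D.crossings ∧ v.1.1 = i ∧ v.2.1 = j := by
  simp [Diagram.between]

/-- The parameters at which two strands meet. -/
def meets {r : ℕ} (σ : Fin r → ℝ → ℝ × ℝ) (a b : Fin r) : Set (ℝ × ℝ) :=
  {p | σ a p.1 = σ b p.2}

theorem ncard_meets_comm {r : ℕ} (σ : Fin r → ℝ → ℝ × ℝ) (a b : Fin r) :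
    (meets σ a b).ncard = (meets σ b a).ncard := by
  rw [← Set.ncard_image_of_injective (meets σ a b) Prod.swap_injective]
  congr 1
  ext ⟨u, v⟩
  simp [meets, eq_comm]

open Classical in
-- The chart is injective, so the double points of two strands on different components are the
-- common points of their planar models, and the heights decide for all of them at once which strand
-- is on top.
theorem card_strand_crossings {m k r : ℕ} {D : Diagram m k} {σ : Fin r → ℝ → ℝ × ℝ}
    {h : DiskChart} {comp : Fin r → Comp m k} {θ : Fin r → ℝ → ℝ} {height : Fin r → ℕ}
    (hθ : ∀ a u, θ a u ∈ Ioo (0 : ℝ) 1)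
    (hinj : ∀ a b u v, comp a = comp b → θ a u = θ b v → a = b ∧ u = v)
    (hc : ∀ a u, D.curve (comp a) (θ a u) = h.toFun (σ a u))
    (hh : ∀ a b u v, a ≠ b → ((comp a, θ a u), (comp b, θ b v)) ∈ D.crossings →
      height b < height a)
    {a b : Fin r} (hab : comp a ≠ comp b) :
    (D.crossings.filter fun v => ∃ p : ℝ × ℝ,
        v = ((comp a, θ a p.1), (comp b, θ b p.2))).card =
      if height b < height a then (meets σ a b).ncard else 0 := by
  have hab' : a ≠ b := fun e => hab (by rw [e])
  have hpt : ∀ a u, ((comp a, θ a u) : Pt m k) ∈ points m k := by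
    intro a u
    have := hθ a u
    change θ a u ∈ params (comp a)
    rcases comp a with i | i
    · exact Ioo_subset_Icc_self this
    · exact Ioo_subset_Ico_self this
  split_ifs with hlt
  · rw [← Set.ncard_coe_finset, ← Set.ncard_image_of_injective (meets σ a b)
      (f := fun p : ℝ × ℝ => (((comp a, θ a p.1), (comp b, θ b p.2)) : Pt m k × Pt m k))]
    · congr 1
      ext v
      simp only [Finset.coe_filter, mem_ofPred_eq, mem_image]
      constructor
      · rintro ⟨hv, p, rfl⟩
        refine ⟨p, ?_, rfl⟩
        have := (D.crossing_double _ hv).2.2.2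
        simp only [hc] at this
        have := congrArg h.invFun this
        rwa [h.left_inv, h.left_inv] at this
      · rintro ⟨p, hp, rfl⟩
        refine ⟨?_, p, rfl⟩
        have hp' : σ a p.1 = σ b p.2 := hp
        rcases D.double_crossing _ (hpt a p.1) _ (hpt b p.2)
          (fun e => hab (congrArg Prod.fst e)) (by simp only [hc, hp']) with h1 | h1
        · exact h1
        · exact absurd (hh b a _ _ hab'.symm h1) (by omega)
    · rintro ⟨u, v⟩ ⟨u', v'⟩ e
      simp only [Prod.mk.injEq] at e
      rw [(hinj a a u u' rfl e.1.2).2, (hinj b b v v' rfl e.2.2).2]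
  · rw [Finset.card_eq_zero, Finset.filter_eq_empty_iff]
    rintro v hv ⟨p, rfl⟩
    exact hlt (hh a b _ _ hab' hv)

open Classical in
-- Splits the count into crossings not formed by two strands of the disk, which a local move leaves
-- alone, and a term that depends on the planar model only.
theorem card_between_eq {m k r : ℕ} {D : Diagram m k} {σ : Fin r → ℝ → ℝ × ℝ}
    {h : DiskChart} {comp : Fin r → Comp m k} {θ : Fin r → ℝ → ℝ} {height : Fin r → ℕ}
    (hθ : ∀ a u, θ a u ∈ Ioo (0 : ℝ) 1)
    (hinj : ∀ a b u v, comp a = comp b → θ a u = θ b v → a = b ∧ u = v)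
    (hc : ∀ a u, D.curve (comp a) (θ a u) = h.toFun (σ a u))
    (hh : ∀ a b u v, a ≠ b → ((comp a, θ a u), (comp b, θ b v)) ∈ D.crossings →
      height b < height a)
    {i j : Comp m k} (hij : i ≠ j) :
    (D.between i j).card =
      ((D.between i j).filter fun v =>
        ((∀ a u, v.1 ≠ (comp a, θ a u)) ∨ (∀ a u, v.2 ≠ (comp a, θ a u)))).card +
      ∑ s : Fin r × Fin r, if comp s.1 = i ∧ comp s.2 = j ∧ height s.2 < height s.1 then
        (meets σ s.1 s.2).ncard else 0 := by
  rw [← Finset.card_filter_add_card_filter_not (s := D.between i j) (fun v =>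
        ((∀ a u, v.1 ≠ (comp a, θ a u)) ∨ (∀ a u, v.2 ≠ (comp a, θ a u))))]
  congr 1
  have key : (D.between i j).filter (fun v =>
      ¬ ((∀ a u, v.1 ≠ (comp a, θ a u)) ∨ (∀ a u, v.2 ≠ (comp a, θ a u)))) =
      Finset.univ.biUnion fun s : Fin r × Fin r => (D.between i j).filter fun v =>
        ∃ p : ℝ × ℝ, v = ((comp s.1, θ s.1 p.1), (comp s.2, θ s.2 p.2)) := by
    ext ⟨p, q⟩
    simp only [Finset.mem_filter, Finset.mem_biUnion, Finset.mem_univ, true_and]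
    push Not
    constructor
    · rintro ⟨hv, ⟨a, u, h1⟩, b, w, h2⟩
      exact ⟨(a, b), hv, (u, w), by rw [h1, h2]⟩
    · rintro ⟨⟨a, b⟩, hv, ⟨u, w⟩, e⟩
      simp only [Prod.mk.injEq] at e
      exact ⟨hv, ⟨a, u, e.1⟩, b, w, e.2⟩
  rw [key, Finset.card_biUnion]
  · refine Finset.sum_congr rfl fun s _ => ?_
    by_cases hs : comp s.1 = i ∧ comp s.2 = j
    · obtain ⟨h1, h2⟩ := hs
      have := card_strand_crossings hθ hinj hc hh (a := s.1) (b := s.2) (by rwa [h1, h2])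
      simp only [h1, h2, true_and]
      rw [← this]
      congr 1
      ext v
      simp only [Finset.mem_filter, Diagram.mem_between, and_congr_left_iff, h1, h2]
      rintro ⟨p, rfl⟩
      simp
    · rw [if_neg (fun e => hs ⟨e.1, e.2.1⟩), Finset.card_eq_zero, Finset.filter_eq_empty_iff]
      rintro v hv ⟨p, rfl⟩
      exact hs (Diagram.mem_between.1 hv).2
  · intro s _ s' _ hss
    rw [Function.onFun, Finset.disjoint_left]
    intro v hv hv'
    obtain ⟨p, rfl⟩ := (Finset.mem_filter.1 hv).2
    obtain ⟨p', e⟩ := (Finset.mem_filter.1 hv').2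
    simp only [Prod.mk.injEq] at e
    exact hss (Prod.ext (hinj _ _ _ _ e.1.1 e.1.2).1 (hinj _ _ _ _ e.2.1 e.2.2).1)

/-- Both diagrams share components and heights of the strands, so only the numbers of common points
of the planar models can differ. Strands on different components are distinct, hence self-crossings
never enter. -/
theorem LocalMove.between_parity {m k r : ℕ} {σ σ' : Fin r → ℝ → ℝ × ℝ} {D D' : Diagram m k}
    (H : LocalMove r σ σ' D D')
    (hσ : ∀ a b, a ≠ b → (meets σ a b).ncard ≡ (meets σ' a b).ncard [MOD 2])
    {i j : Comp m k} (hij : i ≠ j) :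
    (D.between i j).card ≡ (D'.between i j).card [MOD 2] := by
  classical
  obtain ⟨h, comp, θ, height, -, -, hθ, hinj, -, hc, hc', -, hout, hh, hh'⟩ := H
  rw [card_between_eq hθ hinj hc hh hij, card_between_eq hθ hinj hc' hh' hij]
  refine Nat.ModEq.add ?_ ?_
  · have : ∀ v : Pt m k × Pt m k,
        ((∀ a u, v.1 ≠ (comp a, θ a u)) ∨ (∀ a u, v.2 ≠ (comp a, θ a u))) →
        (v ∈ D.between i j ↔ v ∈ D'.between i j) := by
      rintro ⟨p, q⟩ hv
      rw [Diagram.mem_between, Diagram.mem_between, hout p q hv]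
    rw [Finset.card_bij (fun v _ => v) (t := (D'.between i j).filter fun v =>
        ((∀ a u, v.1 ≠ (comp a, θ a u)) ∨ (∀ a u, v.2 ≠ (comp a, θ a u))))]
    · intro v hv
      rw [Finset.mem_filter] at hv ⊢
      exact ⟨(this v hv.2).1 hv.1, hv.2⟩
    · exact fun _ _ _ _ e => e
    · intro v hv
      rw [Finset.mem_filter] at hv
      exact ⟨v, Finset.mem_filter.2 ⟨(this v hv.2).2 hv.1, hv.2⟩, rfl⟩
  · refine Nat.ModEq.sum fun s _ => ?_
    split_ifs with hs
    · exact hσ _ _ fun e => hij (by rw [← hs.1, ← hs.2.1, e])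
    · rfl

theorem R1.between_parity {m k : ℕ} {D D' : Diagram m k} (H : R1 D D')
    {i j : Comp m k} (hij : i ≠ j) :
    (D.between i j).card ≡ (D'.between i j).card [MOD 2] := by
  obtain ⟨p, -, -, -, H⟩ := H
  exact H.between_parity (fun a b hab => absurd (Subsingleton.elim a b) hab) hij

/-- The number of common points goes from 0 to 2, the zeros of `t ^ 2 - 1`. -/
theorem R2.between_parity {m k : ℕ} {D D' : Diagram m k} (H : R2 D D')
    {i j : Comp m k} (hij : i ≠ j) :
    (D.between i j).card ≡ (D'.between i j).card [MOD 2] := by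
  obtain ⟨f, -, hf, -, H⟩ := H
  refine H.between_parity ?_ hij
  have h1 : (meets ![fun t => (t, 0), fun t => (t, f t)] 0 1).ncard = 0 := by
    rw [show meets ![fun t => (t, 0), fun t => (t, f t)] 0 1 = ∅ from ?_, Set.ncard_empty]
    ext ⟨u, v⟩
    simpa [meets] using fun _ => (hf v).ne
  have h2 : (meets ![fun t => (t, 0), fun t : ℝ => (t, t ^ 2 - 1)] 0 1).ncard = 2 := by
    rw [show meets ![fun t => (t, 0), fun t : ℝ => (t, t ^ 2 - 1)] 0 1 = {(1, 1), (-1, -1)} from ?_,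
      Set.ncard_pair (by norm_num)]
    ext ⟨u, v⟩
    simp only [meets, Matrix.cons_val_zero, Matrix.cons_val_one, Prod.mk.injEq, mem_ofPred_eq,
      mem_insert_iff, mem_singleton_iff]
    constructor
    · rintro ⟨rfl, h⟩
      have : (u - 1) * (u + 1) = 0 := by linarith
      rcases mul_eq_zero.1 this with h | h
      · left; constructor <;> linarith
      · right; constructor <;> linarith
    · rintro (⟨rfl, rfl⟩ | ⟨rfl, rfl⟩) <;> norm_num
  intro a b hab
  fin_cases a <;> fin_cases b <;> try exact absurd rfl hab
  · change (meets _ 0 1).ncard ≡ (meets _ 0 1).ncard [MOD 2]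
    rw [h1, h2]; rfl
  · change (meets _ 1 0).ncard ≡ (meets _ 1 0).ncard [MOD 2]
    rw [ncard_meets_comm, h1, ncard_meets_comm, h2]; rfl

/-- The function `t - f t` is strictly increasing, and it equals `t` at `±2`, where it has opposite
signs. -/
theorem existsUnique_fixedPoint {f : ℝ → ℝ} (hf : ContDiff ℝ ∞ f) (hd : ∀ t, |deriv f t| < 1)
    (h0 : ∀ t, 2 ≤ |t| → f t = 0) : ∃! t, f t = t := by
  have hcont : Continuous fun t => t - f t := continuous_id.sub hf.continuous
  have hmono : StrictMono fun t => t - f t := by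
    refine strictMono_of_deriv_pos fun t => ?_
    have := ((hasDerivAt_id t).sub ((hf.differentiable (by simp)) t).hasDerivAt).deriv
    have h2 : deriv (fun t => t - f t) t = 1 - deriv f t := this
    rw [h2]
    linarith [(abs_lt.1 (hd t)).2]
  obtain ⟨t, -, ht⟩ := intermediate_value_Icc (show (-2 : ℝ) ≤ 2 by norm_num)
    hcont.continuousOn (show (0 : ℝ) ∈ Icc _ _ by
      rw [h0 2 (by norm_num), h0 (-2) (by norm_num)]; norm_num)
  refine ⟨t, by simp only at ht; linarith, fun s hs => hmono.injective ?_⟩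
  simp only at ht ⊢
  rw [ht]
  linarith

/-- The graph of `f` meets the diagonal in the fixed points of `f` and the antidiagonal in those of
`-f`. The hypotheses are stable under `f ↦ -f`, so this serves both sides of the third move. -/
theorem ncard_meets_r3 {f : ℝ → ℝ} (hf : ContDiff ℝ ∞ f) (hd : ∀ t, |deriv f t| < 1)
    (h0 : ∀ t, 2 ≤ |t| → f t = 0) {a b : Fin 3} (hab : a ≠ b) :
    (meets ![fun t => (t, t), fun t => (t, -t), fun t => (t, f t)] a b).ncard = 1 := by
  have hd' : ∀ t, |deriv (fun t => - f t) t| < 1 := by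
    intro t
    rw [deriv.fun_neg, abs_neg]
    exact hd t
  obtain ⟨u₁, hu₁, hu₁'⟩ := existsUnique_fixedPoint hf hd h0
  obtain ⟨u₂, hu₂, hu₂'⟩ := existsUnique_fixedPoint hf.neg hd' fun t ht => by simp [h0 t ht]
  have h01 : (meets ![fun t => (t, t), fun t => (t, -t), fun t => (t, f t)] 0 1).ncard = 1 := by
    rw [Set.ncard_eq_one]
    refine ⟨(0, 0), ?_⟩
    ext ⟨u, v⟩
    simp only [meets, Matrix.cons_val_zero, Matrix.cons_val_one, Prod.mk.injEq, mem_ofPred_eq,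
      mem_singleton_iff]
    constructor <;> rintro ⟨h1, h2⟩ <;> constructor <;> linarith
  have h02 : (meets ![fun t => (t, t), fun t => (t, -t), fun t => (t, f t)] 0 2).ncard = 1 := by
    rw [Set.ncard_eq_one]
    refine ⟨(u₁, u₁), ?_⟩
    ext ⟨u, v⟩
    simp only [meets, Matrix.cons_val, Prod.mk.injEq, mem_ofPred_eq, mem_singleton_iff]
    constructor
    · rintro ⟨rfl, h⟩
      exact ⟨hu₁' _ h.symm, hu₁' _ h.symm⟩
    · rintro ⟨rfl, rfl⟩
      exact ⟨rfl, hu₁.symm⟩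
  have h12 : (meets ![fun t => (t, t), fun t => (t, -t), fun t => (t, f t)] 1 2).ncard = 1 := by
    rw [Set.ncard_eq_one]
    refine ⟨(u₂, u₂), ?_⟩
    ext ⟨u, v⟩
    simp only [meets, Matrix.cons_val, Prod.mk.injEq, mem_ofPred_eq, mem_singleton_iff]
    constructor
    · rintro ⟨rfl, h⟩
      have : u = u₂ := hu₂' _ (by simp only; linarith)
      exact ⟨this, this⟩
    · rintro ⟨rfl, rfl⟩
      exact ⟨rfl, by linarith⟩
  fin_cases a <;> fin_cases b <;> try exact absurd rfl hab
  · exact h01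
  · exact h02
  · exact (ncard_meets_comm _ 1 0).trans h01
  · exact h12
  · exact (ncard_meets_comm _ 2 0).trans h02
  · exact (ncard_meets_comm _ 2 1).trans h12

theorem R3.between_parity {m k : ℕ} {D D' : Diagram m k} (H : R3 D D')
    {i j : Comp m k} (hij : i ≠ j) :
    (D.between i j).card ≡ (D'.between i j).card [MOD 2] := by
  obtain ⟨f, hf, hd, -, h0, H⟩ := H
  refine H.between_parity (fun a b hab => ?_) hij
  rw [ncard_meets_r3 hf hd h0 hab, ncard_meets_r3 (f := fun t => - f t) hf.neg
    (fun t => by rw [deriv.fun_neg, abs_neg]; exact hd t) (fun t ht => by simp [h0 t ht]) hab]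

/-! ### Invariance under reparametrization and the odd linking property. -/

theorem Reparam.card_between {m k : ℕ} {D D' : Diagram m k} (H : Reparam D D') :
    ∃ e : Equiv.Perm (Fin m), ∃ e' : Equiv.Perm (Fin k), ∀ i j,
      (D'.between i j).card = (D.between (Sum.map e e' i) (Sum.map e e' j)).card := by
  obtain ⟨e, e', ρ, hρ, hρ', hl, hr, -, hx⟩ := H
  refine ⟨e, e', fun i j => ?_⟩
  have hmono : ∀ i, StrictMono (ρ i) := fun i => strictMono_of_deriv_pos (hρ' i)
  have hsurj : ∀ i, ∀ s ∈ params (Sum.map e e' i), ∃ t ∈ params i, rep i (ρ i t) = s := by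
    rintro (i | i) s hs
    · change s ∈ Icc (0 : ℝ) 1 at hs
      rw [← (hl i).1, ← (hl i).2] at hs
      obtain ⟨t, ht, h⟩ := intermediate_value_Icc zero_le_one (hρ _).continuous.continuousOn hs
      exact ⟨t, ht, h⟩
    · change s ∈ Ico (0 : ℝ) 1 at hs
      have h1 : ρ (.inr i) 1 = ρ (.inr i) 0 + 1 := by simpa using hr i 0
      -- On a circle `ρ` maps `[0,1)` onto the unit interval starting at `ρ 0`, so `s` is first
      -- shifted into it by an integer.
      have hs' : s + ⌈ρ (.inr i) 0 - s⌉ ∈ Ico (ρ (.inr i) 0) (ρ (.inr i) 1) := by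
        rw [h1]
        have := Int.le_ceil (ρ (.inr i) 0 - s)
        have := Int.ceil_lt_add_one (ρ (.inr i) 0 - s)
        constructor <;> linarith
      obtain ⟨t, ht, h⟩ := intermediate_value_Ico zero_le_one (hρ _).continuous.continuousOn hs'
      refine ⟨t, ht, ?_⟩
      change Int.fract (ρ _ t) = s
      rw [h, Int.fract_add_intCast, Int.fract_eq_self.2 hs]
  have hinj : ∀ i, ∀ t ∈ params i, ∀ s ∈ params i, rep i (ρ i t) = rep i (ρ i s) → t = s := by
    rintro (i | i) t ht s hs h
    · exact (hmono _).injective h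
    · change t ∈ Ico (0 : ℝ) 1 at ht
      change s ∈ Ico (0 : ℝ) 1 at hs
      have h1 : ρ (.inr i) 1 = ρ (.inr i) 0 + 1 := by simpa using hr i 0
      -- Both values lie in one half-open interval of length one, so their integral difference `z`
      -- is 0.
      obtain ⟨z, hz⟩ := Int.fract_eq_fract.1 (show Int.fract _ = Int.fract _ from h)
      have h2 := (hmono (.inr i)).monotone ht.1
      have h3 := (hmono (.inr i)) ht.2
      have h4 := (hmono (.inr i)).monotone hs.1
      have h5 := (hmono (.inr i)) hs.2
      have h6 : (z : ℝ) < 1 := by linarith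
      have h7 : (-1 : ℝ) < z := by linarith
      have h8 : z = 0 := by
        have : z < 1 := by exact_mod_cast h6
        have : -1 < z := by exact_mod_cast h7
        omega
      refine (hmono (.inr i)).injective ?_
      rw [h8] at hz
      push_cast at hz
      linarith
  refine Finset.card_bij (fun v _ => ((Sum.map e e' v.1.1, rep v.1.1 (ρ v.1.1 v.1.2)),
    (Sum.map e e' v.2.1, rep v.2.1 (ρ v.2.1 v.2.2)))) ?_ ?_ ?_
  · rintro ⟨p, q⟩ hv
    obtain ⟨hw, rfl, rfl⟩ := Diagram.mem_between.1 hv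
    have hd := D'.crossing_double _ hw
    exact Diagram.mem_between.2 ⟨(hx p hd.1 q hd.2.1).1 hw, rfl, rfl⟩
  · rintro ⟨p, q⟩ hv ⟨p', q'⟩ hv' h
    obtain ⟨hw, h1, h2⟩ := Diagram.mem_between.1 hv
    obtain ⟨hw', h1', h2'⟩ := Diagram.mem_between.1 hv'
    have hd := D'.crossing_double _ hw
    have hd' := D'.crossing_double _ hw'
    obtain ⟨p1, p2⟩ := p
    obtain ⟨q1, q2⟩ := q
    obtain ⟨p1', p2'⟩ := p'
    obtain ⟨q1', q2'⟩ := q'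
    simp only at h1 h2 h1' h2'
    subst h1 h2 h1' h2'
    simp only [Prod.mk.injEq, true_and] at h
    have h1 : p2 = p2' := hinj _ _ hd.1 _ hd'.1 h.1
    have h2 : q2 = q2' := hinj _ _ hd.2.1 _ hd'.2.1 h.2
    rw [h1, h2]
  · rintro ⟨⟨p1, p2⟩, ⟨q1, q2⟩⟩ hv
    obtain ⟨hv, h1, h2⟩ := Diagram.mem_between.1 hv
    have hd := D.crossing_double _ hv
    simp only at h1 h2
    subst h1 h2
    obtain ⟨t, ht, h3⟩ := hsurj _ _ hd.1
    obtain ⟨s, hs, h4⟩ := hsurj _ _ hd.2.1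
    refine ⟨((i, t), (j, s)), Diagram.mem_between.2 ⟨(hx _ ht _ hs).2 ?_, rfl, rfl⟩, ?_⟩
    · simpa only [h3, h4] using hv
    · simp only [h3, h4]

/-- Every interval passes over the circle an odd number of times. -/
def OddLinked {n : ℕ} (D : Diagram n 1) : Prop :=
  ∀ a : Fin n, Odd (D.between (.inl a) (.inr 0)).card

/-- A reparametrization may permute the intervals, so the parities are preserved only jointly; the
single circle is necessarily kept. -/
theorem Step.oddLinked_iff {n : ℕ} {D D' : Diagram n 1} (H : Step D D') :
    OddLinked D ↔ OddLinked D' := by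
  have key : (∀ a : Fin n, (D.between (.inl a) (.inr 0)).card ≡
      (D'.between (.inl a) (.inr 0)).card [MOD 2]) → (OddLinked D ↔ OddLinked D') := by
    intro h
    refine forall_congr' fun a => ?_
    rw [Nat.odd_iff, Nat.odd_iff, h a]
  rcases H with H | H | H | H | H
  · obtain ⟨e, e', h⟩ := H.card_between
    have h' : ∀ a, (D'.between (.inl a) (.inr 0)).card =
        (D.between (.inl (e a)) (.inr 0)).card := by
      intro a
      rw [h, Sum.map_inl, Sum.map_inr, Subsingleton.elim (e' 0) 0]
    constructor
    · intro hD a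
      rw [h']
      exact hD _
    · intro hD a
      have := hD (e.symm a)
      rwa [h', Equiv.apply_symm_apply] at this
  · obtain ⟨Φ, -, h⟩ := H
    refine key fun a => ?_
    rw [Diagram.between, Diagram.between, h]
  · exact key fun a => H.between_parity (by simp)
  · exact key fun a => H.between_parity (by simp)
  · exact key fun a => H.between_parity (by simp)

theorem oddLinked_iff_of_linkoid_eq {n : ℕ} {D D' : Diagram n 1} (H : D.linkoid = D'.linkoid) :
    OddLinked D ↔ OddLinked D' := by
  have h : Relation.EqvGen Step D D' := Quotient.exact H
  induction h with
  | rel _ _ h => exact h.oddLinked_iff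
  | refl _ => rfl
  | symm _ _ _ ih => exact (ih (Quotient.sound (by assumption))).symm
  | trans _ _ _ h1 h2 ih1 ih2 => exact (ih1 (Quotient.sound h1)).trans (ih2 (Quotient.sound h2))

/-! ### The crossing number of `M n`. -/

theorem mCrossing_injective (n : ℕ) : Function.Injective (mCrossing n) := by
  intro a b h
  simpa [mCrossing] using congrArg (fun v => v.1.1) h

theorem oddLinked_M (n : ℕ) : OddLinked (M n) := by
  intro a
  have : (M n).between (.inl a) (.inr 0) = {mCrossing n a} := by
    ext v
    rw [Diagram.mem_between, Finset.mem_singleton]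
    constructor
    · rintro ⟨hv, h, -⟩
      obtain ⟨b, -, rfl⟩ := Finset.mem_image.1 hv
      have : b = a := Sum.inl_injective h
      rw [this]
    · rintro rfl
      exact ⟨Finset.mem_image_of_mem _ (Finset.mem_univ _), rfl, rfl⟩
  rw [this, Finset.card_singleton]
  exact odd_one

/-- An odd number is positive: choose for each interval a crossing in which it is the over-strand.
Different intervals get different crossings. -/
theorem OddLinked.le_card {n : ℕ} {D : Diagram n 1} (H : OddLinked D) :
    n ≤ D.crossings.card := by
  choose f hf using fun a => Finset.card_pos.1 (H a).pos
  have h : Function.Injective f := by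
    intro a b e
    have h1 := (Diagram.mem_between.1 (hf a)).2.1
    rw [e, (Diagram.mem_between.1 (hf b)).2.1] at h1
    exact (Sum.inl_injective h1).symm
  simpa using Finset.card_le_card_of_injOn (s := Finset.univ) f
    (fun a _ => (Diagram.mem_between.1 (hf a)).1) h.injOn

theorem crossingNumber_M (n : ℕ) : (M n).linkoid.crossingNumber = n := by
  apply le_antisymm
  · refine Nat.sInf_le ⟨M n, rfl, ?_⟩
    rw [M, Finset.card_image_of_injective _ (mCrossing_injective n), Finset.card_univ,
      Fintype.card_fin]
  · refine le_csInf ⟨_, M n, rfl, rfl⟩ ?_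
    rintro N ⟨D, hD, rfl⟩
    exact ((oddLinked_iff_of_linkoid_eq hD).2 (oddLinked_M n)).le_card

/-! Local coordinates of the sphere at a transverse double point. -/

theorem orient_comb (x v u : E3) (a b c : ℝ) :
    orient x v (a • v + b • u + c • x) = b * orient x v u := by
  simp [orient, Matrix.det_fin_three]
  ring

theorem orient_comb_left (x v u : E3) (a b c : ℝ) :
    orient x (a • v + b • u + c • x) u = a * orient x v u := by
  simp [orient, Matrix.det_fin_three]
  ring

theorem orient_comb_base (x v u : E3) (a b c : ℝ) :
    orient (a • v + b • u + c • x) v u = c * orient x v u := by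
  simp [orient, Matrix.det_fin_three]
  ring

theorem orient_zero (v u : E3) : orient 0 v u = 0 ∧ orient v 0 u = 0 ∧ orient v u 0 = 0 := by
  simp [orient, Matrix.det_fin_three]

theorem continuous_orient {f g h : ℝ → E3} (hf : Continuous f) (hg : Continuous g)
    (hh : Continuous h) : Continuous fun t => orient (f t) (g t) (h t) := by
  simp only [orient, Matrix.det_fin_three]
  simp
  fun_prop

/-- The linear map with the columns `v`, `u`, `x`. -/
def frameMap (v u x : E3) : ℝ × ℝ × ℝ →L[ℝ] E3 :=
  (ContinuousLinearMap.fst ℝ ℝ (ℝ × ℝ)).smulRight v +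
    ((ContinuousLinearMap.fst ℝ ℝ ℝ).comp (ContinuousLinearMap.snd ℝ ℝ (ℝ × ℝ))).smulRight u +
    ((ContinuousLinearMap.snd ℝ ℝ ℝ).comp (ContinuousLinearMap.snd ℝ ℝ (ℝ × ℝ))).smulRight x

theorem frameMap_apply (v u x : E3) (p : ℝ × ℝ × ℝ) :
    frameMap v u x p = p.1 • v + p.2.1 • u + p.2.2 • x := rfl

/-- Cramer's rule: the coefficients of a vector in the frame are determinants with one column
replaced, divided by `orient x v u`. -/
theorem frameMap_injective {v u x : E3} (h : orient x v u ≠ 0) :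
    Function.Injective (frameMap v u x) := by
  rw [injective_iff_map_eq_zero]
  rintro ⟨a, b, c⟩ hp
  rw [frameMap_apply] at hp
  simp only at hp
  have h1 := orient_comb x v u a b c
  have h2 := orient_comb_left x v u a b c
  have h3 := orient_comb_base x v u a b c
  rw [hp] at h1 h2 h3
  simp only [orient_zero] at h1 h2 h3
  have e1 := (mul_eq_zero.1 h1.symm).resolve_right h
  have e2 := (mul_eq_zero.1 h2.symm).resolve_right h
  have e3 := (mul_eq_zero.1 h3.symm).resolve_right h
  rw [e1, e2, e3]
  rfl

/-- A frame of space as a linear isomorphism. -/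
def frameEquiv {v u x : E3} (h : orient x v u ≠ 0) : (ℝ × ℝ × ℝ) ≃L[ℝ] E3 :=
  (LinearMap.linearEquivOfInjective (frameMap v u x : ℝ × ℝ × ℝ →ₗ[ℝ] E3) (frameMap_injective h)
    (by simp)).toContinuousLinearEquiv

theorem frameEquiv_coe {v u x : E3} (h : orient x v u ≠ 0) :
    (frameEquiv h : ℝ × ℝ × ℝ →L[ℝ] E3) = frameMap v u x := by
  exact ContinuousLinearMap.ext fun p => rfl

/-- Two smooth curves that meet transversely in a point of the sphere. -/
structure Transverse (γ δ : ℝ → E3) (t₀ s₀ : ℝ) : Prop where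
  smooth_left : ContDiff ℝ ∞ γ
  smooth_right : ContDiff ℝ ∞ δ
  eq : γ t₀ = δ s₀
  norm_eq : ‖γ t₀‖ = 1
  orient_ne : orient (γ t₀) (deriv γ t₀) (deriv δ s₀) ≠ 0

theorem Transverse.symm {γ δ : ℝ → E3} {t₀ s₀ : ℝ} (H : Transverse γ δ t₀ s₀) :
    Transverse δ γ s₀ t₀ where
  smooth_left := H.smooth_right
  smooth_right := H.smooth_left
  eq := H.eq.symm
  norm_eq := H.eq ▸ H.norm_eq
  orient_ne := by
    rw [orient_swap, ← H.eq]
    exact neg_ne_zero.2 H.orient_ne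

/-- The translation surface of two curves, in a cone over the sphere. -/
def coneMap (γ δ : ℝ → E3) (x : E3) (p : ℝ × ℝ × ℝ) : E3 := p.2.2 • (γ p.1 + δ p.2.1 - x)

/-- The translation surface of two curves, projected to the sphere. -/
def crossMap (γ δ : ℝ → E3) (x : E3) (p : ℝ × ℝ) : E3 :=
  ‖γ p.1 + δ p.2 - x‖⁻¹ • (γ p.1 + δ p.2 - x)

theorem crossMap_swap (γ δ : ℝ → E3) (x : E3) (p : ℝ × ℝ) :
    crossMap δ γ x p.swap = crossMap γ δ x p := by
  simp [crossMap, add_comm]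

theorem mem_S2 {x : E3} : x ∈ S2 ↔ ‖x‖ = 1 := mem_sphere_zero_iff_norm

namespace Transverse

variable {γ δ : ℝ → E3} {t₀ s₀ : ℝ}

/-- The coordinate axis `s = s₀` is the first curve itself; by symmetry the axis `t = t₀` is the
second. -/
theorem crossMap_left (H : Transverse γ δ t₀ s₀) {t : ℝ} (ht : γ t ∈ S2) :
    crossMap γ δ (γ t₀) (t, s₀) = γ t := by
  simp [crossMap, ← H.eq, mem_S2.1 ht]

theorem contDiff_coneMap (H : Transverse γ δ t₀ s₀) : ContDiff ℝ ∞ (coneMap γ δ (γ t₀)) := by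
  have h1 := H.smooth_left
  have h2 := H.smooth_right
  unfold coneMap
  fun_prop

theorem hasFDerivAt_coneMap (H : Transverse γ δ t₀ s₀) (t : ℝ) :
    HasFDerivAt (coneMap γ δ (γ t₀)) (frameMap (deriv γ t) (deriv δ s₀) (γ t)) (t, s₀, 1) := by
  have h1 : HasFDerivAt (fun p : ℝ × ℝ × ℝ => γ p.1) _ (t, s₀, (1 : ℝ)) :=
    ((H.smooth_left.differentiable (by simp)) t).hasDerivAt.hasFDerivAt.comp (t, s₀, (1 : ℝ))
      hasFDerivAt_fst
  have h2 : HasFDerivAt (fun p : ℝ × ℝ × ℝ => δ p.2.1) _ (t, s₀, (1 : ℝ)) :=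
    ((H.smooth_right.differentiable (by simp)) s₀).hasDerivAt.hasFDerivAt.comp (t, s₀, (1 : ℝ))
      (hasFDerivAt_fst.comp (t, s₀, (1 : ℝ)) hasFDerivAt_snd)
  have h3 : HasFDerivAt (fun p : ℝ × ℝ × ℝ => p.2.2) _ (t, s₀, (1 : ℝ)) :=
    ((ContinuousLinearMap.snd ℝ ℝ ℝ).comp (ContinuousLinearMap.snd ℝ ℝ (ℝ × ℝ))).hasFDerivAt
  refine (h3.smul ((h1.add h2).sub_const (γ t₀))).congr_fderiv ?_
  refine ContinuousLinearMap.ext fun p => ?_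
  simp [frameMap_apply, H.eq]

/-- The derivative of `coneMap` at the double point is the frame of the two velocities and the
position vector, invertible by transversality, so the inverse function theorem applies. The third
coordinate is radial; on the sphere the first two are local coordinates. -/
theorem exists_chart (H : Transverse γ δ t₀ s₀) : ∃ ψ : E3 → ℝ × ℝ × ℝ,
    (∀ᶠ p in 𝓝 (t₀, s₀, (1 : ℝ)), ψ (coneMap γ δ (γ t₀) p) = p) ∧
    (∀ᶠ y in 𝓝 (γ t₀), coneMap γ δ (γ t₀) (ψ y) = y) ∧
    (∀ᶠ y in 𝓝 (γ t₀), DifferentiableAt ℝ ψ y) ∧ ψ (γ t₀) = (t₀, s₀, 1) := by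
  have hd : HasFDerivAt (coneMap γ δ (γ t₀))
      (frameEquiv H.orient_ne : ℝ × ℝ × ℝ →L[ℝ] E3) (t₀, s₀, 1) := by
    rw [frameEquiv_coe]
    exact H.hasFDerivAt_coneMap t₀
  have hc : ContDiffAt ℝ ∞ (coneMap γ δ (γ t₀)) (t₀, s₀, 1) := H.contDiff_coneMap.contDiffAt
  have h0 : coneMap γ δ (γ t₀) (t₀, s₀, 1) = γ t₀ := by simp [coneMap, H.eq]
  set Φ := hc.toOpenPartialHomeomorph _ hd (by simp) with hΦ
  have hcoe : (Φ : ℝ × ℝ × ℝ → E3) = coneMap γ δ (γ t₀) :=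
    hc.toOpenPartialHomeomorph_coe hd (by simp)
  have hsrc : ((t₀, s₀, 1) : ℝ × ℝ × ℝ) ∈ Φ.source :=
    hc.mem_toOpenPartialHomeomorph_source hd (by simp)
  have htgt : γ t₀ ∈ Φ.target := by
    have := Φ.map_source hsrc
    rwa [hcoe, h0] at this
  refine ⟨Φ.symm, ?_, ?_, ?_, ?_⟩
  · filter_upwards [Φ.open_source.mem_nhds hsrc] with p hp
    rw [← hcoe]
    exact Φ.left_inv hp
  · filter_upwards [Φ.open_target.mem_nhds htgt] with p hp
    rw [← hcoe]
    exact Φ.right_inv hp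
  · have h1 : ContDiffAt ℝ ∞ Φ.symm (coneMap γ δ (γ t₀) (t₀, s₀, 1)) :=
      hc.to_localInverse hd (by simp)
    rw [h0] at h1
    have h2 : ContDiffAt ℝ 1 Φ.symm (γ t₀) := h1.of_le (by simp)
    filter_upwards [h2.eventually (by simp)] with y hy
    exact hy.differentiableAt (by simp)
  · have := Φ.left_inv hsrc
    rwa [hcoe, h0] at this

/-- `crossMap` is `coneMap` with the radial coordinate set to the inverse norm. This limit lets
statements about the chart in space be restricted to the sphere. -/
theorem tendsto_cone (H : Transverse γ δ t₀ s₀) :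
    Tendsto (fun p : ℝ × ℝ => (p.1, p.2, ‖γ p.1 + δ p.2 - γ t₀‖⁻¹)) (𝓝 (t₀, s₀))
      (𝓝 (t₀, s₀, 1)) := by
  have h1 := H.smooth_left.continuous
  have h2 := H.smooth_right.continuous
  have h3 : ContinuousAt (fun p : ℝ × ℝ => (p.1, p.2, ‖γ p.1 + δ p.2 - γ t₀‖⁻¹)) (t₀, s₀) := by
    refine continuousAt_fst.prodMk (continuousAt_snd.prodMk (ContinuousAt.inv₀ ?_ ?_))
    · fun_prop
    · simp [← H.eq, H.norm_eq]
  have h4 := h3.tendsto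
  simpa [← H.eq, H.norm_eq] using h4

theorem eventually_ne (H : Transverse γ δ t₀ s₀) :
    ∀ᶠ p : ℝ × ℝ in 𝓝 (t₀, s₀), γ p.1 + δ p.2 - γ t₀ ≠ 0 := by
  have h1 := H.smooth_left.continuous
  have h2 := H.smooth_right.continuous
  have h3 : Continuous fun p : ℝ × ℝ => γ p.1 + δ p.2 - γ t₀ := by fun_prop
  refine h3.continuousAt.eventually_ne ?_
  have := H.norm_eq
  intro h
  simp only [← H.eq, add_sub_cancel_right] at h
  rw [h] at this
  simp at this

theorem eventually_mem (H : Transverse γ δ t₀ s₀) :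
    ∀ᶠ p : ℝ × ℝ in 𝓝 (t₀, s₀), crossMap γ δ (γ t₀) p ∈ S2 := by
  filter_upwards [H.eventually_ne] with p hp
  rw [mem_S2, crossMap, norm_smul, norm_inv, norm_norm, inv_mul_cancel₀ (norm_ne_zero_iff.2 hp)]

theorem eventually_continuousAt (H : Transverse γ δ t₀ s₀) :
    ∀ᶠ p : ℝ × ℝ in 𝓝 (t₀, s₀), ContinuousAt (crossMap γ δ (γ t₀)) p := by
  have h1 := H.smooth_left.continuous
  have h2 := H.smooth_right.continuous
  have h3 : Continuous fun p : ℝ × ℝ => γ p.1 + δ p.2 - γ t₀ := by fun_prop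
  filter_upwards [H.eventually_ne] with p hp
  exact (h3.norm.continuousAt.inv₀ (norm_ne_zero_iff.2 hp)).smul h3.continuousAt

theorem tendsto_crossMap (H : Transverse γ δ t₀ s₀) :
    Tendsto (crossMap γ δ (γ t₀)) (𝓝 (t₀, s₀)) (𝓝 (γ t₀)) := by
  have h := H.eventually_continuousAt.self_of_nhds.tendsto
  rwa [H.crossMap_left (mem_S2.2 H.norm_eq)] at h

theorem exists_injOn (H : Transverse γ δ t₀ s₀) :
    ∃ U ∈ 𝓝 (t₀, s₀), InjOn (crossMap γ δ (γ t₀)) U := by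
  obtain ⟨ψ, h1, -⟩ := H.exists_chart
  refine ⟨_, H.tendsto_cone.eventually h1, ?_⟩
  intro p hp q hq h
  -- By definition `crossMap` at `p` is `coneMap` at the triple completed by the inverse norm, so
  -- `ψ` recovers `p`.
  have hp' : ψ (crossMap γ δ (γ t₀) p) = _ := hp
  have hq' : ψ (crossMap γ δ (γ t₀) q) = _ := hq
  rw [h, hq'] at hp'
  simp only [Prod.mk.injEq] at hp'
  exact Prod.ext hp'.1.symm hp'.2.1.symm

/-- Near a point of the cone, the coordinates of a point of the sphere recover the point. -/
theorem crossMap_of_cone {x y : E3} {p : ℝ × ℝ × ℝ} (h : coneMap γ δ x p = y) (hy : ‖y‖ = 1)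
    (hp : 0 < p.2.2) : crossMap γ δ x (p.1, p.2.1) = y := by
  rw [coneMap] at h
  have h1 : p.2.2 * ‖γ p.1 + δ p.2.1 - x‖ = 1 := by
    rw [← hy, ← h, norm_smul, Real.norm_of_nonneg hp.le]
  rw [crossMap, ← eq_inv_of_mul_eq_one_left h1, h]

/-- The patch covers a neighborhood in the sphere: read off the coordinates by `ψ` and drop the
radial one. -/
theorem eventually_exists (H : Transverse γ δ t₀ s₀) {P : ℝ × ℝ → Prop}
    (hP : ∀ᶠ p in 𝓝 (t₀, s₀), P p) :
    ∀ᶠ y in 𝓝 (γ t₀), y ∈ S2 → ∃ p, P p ∧ crossMap γ δ (γ t₀) p = y := by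
  obtain ⟨ψ, -, h2, h3, h4⟩ := H.exists_chart
  have hψ : Tendsto ψ (𝓝 (γ t₀)) (𝓝 (t₀, s₀, 1)) := by
    rw [← h4]
    exact h3.self_of_nhds.continuousAt
  have h5 : Tendsto (fun p : ℝ × ℝ × ℝ => (p.1, p.2.1)) (𝓝 (t₀, s₀, 1)) (𝓝 (t₀, s₀)) :=
    Continuous.tendsto (by fun_prop) (t₀, s₀, (1 : ℝ))
  have h6 : ∀ᶠ p : ℝ × ℝ × ℝ in 𝓝 (t₀, s₀, 1), 0 < p.2.2 :=
    Continuous.tendsto (f := fun p : ℝ × ℝ × ℝ => p.2.2) (by fun_prop) (t₀, s₀, (1 : ℝ))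
      |>.eventually (lt_mem_nhds one_pos)
  filter_upwards [h2, (h5.comp hψ).eventually hP, hψ.eventually h6] with y h7 h8 h9 hy
  exact ⟨_, h8, crossMap_of_cone h7 (mem_S2.1 hy) h9⟩

theorem eventually_of_deriv_pos {f : ℝ → ℝ} {f' : ℝ} (hf : HasDerivWithinAt f f' (Ici 0) 0)
    (h : 0 < f') : ∀ᶠ s in 𝓝[>] (0 : ℝ), f 0 < f s := by
  have h1 := (hasDerivWithinAt_iff_tendsto_slope.1 hf).eventually (lt_mem_nhds h)
  have h2 : Ici (0 : ℝ) \ {0} = Ioi 0 := Ici_sdiff_left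
  rw [h2] at h1
  filter_upwards [h1, self_mem_nhdsWithin] with s hs hs0
  rw [slope_def_field] at hs
  have hs0 : 0 < s := hs0
  have := (div_pos_iff_of_pos_right (by linarith)).1 hs
  linarith

/-- A path that leaves the first curve transversely enters the part of the coordinate patch on the
corresponding side. -/
theorem eventually_path (H : Transverse γ δ t₀ s₀) {P : ℝ × ℝ → Prop}
    (hP : ∀ᶠ p in 𝓝 (t₀, s₀), P p) :
    ∀ᶠ t in 𝓝 t₀, γ t ∈ S2 → ∀ (b : ℝ) (α : ℝ → E3) (w : E3), (∀ s, α s ∈ S2) → α 0 = γ t →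
      HasDerivWithinAt α w (Ici 0) 0 →
      0 < b * orient (γ t₀) (deriv γ t₀) (deriv δ s₀) * orient (γ t) (deriv γ t) w →
      ∀ᶠ s in 𝓝[>] (0 : ℝ), ∃ p, crossMap γ δ (γ t₀) p = α s ∧ P p ∧ 0 < b * (p.2 - s₀) ∧
        ∀ a, 0 < a * (t - t₀) → 0 < a * (p.1 - t₀) := by
  obtain ⟨ψ, h1, h2, h3, h4⟩ := H.exists_chart
  have hγ : Tendsto γ (𝓝 t₀) (𝓝 (γ t₀)) := H.smooth_left.continuous.tendsto t₀
  have hline : Tendsto (fun t : ℝ => (t, s₀, (1 : ℝ))) (𝓝 t₀) (𝓝 (t₀, s₀, 1)) :=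
    Continuous.tendsto (by fun_prop) t₀
  have hline' : Tendsto (fun t : ℝ => (t, s₀)) (𝓝 t₀) (𝓝 (t₀, s₀)) :=
    Continuous.tendsto (by fun_prop) t₀
  -- For `t` near `t₀` the frame at `γ t` is still nondegenerate and oriented as at `t₀`.
  have hor : ∀ᶠ t in 𝓝 t₀, 0 < orient (γ t₀) (deriv γ t₀) (deriv δ s₀) *
      orient (γ t) (deriv γ t) (deriv δ s₀) := by
    have hd : Continuous (deriv γ) := H.smooth_left.continuous_deriv (by simp)
    have hc := (continuous_const (y := orient (γ t₀) (deriv γ t₀) (deriv δ s₀))).mul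
      (continuous_orient H.smooth_left.continuous hd (continuous_const (y := deriv δ s₀)))
    exact (hc.tendsto t₀).eventually (lt_mem_nhds (mul_self_pos.2 H.orient_ne))
  filter_upwards [hγ.eventually h2.eventually_nhds, hγ.eventually h3,
    hline.eventually h1.eventually_nhds, hline'.eventually hP.eventually_nhds, hor]
    with t k2 k3 k1 kP kor hS b α w hα hα0 hαw hpos
  have hcone : coneMap γ δ (γ t₀) (t, s₀, 1) = γ t := by simp [coneMap, ← H.eq]
  have hψt : ψ (γ t) = (t, s₀, 1) := by rw [← hcone]; exact k1.self_of_nhds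
  have hαc : Tendsto α (𝓝[>] 0) (𝓝 (γ t)) := by
    rw [← hα0]
    exact (hαw.continuousWithinAt.mono Ioi_subset_Ici_self)
  have hψα : Tendsto (fun s => ψ (α s)) (𝓝[>] 0) (𝓝 (t, s₀, 1)) := by
    rw [← hψt]
    exact k3.continuousAt.tendsto.comp hαc
  have hne : orient (γ t) (deriv γ t) (deriv δ s₀) ≠ 0 := fun e => by
    rw [e, mul_zero] at kor
    exact lt_irrefl _ kor
  obtain ⟨q, rfl⟩ := (frameEquiv hne).surjective w
  have hqw : frameEquiv hne q = frameMap (deriv γ t) (deriv δ s₀) (γ t) q := by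
    rw [← frameEquiv_coe hne]
    rfl
  -- The derivative of `ψ` inverts the frame at `γ t`: the initial velocity of the path, in
  -- coordinates, is its coefficient vector `q`. Its second entry has the sign that decides the
  -- side.
  have hfd : fderiv ℝ ψ (γ t) (frameEquiv hne q) = q := by
    have e1 : HasFDerivAt (fun p => ψ (coneMap γ δ (γ t₀) p))
        ((fderiv ℝ ψ (γ t)).comp (frameMap (deriv γ t) (deriv δ s₀) (γ t))) (t, s₀, 1) := by
      refine HasFDerivAt.comp _ ?_ (H.hasFDerivAt_coneMap t)
      rw [hcone]
      exact k3.hasFDerivAt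
    have e2 : HasFDerivAt (fun p => ψ (coneMap γ δ (γ t₀) p))
        (ContinuousLinearMap.id ℝ (ℝ × ℝ × ℝ)) (t, s₀, 1) :=
      (hasFDerivAt_id _).congr_of_eventuallyEq k1
    rw [hqw]
    exact congrArg (fun L : (ℝ × ℝ × ℝ) →L[ℝ] (ℝ × ℝ × ℝ) => L q) (e1.unique e2)
  have hq : 0 < b * q.2.1 := by
    rw [hqw, frameMap_apply, orient_comb] at hpos
    have : 0 < b * q.2.1 * (orient (γ t₀) (deriv γ t₀) (deriv δ s₀) *
      orient (γ t) (deriv γ t) (deriv δ s₀)) := by linarith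
    exact pos_of_mul_pos_left this kor.le
  have hder : HasDerivWithinAt (fun s => b * ((ψ (α s)).2.1 - s₀)) (b * q.2.1) (Ici 0) 0 := by
    have e1 : HasDerivWithinAt (fun s => ψ (α s)) q (Ici 0) 0 := by
      rw [← hfd]
      refine HasFDerivAt.comp_hasDerivWithinAt (0 : ℝ) ?_ hαw
      rw [hα0]
      exact k3.hasFDerivAt
    have e2 := ((ContinuousLinearMap.fst ℝ ℝ ℝ).comp
      (ContinuousLinearMap.snd ℝ ℝ (ℝ × ℝ))).hasFDerivAt (x := ψ (α 0))
        |>.comp_hasDerivWithinAt (0 : ℝ) e1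
    exact (e2.sub_const s₀).const_mul b
  have h5 : Tendsto (fun p : ℝ × ℝ × ℝ => (p.1, p.2.1)) (𝓝 (t, s₀, 1)) (𝓝 (t, s₀)) :=
    Continuous.tendsto (by fun_prop) (t, s₀, (1 : ℝ))
  have h6 : ∀ᶠ p : ℝ × ℝ × ℝ in 𝓝 (t, s₀, 1), 0 < p.2.2 :=
    Continuous.tendsto (f := fun p : ℝ × ℝ × ℝ => p.2.2) (by fun_prop) (t, s₀, (1 : ℝ))
      |>.eventually (lt_mem_nhds one_pos)
  -- If `t ≠ t₀`, the path also stays on the side of the second axis on which it starts. Together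
  -- with the second coordinate this locates it in one quadrant.
  have h7 : ∀ᶠ p : ℝ × ℝ × ℝ in 𝓝 (t, s₀, 1), 0 < (p.1 - t₀) * (t - t₀) ∨ t = t₀ := by
    rcases eq_or_ne t t₀ with h | h
    · exact Eventually.of_forall fun _ => Or.inr h
    · have hc : Continuous fun p : ℝ × ℝ × ℝ => (p.1 - t₀) * (t - t₀) := by fun_prop
      exact (hc.continuousAt.eventually (lt_mem_nhds (mul_self_pos.2 (sub_ne_zero.2 h)))).mono
        fun _ => Or.inl
  filter_upwards [eventually_of_deriv_pos hder hq, hαc.eventually k2,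
    hψα.eventually h6, (h5.comp hψα).eventually kP,
    hψα.eventually h7] with s i1 i2 i3 i4 i5
  refine ⟨_, crossMap_of_cone i2 (mem_S2.1 (hα s)) i3, i4, ?_, ?_⟩
  · simpa [hα0, hψt] using i1
  · intro a ha
    rcases i5 with i5 | i5
    · have : 0 < a * ((ψ (α s)).1 - t₀) * (t - t₀) ^ 2 := by
        have := mul_pos ha i5
        nlinarith
      exact pos_of_mul_pos_left this (sq_nonneg _)
    · rw [i5, sub_self, mul_zero] at ha
      exact absurd ha (lt_irrefl _)

/-- Off the coordinate axis the patch avoids the first curve. -/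
theorem eventually_ne_left (H : Transverse γ δ t₀ s₀) :
    ∃ ε > 0, ∀ᶠ p : ℝ × ℝ in 𝓝 (t₀, s₀), p.2 ≠ s₀ → ∀ t, |t - t₀| < ε →
      crossMap γ δ (γ t₀) p ≠ γ t := by
  obtain ⟨U, hU, hinj⟩ := H.exists_injOn
  have hline' : Tendsto (fun t : ℝ => (t, s₀)) (𝓝 t₀) (𝓝 (t₀, s₀)) :=
    Continuous.tendsto (by fun_prop) t₀
  obtain ⟨ε, hε, h⟩ := Metric.eventually_nhds_iff.1 (hline'.eventually hU)
  refine ⟨ε, hε, ?_⟩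
  filter_upwards [hU, H.eventually_mem] with p hp hp' hne t ht heq
  -- A point of the first curve already has coordinates `(t, s₀)`, so injectivity leaves no other.
  have h1 := H.crossMap_left (heq ▸ hp' : γ t ∈ S2)
  have h2 := hinj hp (h (y := t) (by rwa [Real.dist_eq])) (heq.trans h1.symm)
  exact hne (by rw [h2])

/-- A function that is constant on regions is constant on a convex cell of the patch. -/
theorem exists_eventually_eq (H : Transverse γ δ t₀ s₀) {X : Type*} [Inhabited X]
    {region : E3 → X} {I : Set E3}
    (hreg : ∀ x ∈ S2 \ I, ∀ y ∈ connectedComponentIn (S2 \ I) x, region y = region x)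
    {C : Set (ℝ × ℝ)} (hC : Convex ℝ C)
    (hCI : ∀ᶠ p in 𝓝 (t₀, s₀), p ∈ C → crossMap γ δ (γ t₀) p ∉ I) :
    ∃ y, ∀ᶠ p in 𝓝 (t₀, s₀), p ∈ C → region (crossMap γ δ (γ t₀) p) = y := by
  obtain ⟨ε, hε, h⟩ := Metric.eventually_nhds_iff_ball.1
    ((hCI.and H.eventually_mem).and H.eventually_continuousAt)
  -- The cell may be empty, for instance a quadrant with a sign parameter equal to 0; then any color
  -- serves.
  rcases (Metric.ball (t₀, s₀) ε ∩ C).eq_empty_or_nonempty with h0 | ⟨q, hq⟩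
  · refine ⟨default, ?_⟩
    filter_upwards [Metric.ball_mem_nhds (t₀, s₀) hε] with p hp hpC
    exact absurd (h0 ▸ ⟨hp, hpC⟩ : p ∈ (∅ : Set (ℝ × ℝ))) (by simp)
  · refine ⟨region (crossMap γ δ (γ t₀) q), ?_⟩
    filter_upwards [Metric.ball_mem_nhds (t₀, s₀) hε] with p hp hpC
    have hconn : IsPreconnected (crossMap γ δ (γ t₀) '' (Metric.ball (t₀, s₀) ε ∩ C)) :=
      ((convex_ball _ _).inter hC).isPreconnected.image _
        fun r hr => (h r hr.1).2.continuousWithinAt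
    have hsub : crossMap γ δ (γ t₀) '' (Metric.ball (t₀, s₀) ε ∩ C) ⊆ S2 \ I := by
      rintro _ ⟨r, hr, rfl⟩
      exact ⟨(h r hr.1).1.2, (h r hr.1).1.1 hr.2⟩
    exact hreg _ (hsub ⟨q, hq, rfl⟩) _
      (hconn.subset_connectedComponentIn ⟨q, hq, rfl⟩ hsub ⟨p, ⟨hp, hpC⟩, rfl⟩)

end Transverse

/-! Local structure of diagrams and of colorings. -/

namespace Diagram

variable {m k : ℕ} (D : Diagram m k)

theorem curve_add_int (j : Fin k) (t : ℝ) (n : ℤ) :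
    D.curve (.inr j) (t + n) = D.curve (.inr j) t := by
  have h : Function.Periodic (D.curve (.inr j)) 1 := D.periodic j
  simpa using h.int_mul n t

theorem deriv_add_int (j : Fin k) (t : ℝ) (n : ℤ) :
    deriv (D.curve (.inr j)) (t + n) = deriv (D.curve (.inr j)) t := by
  rw [← deriv_comp_add_const]
  congr 1
  funext s
  exact D.curve_add_int j s n

theorem curve_add_rep (i : Comp m k) (s t : ℝ) :
    D.curve i (s + (rep i t - t)) = D.curve i s := by
  rcases i with i | j
  · simp [rep]
  · have : rep (.inr j : Comp m k) t - t = ((-⌊t⌋ : ℤ) : ℝ) := by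
      have := Int.fract_add_floor t
      push_cast
      simp only [rep]
      linarith
    rw [this, curve_add_int]

theorem curve_rep (i : Comp m k) (t : ℝ) : D.curve i (rep i t) = D.curve i t := by
  have := D.curve_add_rep i t t
  rwa [add_sub_cancel] at this

theorem deriv_rep (i : Comp m k) (t : ℝ) : deriv (D.curve i) (rep i t) = deriv (D.curve i) t := by
  have h : (fun s => D.curve i (s + (rep i t - t))) = D.curve i :=
    funext fun s => D.curve_add_rep i s t
  have h2 := deriv_comp_add_const (D.curve i) (rep i t - t) t
  rw [h, add_sub_cancel] at h2
  exact h2.symm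

end Diagram

theorem rep_mem {m k : ℕ} {i : Comp m k} {t : ℝ} (ht : t ∈ allParams i) :
    rep i t ∈ params i := by
  rcases i with i | j
  · exact ht
  · exact ⟨Int.fract_nonneg _, Int.fract_lt_one _⟩

theorem rep_of_mem {m k : ℕ} {i : Comp m k} {t : ℝ} (ht : t ∈ params i) : rep i t = t := by
  rcases i with i | j
  · rfl
  · exact Int.fract_eq_self.2 ht

theorem innerParams_subset {m k : ℕ} (i : Comp m k) : innerParams i ⊆ allParams i := by
  rcases i with i | j
  · exact Ioo_subset_Icc_self
  · exact subset_rfl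

theorem isOpen_innerParams {m k : ℕ} (i : Comp m k) : IsOpen (innerParams i) := by
  rcases i with i | j
  · exact isOpen_Ioo
  · exact isOpen_univ

theorem params_subset_Icc {m k : ℕ} (i : Comp m k) : params i ⊆ Icc 0 1 := by
  rcases i with i | j
  · exact subset_rfl
  · exact Ico_subset_Icc_self

theorem Icc_subset_allParams {m k : ℕ} (i : Comp m k) : Icc 0 1 ⊆ allParams i := by
  rcases i with i | j
  · exact subset_rfl
  · exact subset_univ _

namespace Diagram

variable {m k : ℕ} (D : Diagram m k)

theorem curve_mem_S2 {i : Comp m k} {t : ℝ} (ht : t ∈ allParams i) : D.curve i t ∈ S2 := by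
  rw [← D.curve_rep]
  exact D.mem_sphere i _ (rep_mem ht)

theorem curve_mem_image {i : Comp m k} {t : ℝ} (ht : t ∈ allParams i) :
    D.curve i t ∈ D.image := by
  rw [← D.curve_rep]
  exact ⟨(i, rep i t), rep_mem ht, rfl⟩

theorem eventually_mem_S2 {i : Comp m k} {t : ℝ} (ht : t ∈ innerParams i) :
    ∀ᶠ s in 𝓝 t, D.curve i s ∈ S2 := by
  filter_upwards [(isOpen_innerParams i).mem_nhds ht] with s hs
  exact D.curve_mem_S2 (innerParams_subset i hs)

theorem deriv_ne_zero {i : Comp m k} {t : ℝ} (ht : t ∈ allParams i) :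
    deriv (D.curve i) t ≠ 0 := by
  rw [← D.deriv_rep]
  exact D.immersion i _ (rep_mem ht)

theorem hasDerivAt_curve (i : Comp m k) (t : ℝ) :
    HasDerivAt (D.curve i) (deriv (D.curve i) t) t :=
  ((D.smooth i).differentiable (by simp) t).hasDerivAt

theorem inner_deriv {i : Comp m k} {t : ℝ} (ht : t ∈ innerParams i) :
    inner ℝ (D.curve i t) (deriv (D.curve i) t) = 0 := by
  have h1 := (D.hasDerivAt_curve i t).norm_sq
  have h2 : HasDerivAt (fun s => ‖D.curve i s‖ ^ 2) 0 t := by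
    refine (hasDerivAt_const t (1 : ℝ)).congr_of_eventuallyEq ?_
    filter_upwards [D.eventually_mem_S2 ht] with s hs
    rw [mem_S2.1 hs, one_pow]
  have := h1.unique h2
  linarith

/-- Near a point the diagram consists of short pieces of the strands through that point. -/
theorem eventually_image (x : E3) {ε : ℝ} (hε : 0 < ε) :
    ∀ᶠ y in 𝓝 x, y ∈ D.image → ∃ p ∈ points m k, D.pos p = x ∧
      ∃ t, |t - p.2| < ε ∧ y = D.curve p.1 t := by
  have key : ∀ i, ∀ᶠ y in 𝓝 x, ∀ t ∈ Icc (0 : ℝ) 1, D.curve i t = y →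
      ∃ t₁ ∈ Icc (0 : ℝ) 1, D.curve i t₁ = x ∧ |t - t₁| < ε := by
    intro i
    -- Outside the `ε`-balls around the parameters of `x`, the curve has a compact image that misses
    -- `x`, hence also a neighborhood of `x`.
    set U : Set ℝ := ⋃ t₁ ∈ {t₁ | t₁ ∈ Icc (0 : ℝ) 1 ∧ D.curve i t₁ = x}, Metric.ball t₁ ε with hU
    have hUo : IsOpen U := isOpen_biUnion fun _ _ => Metric.isOpen_ball
    have hK : IsCompact (D.curve i '' (Icc (0 : ℝ) 1 \ U)) :=
      (isCompact_Icc.diff hUo).image (D.smooth i).continuous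
    have hx : x ∉ D.curve i '' (Icc (0 : ℝ) 1 \ U) := by
      rintro ⟨t, ⟨ht, htU⟩, h⟩
      exact htU (mem_biUnion (show t ∈ {t₁ | t₁ ∈ Icc (0 : ℝ) 1 ∧ D.curve i t₁ = x} from ⟨ht, h⟩)
        (Metric.mem_ball_self hε))
    filter_upwards [hK.isClosed.isOpen_compl.mem_nhds hx] with y hy t ht hty
    have htU : t ∈ U := by
      by_contra h
      exact hy ⟨t, ⟨ht, h⟩, hty⟩
    obtain ⟨t₁, ht₁, hd⟩ := mem_iUnion₂.1 htU
    exact ⟨t₁, ht₁.1, ht₁.2, by simpa [Real.dist_eq] using hd⟩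
  filter_upwards [eventually_all.2 key] with y hy
  rintro ⟨⟨i, t⟩, ht, rfl⟩
  obtain ⟨t₁, h1, h2, h3⟩ := hy i t (params_subset_Icc i ht) rfl
  -- On a circle `t₁` may be 1, which is not a representative; both parameters are moved by the same
  -- integer.
  refine ⟨(i, rep i t₁), rep_mem (Icc_subset_allParams i h1), ?_, t + (rep i t₁ - t₁), ?_, ?_⟩
  · rw [pos, D.curve_rep, h2]
  · rwa [show t + (rep i t₁ - t₁) - rep i t₁ = t - t₁ by ring]
  · rw [D.curve_add_rep]
    rfl

variable {D}

theorem eq_of_pos_eq {i : Comp m k} {t : ℝ} (ht : t ∈ allParams i) (ho : ¬ D.IsOver i t)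
    (hu : ¬ D.IsUnder i t) {p : Pt m k} (hp : p ∈ points m k) (h : D.pos p = D.curve i t) :
    p = (i, rep i t) := by
  by_contra hne
  rcases D.double_crossing p hp (i, rep i t) (rep_mem ht) hne
    (by rw [D.curve_rep]; exact h) with h1 | h1
  · exact hu ⟨_, h1, rfl⟩
  · exact ho ⟨_, h1, rfl⟩

theorem eq_or_eq_of_pos_eq {v : Pt m k × Pt m k} (hv : v ∈ D.crossings) {p : Pt m k}
    (hp : p ∈ points m k) (h : D.pos p = D.pos v.1) : p = v.1 ∨ p = v.2 := by
  obtain ⟨h1, h2, h3, h4⟩ := D.crossing_double v hv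
  by_contra hne
  push Not at hne
  exact D.no_triple _ h1 _ h2 _ hp h3 hne.1.symm hne.2.symm ⟨h4, h.symm⟩

theorem inner_of_double {p q : Pt m k} (hp : p ∈ points m k) (hq : q ∈ points m k) (hpq : p ≠ q)
    (h : D.pos p = D.pos q) : p.2 ∈ innerParams p.1 := by
  obtain ⟨i | j, t⟩ := p
  · have ht : t ∈ Icc (0 : ℝ) 1 := hp
    have h0 : ¬ (t = 0 ∨ t = 1) := fun e => D.endpoint_simple i t e q hq hpq.symm h.symm
    push Not at h0
    exact ⟨lt_of_le_of_ne ht.1 h0.1.symm, lt_of_le_of_ne ht.2 h0.2⟩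
  · exact mem_univ _

theorem inner_over {v : Pt m k × Pt m k} (hv : v ∈ D.crossings) :
    v.1.2 ∈ innerParams v.1.1 := by
  obtain ⟨h1, h2, h3, h4⟩ := D.crossing_double v hv
  exact inner_of_double h1 h2 h3 h4

theorem inner_under {v : Pt m k × Pt m k} (hv : v ∈ D.crossings) :
    v.2.2 ∈ innerParams v.2.1 := by
  obtain ⟨h1, h2, h3, h4⟩ := D.crossing_double v hv
  exact inner_of_double h2 h1 h3.symm h4.symm

theorem transverse_crossing {v : Pt m k × Pt m k} (hv : v ∈ D.crossings) :
    Transverse (D.curve v.1.1) (D.curve v.2.1) v.1.2 v.2.2 := by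
  obtain ⟨h1, h2, h3, h4⟩ := D.crossing_double v hv
  exact ⟨D.smooth _, D.smooth _, h4, mem_S2.1 (D.mem_sphere _ _ h1),
    D.transverse _ h1 _ h2 h3 h4⟩

end Diagram

/-- The cross product. -/
def crossVec (x v : E3) : E3 :=
  !₂[x 1 * v 2 - x 2 * v 1, x 2 * v 0 - x 0 * v 2, x 0 * v 1 - x 1 * v 0]

theorem inner_crossVec (x v : E3) : inner ℝ x (crossVec x v) = 0 := by
  simp [crossVec, PiLp.inner_apply, Fin.sum_univ_three]
  ring

theorem orient_crossVec (x v : E3) : orient x v (crossVec x v) = ‖crossVec x v‖ ^ 2 := by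
  rw [EuclideanSpace.norm_sq_eq]
  simp [crossVec, orient, Matrix.det_fin_three, Fin.sum_univ_three]
  ring

/-- Lagrange's identity for the cross product. -/
theorem norm_crossVec {x v : E3} (hx : ‖x‖ = 1) (h : inner ℝ x v = 0) :
    ‖crossVec x v‖ = ‖v‖ := by
  rw [← sq_eq_sq₀ (norm_nonneg _) (norm_nonneg _)]
  have h1 : ‖x‖ ^ 2 = 1 := by rw [hx, one_pow]
  rw [EuclideanSpace.norm_sq_eq] at h1 ⊢
  rw [EuclideanSpace.norm_sq_eq]
  simp [PiLp.inner_apply, Fin.sum_univ_three] at h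
  simp [Fin.sum_univ_three] at h1
  simp [crossVec, Fin.sum_univ_three]
  linear_combination (v 0 ^ 2 + v 1 ^ 2 + v 2 ^ 2) * h1
    - (v 0 * x 0 + v 1 * x 1 + v 2 * x 2) * h

theorem orient_smul (x v w : E3) (c : ℝ) : orient x v (c • w) = c * orient x v w := by
  simp [orient, Matrix.det_fin_three]
  ring

/-- The region on the side of the direction `v` at `x` given by the sign of `o` has color `y`. -/
def SideColor {X : Type*} (region : E3 → X) (x v : E3) (o : ℝ) (y : X) : Prop :=
  ∀ (α : ℝ → E3) (w : E3), (∀ s, α s ∈ S2) → α 0 = x → HasDerivWithinAt α w (Ici 0) 0 →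
    0 < o * orient x v w → ∀ᶠ s in 𝓝[>] (0 : ℝ), region (α s) = y

/-! ### Colors of the two sides of a strand. -/

section Sides

variable {X : Type*} {region : E3 → X} {x v : E3} {o : ℝ} {y z : X}

theorem SideColor.left (h : SideColor region x v o y) (ho : 0 < o) : LeftColor region x v y :=
  fun α w h1 h2 h3 h4 => h α w h1 h2 h3 (mul_pos ho h4)

theorem SideColor.right (h : SideColor region x v o y) (ho : o < 0) : RightColor region x v y :=
  fun α w h1 h2 h3 h4 => h α w h1 h2 h3 (mul_pos_of_neg_of_neg ho h4)

theorem RightColor.side (h : RightColor region x v y) : SideColor region x v (-1) y :=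
  fun α w h1 h2 h3 h4 => h α w h1 h2 h3 (by linarith)

theorem LeftColor.side (h : LeftColor region x v y) : SideColor region x v 1 y :=
  fun α w h1 h2 h3 h4 => h α w h1 h2 h3 (by linarith)

/-- Great circles witness that the color of a side is unique. -/
theorem SideColor.unique (hx : ‖x‖ = 1) (hv : v ≠ 0) (hxv : inner ℝ x v = 0) (ho : o ≠ 0)
    (h1 : SideColor region x v o y) (h2 : SideColor region x v o z) : y = z := by
  have hn : 0 < ‖crossVec x v‖ := by
    rw [norm_crossVec hx hxv]
    exact norm_pos_iff.2 hv
  -- The sign `c` selects the unit normal `w` on the side of `o`; the great circle through `x` in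
  -- direction `w` is a path to which both color conditions apply.
  obtain ⟨c, hc2, hoc⟩ : ∃ c : ℝ, c ^ 2 = 1 ∧ 0 < o * c := by
    rcases ho.lt_or_gt with h | h
    · exact ⟨-1, by norm_num, by linarith⟩
    · exact ⟨1, by norm_num, by linarith⟩
  set w : E3 := (c * ‖crossVec x v‖⁻¹) • crossVec x v with hw
  have hwn : ‖w‖ ^ 2 = 1 := by
    rw [hw, norm_smul, mul_pow, Real.norm_eq_abs, sq_abs, mul_pow, hc2]
    field_simp
  have hxw : inner ℝ x w = 0 := by rw [hw, inner_smul_right, inner_crossVec, mul_zero]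
  have hd : HasDerivAt (fun s : ℝ => Real.cos s • x + Real.sin s • w) w 0 := by
    exact (((Real.hasDerivAt_cos 0).smul_const x).add
      ((Real.hasDerivAt_sin 0).smul_const w)).congr_deriv (by simp)
  have hS : ∀ s : ℝ, Real.cos s • x + Real.sin s • w ∈ S2 := by
    intro s
    rw [mem_S2, ← sq_eq_sq₀ (norm_nonneg _) zero_le_one, norm_add_sq_real, norm_smul, norm_smul,
      inner_smul_left, inner_smul_right, hxw, mul_pow, mul_pow, hwn, hx]
    simp
  have hor : 0 < o * orient x v w := by
    rw [hw, orient_smul, orient_crossVec]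
    have : 0 < (o * c) * (‖crossVec x v‖⁻¹ * ‖crossVec x v‖ ^ 2) := by positivity
    linarith
  obtain ⟨s, hs1, hs2⟩ := ((h1 _ w hS (by simp) hd.hasDerivWithinAt hor).and
    (h2 _ w hS (by simp) hd.hasDerivWithinAt hor)).exists
  exact hs1.symm.trans hs2

end Sides

theorem convex_pos_mul (a c : ℝ) : Convex ℝ {t : ℝ | 0 < a * (t - c)} := by
  have : {t : ℝ | 0 < a * (t - c)} = (fun t => a * t) ⁻¹' Ioi (a * c) := by
    ext t
    simp [mul_sub]
  rw [this]
  exact (convex_Ioi _).is_linear_preimage (IsLinearMap.isLinearMap_smul a)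

/-! ### Region colors near a crossing and near a simple point. -/

section Local

variable {m k : ℕ} {D : Diagram m k} {X : Type*} {region : E3 → X}

/-- The four region colors around a crossing. -/
theorem crossing_colors
    (hreg : ∀ x ∈ S2 \ D.image, ∀ y ∈ connectedComponentIn (S2 \ D.image) x, region y = region x)
    {v : Pt m k × Pt m k} (hv : v ∈ D.crossings) : ∃ q : ℝ → ℝ → X, ∀ a b,
      (∀ᶠ t in 𝓝 v.1.2, 0 < a * (t - v.1.2) →
        SideColor region (D.curve v.1.1 t) (deriv (D.curve v.1.1) t)
          (b * orient (D.pos v.1) (D.vel v.1) (D.vel v.2)) (q a b)) ∧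
      ∀ᶠ s in 𝓝 v.2.2, 0 < b * (s - v.2.2) →
        SideColor region (D.curve v.2.1 s) (deriv (D.curve v.2.1) s)
          (a * - orient (D.pos v.1) (D.vel v.1) (D.vel v.2)) (q a b) := by
  have H := D.transverse_crossing hv
  have H' := H.symm
  set x := D.curve v.1.1 v.1.2 with hx
  have hx' : D.curve v.2.1 v.2.2 = x := H.eq.symm
  have : Inhabited X := ⟨region x⟩
  -- Without triple points, only the two strands of the crossing pass nearby, and they are the
  -- coordinate axes. So the open quadrants miss the diagram.
  have havoid : ∀ᶠ p in 𝓝 (v.1.2, v.2.2), p.1 ≠ v.1.2 → p.2 ≠ v.2.2 →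
      crossMap (D.curve v.1.1) (D.curve v.2.1) x p ∉ D.image := by
    obtain ⟨ε, hε, h1⟩ := H.eventually_ne_left
    obtain ⟨ε', hε', h2⟩ := H'.eventually_ne_left
    rw [hx'] at h2
    have h2' := (continuous_swap.tendsto (v.1.2, v.2.2)).eventually h2
    filter_upwards [h1, h2', H.tendsto_crossMap.eventually
      (D.eventually_image x (lt_min hε hε'))] with p k1 k2 k3 hp1 hp2 hI
    obtain ⟨q, hq, hqx, t, ht, heq⟩ := k3 hI
    rcases D.eq_or_eq_of_pos_eq hv hq hqx with rfl | rfl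
    · exact k1 hp2 t (ht.trans_le (min_le_left _ _)) heq
    · refine k2 hp1 t (ht.trans_le (min_le_right _ _)) ?_
      rw [crossMap_swap]
      exact heq
  have hcell : ∀ a b : ℝ, ∃ y, ∀ᶠ p in 𝓝 (v.1.2, v.2.2),
      p ∈ {t : ℝ | 0 < a * (t - v.1.2)} ×ˢ {s : ℝ | 0 < b * (s - v.2.2)} →
      region (crossMap (D.curve v.1.1) (D.curve v.2.1) x p) = y := by
    intro a b
    refine H.exists_eventually_eq hreg ((convex_pos_mul a _).prod (convex_pos_mul b _)) ?_
    filter_upwards [havoid] with p hp hpC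
    refine hp ?_ ?_
    · intro e
      have := hpC.1
      simp [e] at this
    · intro e
      have := hpC.2
      simp [e] at this
  choose q hq using hcell
  -- For signs `a`, `b`, `q a b` is the color of the quadrant given by `a` along the over-strand and
  -- `b` along the under-strand. It lies on the side `b * o` of the over-strand and, as exchanging
  -- the strands reverses the orientation, on the side `-a * o` of the under-strand, `o` being the
  -- determinant of the crossing.
  refine ⟨q, fun a b => ⟨?_, ?_⟩⟩
  · filter_upwards [H.eventually_path (hq a b), D.eventually_mem_S2 (D.inner_over hv)]
      with t h1 h2 ht α w k1 k2 k3 k4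
    filter_upwards [h1 h2 b α w k1 k2 k3 k4] with s hs
    obtain ⟨p, e, hp, hb, ha⟩ := hs
    rw [← e]
    exact hp ⟨ha a ht, hb⟩
  · have hq' := (continuous_swap.tendsto (v.2.2, v.1.2)).eventually (hq a b)
    filter_upwards [H'.eventually_path hq', D.eventually_mem_S2 (D.inner_under hv)]
      with t h1 h2 ht α w k1 k2 k3 k4
    rw [hx'] at h1
    filter_upwards [h1 h2 a α w k1 k2 k3 (by rwa [orient_swap])] with s hs
    obtain ⟨p, e, hp, hb, ha⟩ := hs
    rw [← e, ← crossMap_swap]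
    exact hp ⟨hb, ha b ht⟩

/-- The two region colors along a simple piece of a strand. -/
theorem simple_colors
    (hreg : ∀ x ∈ S2 \ D.image, ∀ y ∈ connectedComponentIn (S2 \ D.image) x, region y = region x)
    {i : Comp m k} {t₀ : ℝ} (ht₀ : t₀ ∈ innerParams i) (ho : ¬ D.IsOver i t₀)
    (hu : ¬ D.IsUnder i t₀) : ∃ y z : X,
      (∀ᶠ t in 𝓝 t₀, RightColor region (D.curve i t) (deriv (D.curve i) t) y ∧
        LeftColor region (D.curve i t) (deriv (D.curve i) t) z) ∧
      ∀ᶠ x in 𝓝 (D.curve i t₀), x ∈ S2 \ D.image → region x = y ∨ region x = z := by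
  set x := D.curve i t₀ with hx
  have hxn : ‖x‖ = 1 := mem_S2.1 (D.curve_mem_S2 (innerParams_subset i ht₀))
  set n := crossVec x (deriv (D.curve i) t₀) with hn
  have hor : 0 < orient x (deriv (D.curve i) t₀) n := by
    rw [hn, orient_crossVec, norm_crossVec hxn (D.inner_deriv ht₀)]
    have := norm_pos_iff.2 (D.deriv_ne_zero (innerParams_subset i ht₀))
    positivity
  have hd : deriv (fun s : ℝ => x + s • n) 0 = n := by
    have : HasDerivAt (fun s : ℝ => x + s • n) ((1 : ℝ) • n) 0 :=
      ((hasDerivAt_id (0 : ℝ)).smul_const n).const_add x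
    rw [this.deriv, one_smul]
  -- A straight line in the direction of the left normal plays the part of a second strand, so the
  -- coordinates at a double point can be reused. It is not part of the diagram, and half-planes
  -- replace the quadrants.
  have H : Transverse (D.curve i) (fun s : ℝ => x + s • n) t₀ 0 :=
    ⟨D.smooth i, by fun_prop, by simp [hx], hxn, by rw [hd]; exact hor.ne'⟩
  have : Inhabited X := ⟨region x⟩
  have havoid : ∀ᶠ p in 𝓝 (t₀, (0 : ℝ)), p.2 ≠ 0 →
      crossMap (D.curve i) (fun s : ℝ => x + s • n) x p ∉ D.image := by
    obtain ⟨ε, hε, h1⟩ := H.eventually_ne_left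
    filter_upwards [h1, H.tendsto_crossMap.eventually (D.eventually_image x hε)]
      with p k1 k3 hp2 hI
    obtain ⟨q, hq, hqx, t, ht, heq⟩ := k3 hI
    rw [D.eq_of_pos_eq (innerParams_subset i ht₀) ho hu hq hqx] at ht heq
    refine k1 hp2 (t + (t₀ - rep i t₀)) ?_ ?_
    · rwa [show t + (t₀ - rep i t₀) - t₀ = t - rep i t₀ by ring]
    · rw [heq, ← D.curve_add_rep i (t + (t₀ - rep i t₀)) t₀]
      congr 1
      ring
  have hcell : ∀ b : ℝ, ∃ y, ∀ᶠ p in 𝓝 (t₀, (0 : ℝ)),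
      p ∈ (univ : Set ℝ) ×ˢ {s : ℝ | 0 < b * (s - 0)} →
      region (crossMap (D.curve i) (fun s : ℝ => x + s • n) x p) = y := by
    intro b
    refine H.exists_eventually_eq hreg (convex_univ.prod (convex_pos_mul b _)) ?_
    filter_upwards [havoid] with p hp hpC
    refine hp fun e => ?_
    have := hpC.2
    simp [e] at this
  choose q hq using hcell
  have hside : ∀ b, ∀ᶠ t in 𝓝 t₀, SideColor region (D.curve i t) (deriv (D.curve i) t)
      (b * orient x (deriv (D.curve i) t₀) n) (q b) := by
    intro b
    filter_upwards [H.eventually_path (hq b), D.eventually_mem_S2 ht₀]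
      with t h1 h2 α w k1 k2 k3 k4
    filter_upwards [h1 h2 b α w k1 k2 k3 (by rwa [hd])] with s hs
    obtain ⟨p, e, hp, hb, -⟩ := hs
    rw [← e]
    exact hp ⟨mem_univ _, hb⟩
  refine ⟨q (-1), q 1, ?_, ?_⟩
  · filter_upwards [hside (-1), hside 1] with t h1 h2
    exact ⟨h1.right (by linarith), h2.left (by linarith)⟩
  · have hin : ∀ᶠ p in 𝓝 (t₀, (0 : ℝ)), p.1 ∈ innerParams i :=
      (continuous_fst.tendsto (t₀, (0 : ℝ))).eventually ((isOpen_innerParams i).mem_nhds ht₀)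
    filter_upwards [H.eventually_exists (((hq (-1)).and (hq 1)).and hin)] with y hy hyI
    obtain ⟨p, ⟨⟨h1, h2⟩, h3⟩, rfl⟩ := hy hyI.1
    rcases lt_trichotomy p.2 0 with h | h | h
    · exact Or.inl (h1 ⟨mem_univ _, by change 0 < -1 * (p.2 - 0); linarith⟩)
    · refine absurd ?_ hyI.2
      have h4 : p = (p.1, 0) := Prod.ext rfl h
      rw [h4, H.crossMap_left (D.curve_mem_S2 (innerParams_subset i h3))]
      exact D.curve_mem_image (innerParams_subset i h3)
    · exact Or.inr (h2 ⟨mem_univ _, by change 0 < 1 * (p.2 - 0); linarith⟩)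

end Local

/-! Colorings by `P3`: states along a strand and the bound on the weight. -/

theorem eventually_ne_punctured (t₀ a : ℝ) : ∀ᶠ t in 𝓝[≠] t₀, t ≠ a := by
  rcases eq_or_ne a t₀ with rfl | h
  · exact self_mem_nhdsWithin
  · exact eventually_nhdsWithin_of_eventually_nhds (eventually_ne_nhds h.symm)

theorem eventually_rep_ne {m k : ℕ} (i : Comp m k) (t₀ r : ℝ) :
    ∀ᶠ t in 𝓝[≠] t₀, rep i t ≠ r := by
  rcases i with i | j
  · exact eventually_ne_punctured t₀ r
  · have h1 : ∀ᶠ t in 𝓝[≠] t₀, ∀ n ∈ Icc (⌊t₀⌋ - 1) (⌊t₀⌋ + 1), t ≠ r + n :=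
      (eventually_all_finite (finite_Icc _ _)).2 fun n _ => eventually_ne_punctured t₀ _
    have h2 : ∀ᶠ t in 𝓝[≠] t₀, t ∈ Ioo (t₀ - 1) (t₀ + 1) :=
      eventually_nhdsWithin_of_eventually_nhds (Ioo_mem_nhds (by linarith) (by linarith))
    filter_upwards [h1, h2] with t h1 h2 h
    have h3 := Int.fract_add_floor t
    rw [show Int.fract t = r from h] at h3
    refine h1 ⌊t⌋ ⟨?_, ?_⟩ h3.symm
    · have := Int.floor_mono (show t₀ - 1 ≤ t from h2.1.le)
      rwa [Int.floor_sub_one] at this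
    · have := Int.floor_mono (show t ≤ t₀ + 1 from h2.2.le)
      rwa [Int.floor_add_one] at this

theorem Diagram.eventually_not_crossing {m k : ℕ} (D : Diagram m k) (i : Comp m k) (t₀ : ℝ) :
    ∀ᶠ t in 𝓝[≠] t₀, ¬ D.IsOver i t ∧ ¬ D.IsUnder i t := by
  have h : ∀ᶠ t in 𝓝[≠] t₀, ∀ c ∈ D.crossings, rep i t ≠ c.1.2 ∧ rep i t ≠ c.2.2 :=
    (Filter.eventually_all_finset _).2 fun c _ =>
      (eventually_rep_ne i t₀ _).and (eventually_rep_ne i t₀ _)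
  filter_upwards [h] with t ht
  constructor
  · rintro ⟨c, hc, e⟩
    exact (ht c hc).1 (by rw [e])
  · rintro ⟨c, hc, e⟩
    exact (ht c hc).2 (by rw [e])

/-- A function that is locally constant up to isolated exceptions is constant up to isolated
exceptions. -/
theorem exists_const_of_punctured {Y : Type*} {S : Set ℝ} (hS : IsPreconnected S) {f : ℝ → Y}
    (hne : S.Nonempty) (h : ∀ t ∈ S, ∃ y, ∀ᶠ s in 𝓝[≠] t, f s = y) :
    ∃ y, ∀ t ∈ S, ∀ᶠ s in 𝓝[≠] t, f s = y := by
  have uniq : ∀ {t y z}, (∀ᶠ s in 𝓝[≠] t, f s = y) → (∀ᶠ s in 𝓝[≠] t, f s = z) → y = z := by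
    intro t y z h1 h2
    obtain ⟨s, e1, e2⟩ := (h1.and h2).exists
    exact e1.symm.trans e2
  obtain ⟨t₀, ht₀⟩ := hne
  obtain ⟨y, hy⟩ := h t₀ ht₀
  refine ⟨y, fun t ht => ?_⟩
  -- Having the same punctured value is an equivalence relation that holds between nearby points,
  -- hence throughout a preconnected set.
  refine (hS.induction₂ (fun a b => ∀ y, (∀ᶠ s in 𝓝[≠] a, f s = y) ↔ ∀ᶠ s in 𝓝[≠] b, f s = y)
    ?_ (fun a b c _ _ _ h1 h2 y => (h1 y).trans (h2 y)) (fun a b _ _ h1 y => (h1 y).symm)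
    ht₀ ht y).1 hy
  intro a ha
  obtain ⟨z, hz⟩ := h a ha
  have hz' : ∀ᶠ b in 𝓝 a, b ≠ a → ∀ᶠ s in 𝓝[≠] b, f s = z := by
    rw [eventually_nhdsWithin_iff] at hz
    filter_upwards [hz.eventually_nhds] with b hb hba
    refine eventually_nhdsWithin_of_eventually_nhds ?_
    filter_upwards [hb, eventually_ne_nhds hba] with s h1 h2
    exact h1 h2
  filter_upwards [eventually_nhdsWithin_of_eventually_nhds hz'] with b hb w
  rcases eq_or_ne b a with rfl | hba
  · rfl
  · constructor
    · intro h1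
      rw [uniq h1 hz]
      exact hb hba
    · intro h1
      rw [uniq h1 (hb hba)]
      exact hz

/-- One if region and arc are the two distinct nonzero elements. -/
def clash : P3 × P3 → ℤ
  | (.one, .two) => 1
  | (.two, .one) => 1
  | _ => 0

/-- Whether an element is `0`: the orbit of the element. -/
def P3.orbit : P3 → Bool
  | .zero => true
  | _ => false

/-- The orbits of region and arc. -/
def orbits (s : P3 × P3) : Bool × Bool := (s.1.orbit, s.2.orbit)

theorem qop_qop_self (x y : P3) : qop (qop x y) y = x := by
  cases x <;> cases y <;> rfl

theorem orbit_qop (x y : P3) : (qop x y).orbit = x.orbit := by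
  cases x <;> cases y <;> rfl

/-- The key to the bound: the integer part of `φ` is the difference of `clash` between the two
regions to the right of an over-strand of color `z`, before and after it meets an under-strand of
color `x`. -/
theorem clash_over (y x z : P3) : clash (y, z) - clash (qop y x, z) = (φ y x z).2 := by
  cases x <;> cases y <;> cases z <;> rfl

/-- Passing under `z` acts on region and arc simultaneously, and an action exchanging 1 and 2
preserves distinctness. -/
theorem clash_under (y x z : P3) : clash (qop y z, qop x z) = clash (y, x) := by
  cases x <;> cases y <;> cases z <;> rfl

theorem clash_mem (s : P3 × P3) : clash s = 0 ∨ clash s = 1 := by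
  obtain ⟨x, y⟩ := s
  cases x <;> cases y <;> simp [clash]

theorem clash_of_orbit {s : P3 × P3} (h : s.1.orbit = true ∨ s.2.orbit = true) : clash s = 0 := by
  obtain ⟨x, y⟩ := s
  cases x <;> cases y <;> simp_all [clash, P3.orbit]

open Classical in
/-- The color of the region to the right of the direction `v` at `x`. -/
def rightColorAt (region : E3 → P3) (x v : E3) : P3 :=
  if h : ∃ y, RightColor region x v y then h.choose else .zero

namespace Coloring

variable {m k : ℕ} {D : Diagram m k} (c : Coloring P3 D)

/-- The color of the region to the right of a strand, and of the arc. -/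
def state (i : Comp m k) (t : ℝ) : P3 × P3 :=
  (rightColorAt c.region (D.curve i t) (deriv (D.curve i) t), c.arc i t)

theorem state_eq {i : Comp m k} {t : ℝ} (ht : t ∈ innerParams i) {y : P3}
    (h : RightColor c.region (D.curve i t) (deriv (D.curve i) t) y) :
    c.state i t = (y, c.arc i t) := by
  have he : ∃ y, RightColor c.region (D.curve i t) (deriv (D.curve i) t) y := ⟨y, h⟩
  have ht' := innerParams_subset i ht
  rw [state, rightColorAt, dif_pos he, SideColor.unique (mem_S2.1 (D.curve_mem_S2 ht')) (D.deriv_ne_zero ht')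
    (D.inner_deriv ht) (by norm_num) he.choose_spec.side h.side]

theorem arc_add_int (j : Fin k) (t : ℝ) (n : ℤ) : c.arc (.inr j) (t + n) = c.arc (.inr j) t := by
  have h : Function.Periodic (c.arc (.inr j)) 1 := c.arc_periodic j
  simpa using h.int_mul n t

theorem state_add_int (j : Fin k) (t : ℝ) (n : ℤ) :
    c.state (.inr j) (t + n) = c.state (.inr j) t := by
  simp only [state, D.curve_add_int, D.deriv_add_int, c.arc_add_int]

theorem eventually_arc {i : Comp m k} {t₀ : ℝ} (ht₀ : t₀ ∈ innerParams i)
    (hu : ¬ D.IsUnder i t₀) : ∀ᶠ t in 𝓝 t₀, c.arc i t = c.arc i t₀ := by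
  have h1 : ∀ᶠ t in 𝓝 t₀, ¬ D.IsUnder i t := by
    have h := D.eventually_not_crossing i t₀
    rw [eventually_nhdsWithin_iff] at h
    filter_upwards [h] with t ht
    rcases eq_or_ne t t₀ with rfl | hne
    · exact hu
    · exact (ht hne).2
  obtain ⟨ε, hε, h2⟩ := Metric.eventually_nhds_iff_ball.1
    (h1.and ((isOpen_innerParams i).mem_nhds ht₀))
  filter_upwards [Metric.ball_mem_nhds t₀ hε] with t ht
  have h3 : ∀ {a b}, a ∈ Metric.ball t₀ ε → b ∈ Metric.ball t₀ ε → Icc a b ⊆ Metric.ball t₀ ε :=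
    fun ha hb => (convex_ball t₀ ε).ordConnected.out ha hb
  have h0 : t₀ ∈ Metric.ball t₀ ε := Metric.mem_ball_self hε
  rcases le_total t t₀ with h | h
  · exact c.arc_const i _ _ h
      (fun u hu => innerParams_subset i (h2 u (h3 ht h0 hu)).2) fun u hu => (h2 u (h3 ht h0 hu)).1
  · exact (c.arc_const i _ _ h
      (fun u hu => innerParams_subset i (h2 u (h3 h0 ht hu)).2)
      fun u hu => (h2 u (h3 h0 ht hu)).1).symm

theorem state_simple {i : Comp m k} {t₀ : ℝ} (ht₀ : t₀ ∈ innerParams i) (ho : ¬ D.IsOver i t₀)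
    (hu : ¬ D.IsUnder i t₀) : ∃ s, ∀ᶠ t in 𝓝 t₀, c.state i t = s := by
  obtain ⟨y, _, h, _⟩ := simple_colors c.region_const ht₀ ho hu
  refine ⟨(y, c.arc i t₀), ?_⟩
  filter_upwards [h, c.eventually_arc ht₀ hu, (isOpen_innerParams i).mem_nhds ht₀] with t h1 h2 h3
  rw [c.state_eq h3 h1.1, h2]

/-- Combines the two quadrants along one half of a strand with the coloring rule. That rule holds
only off crossings, whence the filter inside the punctured neighborhood. -/
theorem half_state {i : Comp m k} {t₀ : ℝ} (ht₀ : t₀ ∈ innerParams i) {F : Filter ℝ}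
    (hF : F ≤ 𝓝[≠] t₀) {oR oL : ℝ} {yR yL x : P3} (hR0 : oR < 0) (hL0 : 0 < oL)
    (hR : ∀ᶠ t in F, SideColor c.region (D.curve i t) (deriv (D.curve i) t) oR yR)
    (hL : ∀ᶠ t in F, SideColor c.region (D.curve i t) (deriv (D.curve i) t) oL yL)
    (hx : ∀ᶠ t in F, c.arc i t = x) :
    ∀ᶠ t in F, c.state i t = (yR, x) ∧ yL = qop yR x := by
  filter_upwards [hR, hL, hF (D.eventually_not_crossing i t₀), hx,
    (hF.trans nhdsWithin_le_nhds) ((isOpen_innerParams i).mem_nhds ht₀)] with t h1 h2 h3 h4 h5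
  have h5' := innerParams_subset i h5
  obtain ⟨y, k1, k2⟩ := c.side i t h5 h3.1 h3.2
  refine ⟨by rw [c.state_eq h5 (h1.right hR0), h4], ?_⟩
  have hn := mem_S2.1 (D.curve_mem_S2 h5')
  have hv := D.deriv_ne_zero h5'
  have e1 : yR = y := SideColor.unique hn hv (D.inner_deriv h5) (by norm_num)
    (h1.right hR0).side k1.side
  have e2 : yL = qop y (c.arc i t) := SideColor.unique hn hv (D.inner_deriv h5) (by norm_num)
    (h2.left hL0).side k2.side
  rw [e2, e1, h4]

/-- The signed second component of the weight of a crossing. -/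
def jump (v : Pt m k × Pt m k) : ℤ :=
  open Classical in
  if D.Positive v then (φ (c.color v).1 (c.color v).2.1 (c.color v).2.2).2
  else - (φ (c.color v).1 (c.color v).2.1 (c.color v).2.2).2

/-- No triple points and no double role at a crossing; therefore the arc color is constant along an
over-passage. -/
theorem not_isUnder_over {v : Pt m k × Pt m k} (hv : v ∈ D.crossings) :
    ¬ D.IsUnder v.1.1 v.1.2 := by
  rintro ⟨w, hw, e⟩
  obtain ⟨h1, h2, h3, h4⟩ := D.crossing_double v hv
  obtain ⟨k1, k2, k3, k4⟩ := D.crossing_double w hw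
  rw [rep_of_mem h1] at e
  change w.2 = v.1 at e
  have h5 : D.pos w.1 = D.pos v.1 := by rw [← e]; exact k4
  rcases D.eq_or_eq_of_pos_eq hv k1 h5 with h | h
  · exact k3 (h.trans e.symm)
  · refine D.crossing_asymm _ _ hv ?_
    rw [← h, ← e]
    exact hw

/-- The states before and after a crossing on both strands. -/
theorem state_crossing {v : Pt m k × Pt m k} (hv : v ∈ D.crossings) :
    ∃ ob oa ub ua : P3 × P3,
      (∀ᶠ t in 𝓝[<] v.1.2, c.state v.1.1 t = ob) ∧ (∀ᶠ t in 𝓝[>] v.1.2, c.state v.1.1 t = oa) ∧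
      (∀ᶠ t in 𝓝[<] v.2.2, c.state v.2.1 t = ub) ∧ (∀ᶠ t in 𝓝[>] v.2.2, c.state v.2.1 t = ua) ∧
      clash oa - clash ob = c.jump v ∧ clash ua = clash ub ∧
      orbits ob = ((c.color v).1.orbit, (c.color v).2.2.orbit) ∧
      orbits oa = ((c.color v).1.orbit, (c.color v).2.2.orbit) ∧
      orbits ub = ((c.color v).1.orbit, (c.color v).2.1.orbit) ∧
      orbits ua = ((c.color v).1.orbit, (c.color v).2.1.orbit) := by
  obtain ⟨q, hq⟩ := crossing_colors c.region_const hv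
  have hin := D.inner_over hv
  have hin' := D.inner_under hv
  have hover := c.eventually_arc hin (not_isUnder_over hv)
  rw [← c.color_over v hv] at hover
  have hcp := c.color_pos v hv
  have hcn := c.color_neg v hv
  set o := orient (D.pos v.1) (D.vel v.1) (D.vel v.2) with ho
  have hone : o ≠ 0 := (D.transverse_crossing hv).orient_ne
  have hlt : ∀ t₀ : ℝ, ∀ᶠ t in 𝓝[<] t₀, 0 < (-1 : ℝ) * (t - t₀) := fun t₀ => by
    filter_upwards [self_mem_nhdsWithin] with t (ht : t < t₀)
    linarith
  have hgt : ∀ t₀ : ℝ, ∀ᶠ t in 𝓝[>] t₀, 0 < (1 : ℝ) * (t - t₀) := fun t₀ => by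
    filter_upwards [self_mem_nhdsWithin] with t (ht : t₀ < t)
    linarith
  have hOL : ∀ b, ∀ᶠ t in 𝓝[<] v.1.2, SideColor c.region (D.curve v.1.1 t)
      (deriv (D.curve v.1.1) t) (b * o) (q (-1) b) := fun b => by
    filter_upwards [eventually_nhdsWithin_of_eventually_nhds (hq (-1) b).1, hlt _] with t h1 h2
    exact h1 h2
  have hOG : ∀ b, ∀ᶠ t in 𝓝[>] v.1.2, SideColor c.region (D.curve v.1.1 t)
      (deriv (D.curve v.1.1) t) (b * o) (q 1 b) := fun b => by
    filter_upwards [eventually_nhdsWithin_of_eventually_nhds (hq 1 b).1, hgt _] with t h1 h2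
    exact h1 h2
  have hUL : ∀ a, ∀ᶠ t in 𝓝[<] v.2.2, SideColor c.region (D.curve v.2.1 t)
      (deriv (D.curve v.2.1) t) (a * -o) (q a (-1)) := fun a => by
    filter_upwards [eventually_nhdsWithin_of_eventually_nhds (hq a (-1)).2, hlt _] with t h1 h2
    exact h1 h2
  have hUG : ∀ a, ∀ᶠ t in 𝓝[>] v.2.2, SideColor c.region (D.curve v.2.1 t)
      (deriv (D.curve v.2.1) t) (a * -o) (q a 1) := fun a => by
    filter_upwards [eventually_nhdsWithin_of_eventually_nhds (hq a 1).2, hgt _] with t h1 h2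
    exact h1 h2
  have hFl : ∀ t₀ : ℝ, 𝓝[<] t₀ ≤ 𝓝[≠] t₀ := fun t₀ => nhdsLT_le_nhdsNE t₀
  have hFg : ∀ t₀ : ℝ, 𝓝[>] t₀ ≤ 𝓝[≠] t₀ := fun t₀ => nhdsGT_le_nhdsNE t₀
  have hol := eventually_nhdsWithin_of_eventually_nhds (s := Iio v.1.2) hover
  have hog := eventually_nhdsWithin_of_eventually_nhds (s := Ioi v.1.2) hover
  have hev : ∀ {F : Filter ℝ} [F.NeBot] {s : P3 × P3} {y x y' : P3},
      (∀ᶠ t in F, c.state v.2.1 t = s ∧ y = qop s.1 s.2) →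
      (∀ᶠ t in F, c.state v.2.1 t = (y', x)) → s.1 = y' := by
    intro F _ s y x y' h1 h2
    obtain ⟨t, e1, e2⟩ := (h1.and h2).exists
    rw [← e1.1, e2]
  simp only [orbits, jump]
  generalize c.color v = col at *
  obtain ⟨y, x, z⟩ := col
  simp only at *
  by_cases hpos : D.Positive v
  · have hop : 0 < o := hpos
    obtain ⟨hb, ha⟩ := hcp hpos
    have s1 := c.half_state hin (hFl _) (by linarith) (by linarith) (hOL (-1)) (hOL 1) hol
    have s2 := c.half_state hin (hFg _) (by linarith) (by linarith) (hOG (-1)) (hOG 1) hog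
    have s3 := c.half_state hin' (hFl _) (by linarith) (by linarith) (hUL 1) (hUL (-1))
      (hb.mono fun _ h => h.1)
    have s4 := c.half_state hin' (hFg _) (by linarith) (by linarith) (hUG 1) (hUG (-1)) ha
    -- For `0 < o` the right of the incoming under-strand is also the right of the outgoing
    -- over-strand. So the over-strand goes from the region `qop y x` to `y`, a change of `clash` by
    -- plus the value of `φ`.
    have hy : q 1 (-1) = y := by
      refine hev s3 (x := x) ?_
      filter_upwards [hb, nhdsWithin_le_nhds ((isOpen_innerParams _).mem_nhds hin')] with t h1 h2
      rw [c.state_eq h2 h1.2, h1.1]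
    have r2 := s2.exists.choose_spec.2
    have r3 := s3.exists.choose_spec.2
    rw [hy] at r2 r3
    refine ⟨_, _, _, _, s1.mono fun _ h => h.1, s2.mono fun _ h => h.1, s3.mono fun _ h => h.1,
      s4.mono fun _ h => h.1, ?_⟩
    rw [if_pos hpos, hy, r2, r3]
    exact ⟨clash_over _ _ _, clash_under _ _ _, by simp [orbit_qop], by simp, by simp,
      by simp [orbit_qop]⟩
  · have hon : o < 0 := lt_of_le_of_ne (not_lt.1 hpos) hone
    obtain ⟨ha, hb⟩ := hcn hpos
    have s1 := c.half_state hin (hFl _) (by linarith) (by linarith) (hOL 1) (hOL (-1)) hol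
    have s2 := c.half_state hin (hFg _) (by linarith) (by linarith) (hOG 1) (hOG (-1)) hog
    have s3 := c.half_state hin' (hFl _) (by linarith) (by linarith) (hUL (-1)) (hUL 1) hb
    have s4 := c.half_state hin' (hFg _) (by linarith) (by linarith) (hUG (-1)) (hUG 1)
      (ha.mono fun _ h => h.1)
    -- For `o < 0` the right of the outgoing under-strand is the right of the incoming over-strand.
    -- Now the over-strand goes from `y` to `qop y x`, which reverses the sign.
    have hy : q (-1) 1 = y := by
      refine hev s4 (x := x) ?_
      filter_upwards [ha, nhdsWithin_le_nhds ((isOpen_innerParams _).mem_nhds hin')] with t h1 h2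
      rw [c.state_eq h2 h1.2, h1.1]
    have r1 := s1.exists.choose_spec.2
    have r4 := s4.exists.choose_spec.2
    rw [hy] at r1 r4
    refine ⟨_, _, _, _, s1.mono fun _ h => h.1, s2.mono fun _ h => h.1, s3.mono fun _ h => h.1,
      s4.mono fun _ h => h.1, ?_⟩
    rw [if_neg hpos, hy, r1, r4]
    refine ⟨?_, (clash_under _ _ _).symm, by simp, by simp [orbit_qop], by simp [orbit_qop],
      by simp⟩
    rw [← clash_over]
    ring

end Coloring

/-! ### Summing the jumps along a component. -/

/-- The function `⌈t - p⌉` goes up by one just after `p` and by one per turn of a circle, so it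
counts passages on the universal cover. At parameters less than one apart it is 0 or 1. -/
theorem ceil_before {t₀ p : ℝ} (h1 : p < t₀ + 1) (h2 : t₀ < p + 1) :
    ∀ᶠ t in 𝓝[<] t₀, ⌈t - p⌉ = if p < t₀ then 1 else 0 := by
  split_ifs with h
  · filter_upwards [Ioo_mem_nhdsLT h] with t ht
    rw [Int.ceil_eq_iff]
    push_cast
    constructor <;> linarith [ht.1, ht.2]
  · filter_upwards [Ioo_mem_nhdsLT (show p - 1 < t₀ by linarith)] with t ht
    rw [Int.ceil_eq_iff]
    push_cast
    constructor <;> linarith [ht.1, ht.2]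

theorem ceil_after {t₀ p : ℝ} (h1 : p < t₀ + 1) (h2 : t₀ < p + 1) :
    ∀ᶠ t in 𝓝[>] t₀, ⌈t - p⌉ = if p ≤ t₀ then 1 else 0 := by
  split_ifs with h
  · filter_upwards [Ioo_mem_nhdsGT h2] with t ht
    rw [Int.ceil_eq_iff]
    push_cast
    constructor <;> linarith [ht.1, ht.2]
  · filter_upwards [Ioo_mem_nhdsGT (not_le.1 h)] with t ht
    rw [Int.ceil_eq_iff]
    push_cast
    constructor <;> linarith [ht.1, ht.2]

theorem abs_sub_lt_of_params {m k : ℕ} {i : Comp m k} {s t : ℝ} (hs : s ∈ params i)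
    (hs' : s ∈ innerParams i) (ht : t ∈ params i) (ht' : t ∈ innerParams i) : s < t + 1 := by
  rcases i with i | i
  · have h1 : s ∈ Ioo (0 : ℝ) 1 := hs'
    have h2 : t ∈ Ioo (0 : ℝ) 1 := ht'
    linarith [h1.2, h2.1]
  · have h1 : s ∈ Ico (0 : ℝ) 1 := hs
    have h2 : t ∈ Ico (0 : ℝ) 1 := ht
    linarith [h1.2, h2.1]

theorem Diagram.eq_of_over_eq {m k : ℕ} {D : Diagram m k} {v w : Pt m k × Pt m k}
    (hv : v ∈ D.crossings) (hw : w ∈ D.crossings) (h : w.1 = v.1) : w = v := by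
  obtain ⟨k1, k2, k3, k4⟩ := D.crossing_double w hw
  have h5 : D.pos w.2 = D.pos v.1 := by rw [← h]; exact k4.symm
  rcases D.eq_or_eq_of_pos_eq hv k2 h5 with e | e
  · exact absurd (h.trans e.symm) k3
  · exact Prod.ext h e

namespace Coloring

variable {m k : ℕ} {D : Diagram m k} (c : Coloring P3 D)

open Classical in
/-- The crossings in which a component is the over-strand. -/
def _root_.MLinkoid.Diagram.overCrossings (D : Diagram m k) (i : Comp m k) :
    Finset (Pt m k × Pt m k) :=
  D.crossings.filter fun v => v.1.1 = i

theorem _root_.MLinkoid.Diagram.mem_overCrossings {i : Comp m k} {v : Pt m k × Pt m k} :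
    v ∈ D.overCrossings i ↔ v ∈ D.crossings ∧ v.1.1 = i := by
  simp [Diagram.overCrossings]

/-- The total jump along a component. -/
def totalJump (i : Comp m k) : ℤ := ∑ v ∈ D.overCrossings i, c.jump v

/-- The sum of the jumps before a parameter. -/
def height (i : Comp m k) (t : ℝ) : ℤ := ∑ v ∈ D.overCrossings i, c.jump v * ⌈t - v.1.2⌉

/-- The quantities that are constant along a component. -/
def level (i : Comp m k) (t : ℝ) : ℤ × (Bool × Bool) :=
  (clash (c.state i t) - c.height i t, orbits (c.state i t))

theorem height_before {i : Comp m k} {t₀ : ℝ} (h : t₀ ∈ params i) (h' : t₀ ∈ innerParams i) :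
    ∀ᶠ t in 𝓝[<] t₀, c.height i t =
      ∑ v ∈ D.overCrossings i, c.jump v * if v.1.2 < t₀ then 1 else 0 := by
  have key : ∀ᶠ t in 𝓝[<] t₀, ∀ v ∈ D.overCrossings i,
      ⌈t - v.1.2⌉ = if v.1.2 < t₀ then 1 else 0 := by
    refine (Filter.eventually_all_finset _).2 fun v hv => ?_
    obtain ⟨hv', rfl⟩ := Diagram.mem_overCrossings.1 hv
    exact ceil_before
      (abs_sub_lt_of_params (D.crossing_double v hv').1 (D.inner_over hv') h h')
      (abs_sub_lt_of_params h h' (D.crossing_double v hv').1 (D.inner_over hv'))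
  filter_upwards [key] with t ht
  exact Finset.sum_congr rfl fun v hv => by rw [ht v hv]

theorem height_after {i : Comp m k} {t₀ : ℝ} (h : t₀ ∈ params i) (h' : t₀ ∈ innerParams i) :
    ∀ᶠ t in 𝓝[>] t₀, c.height i t =
      (∑ v ∈ D.overCrossings i, c.jump v * if v.1.2 < t₀ then 1 else 0) +
      ∑ v ∈ D.overCrossings i, if v.1.2 = t₀ then c.jump v else 0 := by
  have key : ∀ᶠ t in 𝓝[>] t₀, ∀ v ∈ D.overCrossings i,
      ⌈t - v.1.2⌉ = if v.1.2 ≤ t₀ then 1 else 0 := by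
    refine (Filter.eventually_all_finset _).2 fun v hv => ?_
    obtain ⟨hv', rfl⟩ := Diagram.mem_overCrossings.1 hv
    exact ceil_after
      (abs_sub_lt_of_params (D.crossing_double v hv').1 (D.inner_over hv') h h')
      (abs_sub_lt_of_params h h' (D.crossing_double v hv').1 (D.inner_over hv'))
  filter_upwards [key] with t ht
  rw [height, ← Finset.sum_add_distrib]
  refine Finset.sum_congr rfl fun v hv => ?_
  rw [ht v hv]
  rcases lt_trichotomy v.1.2 t₀ with h | h | h
  · simp [h, h.le, h.ne]
  · simp [h]
  · simp [h.not_ge, h.not_gt, h.ne']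

/-- If `clash` changes by the jumps at `t₀`, it changes as `height` does, and the difference does
not notice the crossing. -/
theorem exists_level_of_sides {i : Comp m k} {t₀ : ℝ} (h : t₀ ∈ params i)
    (h' : t₀ ∈ innerParams i) {b a : P3 × P3} (hb : ∀ᶠ t in 𝓝[<] t₀, c.state i t = b)
    (ha : ∀ᶠ t in 𝓝[>] t₀, c.state i t = a)
    (hj : clash a - clash b = ∑ v ∈ D.overCrossings i, if v.1.2 = t₀ then c.jump v else 0)
    (ho : orbits b = orbits a) : ∃ l, ∀ᶠ t in 𝓝[≠] t₀, c.level i t = l := by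
  refine ⟨(clash b - ∑ v ∈ D.overCrossings i, c.jump v * if v.1.2 < t₀ then 1 else 0,
    orbits b), ?_⟩
  rw [← nhdsLT_sup_nhdsGT, eventually_sup]
  constructor
  · filter_upwards [hb, c.height_before h h'] with t h1 h2
    rw [level, h1, h2]
  · filter_upwards [ha, c.height_after h h'] with t h1 h2
    rw [level, h1, h2, ← hj, ho]
    congr 1
    ring

theorem exists_level_of_mem {i : Comp m k} {t₀ : ℝ} (h : t₀ ∈ params i)
    (h' : t₀ ∈ innerParams i) : ∃ l, ∀ᶠ t in 𝓝[≠] t₀, c.level i t = l := by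
  have hzero : ¬ D.IsOver i t₀ →
      ∑ v ∈ D.overCrossings i, (if v.1.2 = t₀ then c.jump v else 0) = 0 := by
    intro ho
    refine Finset.sum_eq_zero fun v hv => if_neg fun e => ho ?_
    obtain ⟨hv, hi⟩ := Diagram.mem_overCrossings.1 hv
    exact ⟨v, hv, Prod.ext hi (by rw [rep_of_mem h]; exact e)⟩
  by_cases ho : D.IsOver i t₀
  · obtain ⟨v, hv, e⟩ := ho
    rw [rep_of_mem h] at e
    obtain ⟨ob, oa, _, _, h1, h2, -, -, h3, -, h4, h5, -⟩ := c.state_crossing hv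
    rw [e] at h1 h2
    refine c.exists_level_of_sides h h' h1 h2 ?_ (h4.trans h5.symm)
    -- A crossing is determined by its over-point, so no other crossing jumps at this parameter.
    rw [h3, Finset.sum_eq_single v]
    · rw [e, if_pos rfl]
    · intro w hw hne
      refine if_neg fun hwt => hne ?_
      obtain ⟨hw, hi⟩ := Diagram.mem_overCrossings.1 hw
      exact D.eq_of_over_eq hv hw (by rw [e]; exact Prod.ext hi hwt)
    · intro hv'
      exact absurd (Diagram.mem_overCrossings.2 ⟨hv, by rw [e]⟩) hv'
  · by_cases hu : D.IsUnder i t₀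
    · obtain ⟨v, hv, e⟩ := hu
      rw [rep_of_mem h] at e
      obtain ⟨_, _, ub, ua, -, -, h1, h2, -, h3, -, -, h4, h5⟩ := c.state_crossing hv
      rw [e] at h1 h2
      exact c.exists_level_of_sides h h' h1 h2 (by rw [hzero ho, h3, sub_self])
        (h4.trans h5.symm)
    · obtain ⟨s, hs⟩ := c.state_simple h' ho hu
      exact c.exists_level_of_sides h h' (eventually_nhdsWithin_of_eventually_nhds hs)
        (eventually_nhdsWithin_of_eventually_nhds hs) (by rw [hzero ho, sub_self]) rfl

theorem height_add_int (i : Comp m k) (t : ℝ) (n : ℤ) :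
    c.height i (t + n) = c.height i t + n * c.totalJump i := by
  rw [height, height, totalJump, Finset.mul_sum, ← Finset.sum_add_distrib]
  refine Finset.sum_congr rfl fun v _ => ?_
  rw [show t + n - v.1.2 = t - v.1.2 + n by ring, Int.ceil_add_intCast]
  ring

theorem level_add_int (j : Fin k) (t : ℝ) (n : ℤ) :
    c.level (.inr j) (t + n) =
      ((c.level (.inr j) t).1 - n * c.totalJump (.inr j), (c.level (.inr j) t).2) := by
  simp only [level, c.state_add_int, c.height_add_int]
  congr 1
  ring

theorem tendsto_add_punctured (a b : ℝ) :
    Tendsto (fun t => t + (b - a)) (𝓝[≠] a) (𝓝[≠] b) := by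
  refine tendsto_nhdsWithin_iff.2 ⟨?_, ?_⟩
  · have : Tendsto (fun t => t + (b - a)) (𝓝 a) (𝓝 (a + (b - a))) :=
      Continuous.tendsto (by fun_prop) a
    rw [add_sub_cancel] at this
    exact this.mono_left nhdsWithin_le_nhds
  · filter_upwards [self_mem_nhdsWithin] with t ht h
    exact ht (by have : t + (b - a) = b := h; exact (by linarith : t = a))

/-- On a circle an integer translation changes the level by a constant only, so it suffices to know
the fundamental interval. -/
theorem exists_level_at {i : Comp m k} {t₀ : ℝ} (h : t₀ ∈ innerParams i) :
    ∃ l, ∀ᶠ t in 𝓝[≠] t₀, c.level i t = l := by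
  rcases i with i | j
  · exact c.exists_level_of_mem (Ioo_subset_Icc_self h) h
  · obtain ⟨l, hl⟩ := c.exists_level_of_mem (i := .inr j) (t₀ := Int.fract t₀)
      ⟨Int.fract_nonneg _, Int.fract_lt_one _⟩ (mem_univ _)
    refine ⟨(l.1 - ⌊t₀⌋ * c.totalJump (.inr j), l.2), ?_⟩
    filter_upwards [(tendsto_add_punctured t₀ (Int.fract t₀)).eventually hl] with t ht
    have : t = t + (Int.fract t₀ - t₀) + ⌊t₀⌋ := by
      linarith [Int.fract_add_floor t₀]
    rw [this, level_add_int, ht]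

theorem innerParams_nonempty (i : Comp m k) : (innerParams i).Nonempty := by
  rcases i with i | j
  · exact ⟨1 / 2, by norm_num [innerParams]⟩
  · exact ⟨0, mem_univ _⟩

theorem exists_level (i : Comp m k) :
    ∃ l, ∀ t ∈ innerParams i, ∀ᶠ s in 𝓝[≠] t, c.level i s = l := by
  refine exists_const_of_punctured ?_ (innerParams_nonempty i) fun t ht => c.exists_level_at ht
  rcases i with i | j
  · exact isPreconnected_Ioo
  · exact isPreconnected_univ

/-- The level is constant, yet one turn lowers it by the total jump, because the state is periodic.
-/
theorem totalJump_circle (j : Fin k) : c.totalJump (.inr j) = 0 := by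
  obtain ⟨l, hl⟩ := c.exists_level (.inr j)
  have h1 := (tendsto_add_punctured 0 1).eventually (hl 1 (mem_univ _))
  obtain ⟨t, e1, e2⟩ := ((hl 0 (mem_univ _)).and h1).exists
  have h2 := c.level_add_int j t 1
  have h3 : c.level (.inr j) (t + ((1 : ℤ) : ℝ)) = l := by
    rw [← e2]
    congr 1
    push_cast
    ring
  rw [h3, e1] at h2
  have := congrArg Prod.fst h2
  simp only at this
  linarith

/-- Compare the level before the first and after the last over-crossing, where the height is 0 and
the total jump. The bound `η` allows `t₁` to be taken arbitrarily close to the leg. -/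
theorem totalJump_interval (a : Fin m) {η : ℝ} (hη : η < 1) : ∃ l, ∃ t₀ ∈ Ioo (0 : ℝ) 1,
    ∃ t₁ ∈ Ioo (0 : ℝ) 1, η < t₁ ∧ (∀ t ∈ Ioo (0 : ℝ) 1, ∀ᶠ s in 𝓝[≠] t, c.level (.inl a) s = l) ∧
      orbits (c.state (.inl a) t₀) = l.2 ∧ orbits (c.state (.inl a) t₁) = l.2 ∧
      c.totalJump (.inl a) = clash (c.state (.inl a) t₁) - clash (c.state (.inl a) t₀) := by
  obtain ⟨l, hl⟩ := c.exists_level (.inl a)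
  have hp : ∀ v ∈ D.overCrossings (.inl a), v.1.2 ∈ Ioo (0 : ℝ) 1 := by
    intro v hv
    obtain ⟨hv, e⟩ := Diagram.mem_overCrossings.1 hv
    have := D.inner_over hv
    rwa [e] at this
  have h0 : ∀ᶠ t in 𝓝[>] (0 : ℝ), ∀ v ∈ D.overCrossings (.inl a), t < v.1.2 :=
    (Filter.eventually_all_finset _).2 fun v hv =>
      eventually_nhdsWithin_of_eventually_nhds (eventually_lt_nhds (hp v hv).1)
  have h1 : ∀ᶠ t in 𝓝[<] (1 : ℝ), ∀ v ∈ D.overCrossings (.inl a), v.1.2 < t :=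
    (Filter.eventually_all_finset _).2 fun v hv =>
      eventually_nhdsWithin_of_eventually_nhds (eventually_gt_nhds (hp v hv).2)
  obtain ⟨e₀, he₀, h0⟩ := (mem_nhdsGT_iff_exists_Ioo_subset' zero_lt_one).1 h0
  obtain ⟨e₁, he₁, h1⟩ := (mem_nhdsLT_iff_exists_Ioo_subset' zero_lt_one).1 h1
  have he₀ : 0 < e₀ := he₀
  have he₁ : e₁ < 1 := he₁
  obtain ⟨u₀, hu₀, hu₀'⟩ := exists_between (lt_min he₀ one_pos)
  obtain ⟨u₁, hu₁, hu₁'⟩ := exists_between (max_lt (max_lt he₁ hη) one_pos)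
  rw [lt_min_iff] at hu₀'
  rw [max_lt_iff, max_lt_iff] at hu₁
  -- The level is known only up to isolated exceptions, so `u₀` and `u₁` are replaced by nearby
  -- regular parameters.
  obtain ⟨t₀, k1, k2⟩ := ((hl u₀ ⟨hu₀, hu₀'.2⟩).and
    (eventually_nhdsWithin_of_eventually_nhds (Ioo_mem_nhds hu₀ (lt_min hu₀'.1 hu₀'.2)))).exists
  obtain ⟨t₁, k3, k4⟩ := ((hl u₁ ⟨hu₁.2, hu₁'⟩).and
    (eventually_nhdsWithin_of_eventually_nhds
      (Ioo_mem_nhds (max_lt (max_lt hu₁.1.1 hu₁.1.2) hu₁.2) hu₁'))).exists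
  have k2' := lt_min_iff.1 k2.2
  have k4' := max_lt_iff.1 k4.1
  have k4'' := max_lt_iff.1 k4'.1
  have z0 : c.height (.inl a) t₀ = 0 := by
    refine Finset.sum_eq_zero fun v hv => ?_
    have := h0 (show t₀ ∈ Ioo 0 e₀ from ⟨k2.1, k2'.1⟩) v hv
    rw [Int.ceil_eq_iff.2, mul_zero]
    push_cast
    constructor <;> linarith [(hp v hv).2, k2.1]
  have z1 : c.height (.inl a) t₁ = c.totalJump (.inl a) := by
    refine Finset.sum_congr rfl fun v hv => ?_
    have := h1 (show t₁ ∈ Ioo e₁ 1 from ⟨k4''.1, k4.2⟩) v hv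
    rw [Int.ceil_eq_iff.2, mul_one]
    push_cast
    constructor <;> linarith [(hp v hv).1, k4.2]
  refine ⟨l, t₀, ⟨k2.1, k2'.2⟩, t₁, ⟨k4'.2, k4.2⟩, k4''.2, hl, by rw [← k1]; rfl,
    by rw [← k3]; rfl, ?_⟩
  have e := congrArg Prod.fst (k1.trans k3.symm)
  simp only [level, z0, z1] at e
  linarith

theorem abs_totalJump_le (a : Fin m) : |c.totalJump (.inl a)| ≤ 1 := by
  obtain ⟨l, t₀, -, t₁, -, -, -, -, -, h⟩ := c.totalJump_interval a zero_lt_one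
  rw [h]
  rcases clash_mem (c.state (.inl a) t₀) with h1 | h1 <;>
  rcases clash_mem (c.state (.inl a) t₁) with h2 | h2 <;> rw [h1, h2] <;> decide

/-- Orbits are constant along the strand: a region or arc color 0 near one point is 0 near both ends
too, where `clash` then vanishes. -/
theorem totalJump_eq_zero {a : Fin m} {F : Filter ℝ} [F.NeBot] {t : ℝ} (ht : t ∈ Ioo (0 : ℝ) 1)
    (hF : F ≤ 𝓝[≠] t) {o : Bool × Bool} (h : ∀ᶠ s in F, orbits (c.state (.inl a) s) = o)
    (ho : o.1 = true ∨ o.2 = true) : c.totalJump (.inl a) = 0 := by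
  obtain ⟨l, t₀, -, t₁, -, -, hl, h0, h1, e⟩ := c.totalJump_interval a zero_lt_one
  obtain ⟨s, e1, e2⟩ := (h.and (hF (hl t ht))).exists
  have e3 : l.2 = o := by
    rw [← e1, ← e2]
    rfl
  rw [e3] at h0 h1
  rw [← h0] at ho
  rw [e, clash_of_orbit ho, clash_of_orbit (s := c.state (.inl a) t₁), sub_self]
  rw [h0, ← h1] at ho
  exact ho

theorem weight_snd : (c.weight φ).2 = ∑ i, c.totalJump i := by
  classical
  rw [weight, Prod.snd_sum]
  rw [← Finset.sum_fiberwise (s := D.crossings) (g := fun v => v.1.1)]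
  refine Finset.sum_congr rfl fun i _ => ?_
  rw [totalJump]
  refine Finset.sum_congr (by ext; simp [Diagram.overCrossings]) fun v _ => ?_
  rw [jump]
  split_ifs <;> rfl

end Coloring

/-! ### The bound on the weight. -/

theorem φ_fst_ne_zero {y x z : P3} (h : (φ y x z).1 ≠ 0) :
    y.orbit = true ∧ x.orbit = false ∧ z.orbit = true := by
  cases y <;> cases x <;> cases z <;> simp_all [φ, P3.orbit]

/-- The weight of a coloring of a diagram with one circle is bounded by the number of intervals. -/
theorem Coloring.size_weight_le {n : ℕ} {D : Diagram n 1} (c : Coloring P3 D) :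
    size (c.weight φ) ≤ n := by
  have hsnd : (c.weight φ).2 = ∑ a, c.totalJump (.inl a) := by
    rw [c.weight_snd, Fintype.sum_sum_type,
      Finset.sum_eq_zero (s := (Finset.univ : Finset (Fin 1))) fun j _ => c.totalJump_circle j,
      add_zero]
  have hle : |(c.weight φ).2| ≤ ∑ a, |c.totalJump (.inl a)| := by
    rw [hsnd]
    exact Finset.abs_sum_le_sum_abs _ _
  rw [size]
  by_cases h0 : (c.weight φ).1 = 0
  · rw [h0]
    have : ∑ a, |c.totalJump (.inl a)| ≤ ∑ _a : Fin n, (1 : ℤ) :=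
      Finset.sum_le_sum fun a _ => c.abs_totalJump_le a
    simp at this
    simp
    omega
  · have hval : ((c.weight φ).1.val : ℤ) ≤ 1 := by
      have := ZMod.val_lt (c.weight φ).1
      omega
    -- One interval without a jump lowers the bound on `|β|` to `n - 1`, which makes room for `α =
    -- 1`.
    suffices hz : ∃ a, c.totalJump (.inl a) = 0 by
      obtain ⟨a, ha⟩ := hz
      have : ∑ b, |c.totalJump (.inl b)| + 1 ≤ ∑ _b : Fin n, (1 : ℤ) := by
        rw [← Finset.add_sum_erase _ _ (Finset.mem_univ a), ha,
          ← Finset.add_sum_erase _ (fun _ => (1 : ℤ)) (Finset.mem_univ a), abs_zero, zero_add,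
          add_comm]
        exact add_le_add_right (Finset.sum_le_sum fun b _ => c.abs_totalJump_le b) 1
      simp at this
      omega
    obtain ⟨v, hv, hφ⟩ : ∃ v ∈ D.crossings,
        (φ (c.color v).1 (c.color v).2.1 (c.color v).2.2).1 ≠ 0 := by
      by_contra hcon
      push Not at hcon
      refine h0 ?_
      rw [Coloring.weight, Prod.fst_sum]
      refine Finset.sum_eq_zero fun v hv => ?_
      split_ifs
      · exact hcon v hv
      · rw [Prod.fst_neg, hcon v hv, neg_zero]
    obtain ⟨hy, hx, hz⟩ := φ_fst_ne_zero hφ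
    obtain ⟨ob, oa, ub, ua, -, h1, -, h2, -, -, -, h3, -, h4⟩ := c.state_crossing hv
    have hov := D.inner_over hv
    have hun := D.inner_under hv
    obtain ⟨⟨i, t⟩, ⟨j, s⟩⟩ := v
    simp only at *
    rw [hy, hz] at h3
    rw [hy, hx] at h4
    have h1' : ∀ᶠ t' in 𝓝[>] t, orbits (c.state i t') = (true, true) :=
      h1.mono fun _ e => by rw [e, h3]
    have h2' : ∀ᶠ t' in 𝓝[>] s, orbits (c.state j t') = (true, false) :=
      h2.mono fun _ e => by rw [e, h4]
    rcases i with a | i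
    · exact ⟨a, c.totalJump_eq_zero hov (nhdsGT_le_nhdsNE t) h1' (Or.inl rfl)⟩
    rcases j with a | j
    · exact ⟨a, c.totalJump_eq_zero hun (nhdsGT_le_nhdsNE s) h2' (Or.inl rfl)⟩
    -- Both strands would lie on the only circle, but its arcs have one orbit, while over-arc and
    -- under-arc have different ones here.
    exfalso
    obtain rfl : i = j := Subsingleton.elim i j
    obtain ⟨l, hl⟩ := c.exists_level (.inr i)
    obtain ⟨t', e1, e2⟩ := (h1'.and (nhdsGT_le_nhdsNE t (hl t (mem_univ _)))).exists
    obtain ⟨s', e3, e4⟩ := (h2'.and (nhdsGT_le_nhdsNE s (hl s (mem_univ _)))).exists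
    have h5 : orbits (c.state (.inr i) t') = orbits (c.state (.inr i) s') :=
      congrArg Prod.snd (e2.trans e4.symm)
    rw [e1, e3] at h5
    simp at h5

/-! The checkerboard function of a closed curve: a two-valued function on the complement of the
curve that changes its value across the curve, namely the parity of the winding number. -/

/-- The parity of the winding number of a closed plane curve around a point, as a sign. -/
def windSign (Γ : ℝ → ℂ) (z : ℂ) : ℂ :=
  Complex.exp ((∫ t in (0 : ℝ)..1, deriv Γ t / (Γ t - z)) / 2)

section Plane

variable {Γ : ℝ → ℂ}

theorem continuous_windIntegrand (hΓ : ContDiff ℝ ∞ Γ) {z : ℂ} (hz : z ∉ range Γ) :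
    Continuous fun t => deriv Γ t / (Γ t - z) :=
  (hΓ.continuous_deriv (by simp)).div (hΓ.continuous.sub continuous_const)
    fun t e => hz ⟨t, sub_eq_zero.1 e⟩

/-- With `I` the integral up to `t`, the product `exp (-I t) * (Γ t - z)` has derivative 0. Since
`Γ` closes up, the exponential of the full integral is 1. -/
theorem windSign_sq (hΓ : ContDiff ℝ ∞ Γ) (hper : Function.Periodic Γ 1) {z : ℂ}
    (hz : z ∉ range Γ) : windSign Γ z ^ 2 = 1 := by
  have hc := continuous_windIntegrand hΓ hz
  set I : ℝ → ℂ := fun t => ∫ u in (0 : ℝ)..t, deriv Γ u / (Γ u - z) with hI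
  have hId : ∀ t, HasDerivAt I (deriv Γ t / (Γ t - z)) t := fun t =>
    intervalIntegral.integral_hasDerivAt_right (hc.intervalIntegrable _ _)
      hc.aestronglyMeasurable.stronglyMeasurableAtFilter hc.continuousAt
  have hd : ∀ t, HasDerivAt (fun t => Complex.exp (-I t) * (Γ t - z)) 0 t := by
    intro t
    have h1 := ((hId t).neg.cexp).mul
      (((hΓ.differentiable (by simp)) t).hasDerivAt.sub_const z)
    refine h1.congr_deriv ?_
    have : Γ t - z ≠ 0 := fun e => hz ⟨t, sub_eq_zero.1 e⟩
    field_simp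
    ring
  have h := is_const_of_deriv_eq_zero (fun t => (hd t).differentiableAt)
    (fun t => (hd t).deriv) 1 0
  have h0 : I 0 = 0 := intervalIntegral.integral_same
  have h1 : Γ 1 = Γ 0 := by simpa using hper 0
  simp only [h0, h1, neg_zero, Complex.exp_zero] at h
  have hne : Γ 0 - z ≠ 0 := fun e => hz ⟨0, sub_eq_zero.1 e⟩
  have h2 := mul_right_cancel₀ hne h
  rw [windSign, ← Complex.exp_nat_mul, Nat.cast_ofNat, mul_div_cancel₀ _ (two_ne_zero)]
  rw [Complex.exp_neg, inv_eq_one] at h2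
  exact h2

theorem windSign_eq (hΓ : ContDiff ℝ ∞ Γ) (hper : Function.Periodic Γ 1) {z : ℂ}
    (hz : z ∉ range Γ) : windSign Γ z = 1 ∨ windSign Γ z = -1 :=
  mul_self_eq_one_iff.1 ((sq _).symm.trans (windSign_sq hΓ hper hz))

/-- Dominated convergence: the piece of curve keeps a distance `ε` from `z₀`, hence `ε / 2` from
nearby points. Arbitrary limits are allowed because the jump across the curve needs the pieces away
from the crossing point. -/
theorem continuousAt_integral (hΓ : ContDiff ℝ ∞ Γ) {a b : ℝ} {z₀ : ℂ}
    (hz : ∀ t ∈ uIcc a b, Γ t ≠ z₀) :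
    ContinuousAt (fun z => ∫ t in a..b, deriv Γ t / (Γ t - z)) z₀ := by
  have hcd : Continuous (deriv Γ) := hΓ.continuous_deriv (by simp)
  have hK : IsClosed (Γ '' uIcc a b) := (isCompact_uIcc.image hΓ.continuous).isClosed
  have hz' : z₀ ∈ (Γ '' uIcc a b)ᶜ := by
    rintro ⟨t, ht, e⟩
    exact hz t ht e
  obtain ⟨ε, hε, hball⟩ := Metric.isOpen_iff.1 hK.isOpen_compl z₀ hz'
  have hdist : ∀ t ∈ uIcc a b, ε ≤ ‖Γ t - z₀‖ := by
    intro t ht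
    by_contra h
    exact hball (show Γ t ∈ Metric.ball z₀ ε by
      rw [Metric.mem_ball, dist_eq_norm]
      exact not_le.1 h) ⟨t, ht, rfl⟩
  refine intervalIntegral.continuousAt_of_dominated_interval
    (bound := fun t => ‖deriv Γ t‖ * (2 / ε)) ?_ ?_ ?_ ?_
  · refine Eventually.of_forall fun z => ?_
    have h1 : Measurable fun t => deriv Γ t / (Γ t - z) :=
      hcd.measurable.div (hΓ.continuous.measurable.sub_const z)
    exact h1.aestronglyMeasurable
  · filter_upwards [Metric.ball_mem_nhds z₀ (half_pos hε)] with z hzb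
    refine Eventually.of_forall fun t ht => ?_
    have h1 := hdist t (uIoc_subset_uIcc ht)
    rw [Metric.mem_ball, dist_eq_norm] at hzb
    have h2 : ‖Γ t - z₀‖ ≤ ‖Γ t - z‖ + ‖z - z₀‖ := by
      have := norm_add_le (Γ t - z) (z - z₀)
      rwa [sub_add_sub_cancel] at this
    rw [norm_div, div_eq_mul_inv]
    refine mul_le_mul_of_nonneg_left ?_ (norm_nonneg _)
    rw [← inv_div]
    exact inv_anti₀ (half_pos hε) (by linarith)
  · exact (hcd.norm.mul continuous_const).intervalIntegrable _ _
  · refine Eventually.of_forall fun t ht => ?_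
    have h1 : Γ t - z₀ ≠ 0 := sub_ne_zero.2 (hz t (uIoc_subset_uIcc ht))
    exact continuousAt_const.div (continuousAt_const.sub continuousAt_id) h1

theorem isClosed_range_of_periodic (hΓ : ContDiff ℝ ∞ Γ) (hper : Function.Periodic Γ 1) :
    IsClosed (range Γ) := by
  rw [← hper.image_Icc one_pos 0]
  exact (isCompact_Icc.image hΓ.continuous).isClosed

theorem eventually_windSign_eq (hΓ : ContDiff ℝ ∞ Γ) (hper : Function.Periodic Γ 1) {z₀ : ℂ}
    (hz : z₀ ∉ range Γ) : ∀ᶠ z in 𝓝 z₀, windSign Γ z = windSign Γ z₀ := by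
  have hc : ContinuousAt (windSign Γ) z₀ := by
    have h := continuousAt_integral hΓ (a := 0) (b := 1) (z₀ := z₀) fun t _ e => hz ⟨t, e⟩
    exact (h.div_const 2).cexp
  have h1 : ∀ᶠ z in 𝓝 z₀, windSign Γ z ≠ - windSign Γ z₀ := by
    refine hc.eventually_ne fun e => ?_
    rcases windSign_eq hΓ hper hz with h | h <;> rw [h] at e <;> norm_num at e
  filter_upwards [h1, (isClosed_range_of_periodic hΓ hper).isOpen_compl.mem_nhds hz] with z h2 h3
  rcases windSign_eq hΓ hper hz with h | h <;> rcases windSign_eq hΓ hper h3 with h' | h' <;>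
    simp_all

theorem exists_windSign_eq_one (hΓ : ContDiff ℝ ∞ Γ) (hper : Function.Periodic Γ 1) :
    ∃ R : ℝ, ∀ z, R < ‖z‖ → windSign Γ z = 1 := by
  have hcd : Continuous (deriv Γ) := hΓ.continuous_deriv (by simp)
  obtain ⟨A, hA⟩ := (isCompact_Icc (a := (0 : ℝ)) (b := 1)).exists_bound_of_continuousOn
    hΓ.continuous.continuousOn
  obtain ⟨B, hB⟩ := (isCompact_Icc (a := (0 : ℝ)) (b := 1)).exists_bound_of_continuousOn
    hcd.continuousOn
  have hB0 : 0 ≤ B := (norm_nonneg _).trans (hB 0 (by simp))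
  -- Beyond this radius the distance to the curve exceeds the bound `B` on the speed, so the
  -- integral has norm at most 1, while the value -1 would force norm at least 2.
  refine ⟨A + B + 1, fun z hz => ?_⟩
  have hzr : z ∉ range Γ := by
    rw [← hper.image_Icc one_pos 0]
    rintro ⟨t, ht, rfl⟩
    have := hA t (by simpa using ht)
    linarith
  have hI : ‖∫ t in (0 : ℝ)..1, deriv Γ t / (Γ t - z)‖ ≤ 1 := by
    have := intervalIntegral.norm_integral_le_of_norm_le_const (a := (0 : ℝ)) (b := 1) (C := 1)
      (f := fun t => deriv Γ t / (Γ t - z)) ?_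
    · simpa using this
    · intro t ht
      rw [uIoc_of_le zero_le_one] at ht
      have h1 := hA t (Ioc_subset_Icc_self ht)
      have h2 := hB t (Ioc_subset_Icc_self ht)
      have h3 : ‖z‖ ≤ ‖Γ t‖ + ‖Γ t - z‖ := by
        have := norm_sub_le (Γ t) (Γ t - z)
        rwa [sub_sub_cancel] at this
      rw [norm_div]
      exact div_le_one_of_le₀ (by linarith) (norm_nonneg _)
  rcases windSign_eq hΓ hper hzr with h | h
  · exact h
  · exfalso
    have h1 : ‖Complex.exp ((∫ t in (0 : ℝ)..1, deriv Γ t / (Γ t - z)) / 2) - 1‖ ≤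
        2 * ‖(∫ t in (0 : ℝ)..1, deriv Γ t / (Γ t - z)) / 2‖ := by
      apply Complex.norm_exp_sub_one_le
      rw [norm_div, Complex.norm_two]
      linarith
    rw [windSign] at h
    rw [h, norm_div, Complex.norm_two] at h1
    norm_num at h1
    linarith

theorem log_sub_log_neg_of_im_pos {w : ℂ} (hw : 0 < w.im) :
    Complex.log w - Complex.log (-w) = Real.pi * Complex.I := by
  simp only [Complex.log, norm_neg, Complex.arg_neg_eq_arg_sub_pi_of_im_pos hw]
  push_cast
  ring

theorem log_sub_log_neg_of_im_neg {w : ℂ} (hw : w.im < 0) :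
    Complex.log w - Complex.log (-w) = -(Real.pi * Complex.I) := by
  have := log_sub_log_neg_of_im_pos (w := -w) (by simpa using hw)
  rw [neg_neg] at this
  linear_combination -this

/-- On a short piece of a curve the integrand has a logarithm as a primitive. -/
theorem integral_eq_log (hΓ : ContDiff ℝ ∞ Γ) {a b : ℝ} (hab : a ≤ b) {z c : ℂ} (hc : c ≠ 0)
    (h : ∀ t ∈ Icc a b, c * (Γ t - z) ∈ Complex.slitPlane) :
    ∫ t in a..b, deriv Γ t / (Γ t - z) =
      Complex.log (c * (Γ b - z)) - Complex.log (c * (Γ a - z)) := by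
  have hne : ∀ t ∈ Icc a b, Γ t - z ≠ 0 := fun t ht e =>
    Complex.slitPlane_ne_zero (h t ht) (by rw [e, mul_zero])
  refine intervalIntegral.integral_eq_sub_of_hasDerivAt (f := fun t => Complex.log (c * (Γ t - z)))
    ?_ ?_
  · intro t ht
    rw [uIcc_of_le hab] at ht
    have h1 := ((((hΓ.differentiable (by simp)) t).hasDerivAt.sub_const z).const_mul c).clog_real
      (h t ht)
    rwa [mul_div_mul_left _ _ hc] at h1
  · refine ContinuousOn.intervalIntegrable ?_
    rw [uIcc_of_le hab]
    exact (hΓ.continuous_deriv (by simp)).continuousOn.div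
      (hΓ.continuous.sub continuous_const).continuousOn hne

/-- For two points approaching the curve along the normal from opposite sides, the integrals over
the far part have the same limit and those over a short piece differ by `2πi` in the limit. So the
quotient of the signs tends to `exp (πi) = -1`. -/
theorem windSign_jump (hΓ : ContDiff ℝ ∞ Γ) (hper : Function.Periodic Γ 1) {t₀ : ℝ}
    (hd : deriv Γ t₀ ≠ 0)
    (hsimple : ∀ t ∈ Icc (t₀ - 1 / 2) (t₀ + 1 / 2), Γ t = Γ t₀ → t = t₀) :
    ∀ᶠ s : ℝ in 𝓝[>] 0,
      Γ t₀ + Complex.I * deriv Γ t₀ * s ∉ range Γ ∧ Γ t₀ - Complex.I * deriv Γ t₀ * s ∉ range Γ ∧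
      windSign Γ (Γ t₀ + Complex.I * deriv Γ t₀ * s) ≠
        windSign Γ (Γ t₀ - Complex.I * deriv Γ t₀ * s) := by
  set x := Γ t₀ with hx
  set τ := deriv Γ t₀ with hτ
  have hcont := hΓ.continuous
  -- On this piece the curve is so close to its tangent that the real part of `(Γ t - x) / τ` has
  -- the sign of `t - t₀`.
  obtain ⟨δ, hδ, hδ2, hu⟩ : ∃ δ > 0, δ < 1 / 2 ∧ ∀ t, |t - t₀| ≤ δ →
      ‖(Γ t - x) / τ - (t - t₀ : ℝ)‖ ≤ |t - t₀| / 2 := by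
    have h1 : HasDerivAt Γ τ t₀ := ((hΓ.differentiable (by simp)) t₀).hasDerivAt
    have h2 := h1.div_const τ
    rw [div_self hd] at h2
    have h3 := (hasDerivAt_iff_isLittleO.1 h2).def (show (0 : ℝ) < 1 / 2 by norm_num)
    obtain ⟨ε, hε, h4⟩ := Metric.eventually_nhds_iff.1 h3
    refine ⟨min (ε / 2) (1 / 4), by positivity, by
      have := min_le_right (ε / 2) (1 / 4 : ℝ); linarith, fun t ht => ?_⟩
    have h5 : dist t t₀ < ε := by
      rw [Real.dist_eq]
      have := min_le_left (ε / 2) (1 / 4 : ℝ)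
      linarith
    have h6 := h4 h5
    rw [Real.norm_eq_abs] at h6
    have h7 : Γ t / τ - Γ t₀ / τ - (t - t₀) • (1 : ℂ) = (Γ t - x) / τ - (t - t₀ : ℝ) := by
      rw [Complex.real_smul, mul_one, ← hx, sub_div]
    rw [h7] at h6
    linarith
  have hre : ∀ t, |t - t₀| ≤ δ → |((Γ t - x) / τ).re - (t - t₀)| ≤ |t - t₀| / 2 := by
    intro t ht
    have := (Complex.abs_re_le_norm _).trans (hu t ht)
    rwa [Complex.sub_re, Complex.ofReal_re] at this
  have hre_pos : ∀ t, |t - t₀| ≤ δ → t₀ < t → 0 < ((Γ t - x) / τ).re := by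
    intro t ht h
    have h1 := (abs_le.1 (hre t ht)).1
    rw [abs_of_pos (sub_pos.2 h)] at h1
    linarith
  have hre_neg : ∀ t, |t - t₀| ≤ δ → t < t₀ → ((Γ t - x) / τ).re < 0 := by
    intro t ht h
    have h1 := (abs_le.1 (hre t ht)).2
    rw [abs_of_neg (sub_neg.2 h)] at h1
    linarith
  -- The factors `±I / τ` turn the short piece, seen from either point, across the positive real
  -- axis: it is real only at `t₀`, with value `s > 0`. Hence it avoids the cut of the logarithm.
  have e1 : ∀ (t s : ℝ), Complex.I / τ * (Γ t - (x + Complex.I * τ * s)) =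
      Complex.I * ((Γ t - x) / τ) + s := by
    intro t s
    field_simp
    linear_combination - τ * s * Complex.I_sq
  have e2 : ∀ (t s : ℝ), -Complex.I / τ * (Γ t - (x - Complex.I * τ * s)) =
      -(Complex.I * ((Γ t - x) / τ)) + s := by
    intro t s
    field_simp
    linear_combination - τ * s * Complex.I_sq
  have hslit1 : ∀ t, |t - t₀| ≤ δ → ∀ s : ℝ, 0 < s →
      Complex.I * ((Γ t - x) / τ) + s ∈ Complex.slitPlane := by
    intro t ht s hs
    rw [Complex.mem_slitPlane_iff]
    rcases lt_trichotomy t t₀ with h | h | h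
    · exact Or.inr (by simpa using (hre_neg t ht h).ne)
    · left
      rw [h, ← hx]
      simpa using hs
    · exact Or.inr (by simpa using (hre_pos t ht h).ne')
  have hslit2 : ∀ t, |t - t₀| ≤ δ → ∀ s : ℝ, 0 < s →
      -(Complex.I * ((Γ t - x) / τ)) + s ∈ Complex.slitPlane := by
    intro t ht s hs
    rw [Complex.mem_slitPlane_iff]
    rcases lt_trichotomy t t₀ with h | h | h
    · exact Or.inr (by simpa using (hre_neg t ht h).ne)
    · left
      rw [h, ← hx]
      simpa using hs
    · exact Or.inr (by simpa using (hre_pos t ht h).ne')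
  have habs : ∀ t ∈ Icc (t₀ - δ) (t₀ + δ), |t - t₀| ≤ δ := fun t ht =>
    abs_le.2 ⟨by linarith [ht.1], by linarith [ht.2]⟩
  have hc1 : Complex.I / τ ≠ 0 := div_ne_zero Complex.I_ne_zero hd
  have hc2 : -Complex.I / τ ≠ 0 := div_ne_zero (neg_ne_zero.2 Complex.I_ne_zero) hd
  have hplus : Tendsto (fun s : ℝ => x + Complex.I * τ * s) (𝓝[>] 0) (𝓝 x) := by
    have : Tendsto (fun s : ℝ => x + Complex.I * τ * s) (𝓝 0) (𝓝 (x + Complex.I * τ * (0 : ℝ))) :=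
      Continuous.tendsto (by fun_prop) 0
    rw [Complex.ofReal_zero, mul_zero, add_zero] at this
    exact this.mono_left nhdsWithin_le_nhds
  have hminus : Tendsto (fun s : ℝ => x - Complex.I * τ * s) (𝓝[>] 0) (𝓝 x) := by
    have : Tendsto (fun s : ℝ => x - Complex.I * τ * s) (𝓝 0) (𝓝 (x - Complex.I * τ * (0 : ℝ))) :=
      Continuous.tendsto (by fun_prop) 0
    rw [Complex.ofReal_zero, mul_zero, sub_zero] at this
    exact this.mono_left nhdsWithin_le_nhds
  have hl : ∀ t ∈ uIcc (t₀ - 1 / 2) (t₀ - δ), Γ t ≠ x := by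
    intro t ht e
    rw [uIcc_of_le (by linarith)] at ht
    have := hsimple t ⟨ht.1, by linarith [ht.2]⟩ e
    linarith [ht.2]
  have hr : ∀ t ∈ uIcc (t₀ + δ) (t₀ + 1 / 2), Γ t ≠ x := by
    intro t ht e
    rw [uIcc_of_le (by linarith)] at ht
    have := hsimple t ⟨by linarith [ht.1], ht.2⟩ e
    linarith [ht.1]
  have hfar : ∀ᶠ z in 𝓝 x, z ∉ Γ '' uIcc (t₀ - 1 / 2) (t₀ - δ) ∧
      z ∉ Γ '' uIcc (t₀ + δ) (t₀ + 1 / 2) := by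
    refine Filter.Eventually.and ?_ ?_
    · refine (isCompact_uIcc.image hcont).isClosed.isOpen_compl.mem_nhds ?_
      rintro ⟨t, ht, e⟩
      exact hl t ht e
    · refine (isCompact_uIcc.image hcont).isClosed.isOpen_compl.mem_nhds ?_
      rintro ⟨t, ht, e⟩
      exact hr t ht e
  have hrange : ∀ z, (z ∉ Γ '' uIcc (t₀ - 1 / 2) (t₀ - δ) ∧
      z ∉ Γ '' uIcc (t₀ + δ) (t₀ + 1 / 2)) → (∀ t ∈ Icc (t₀ - δ) (t₀ + δ), Γ t ≠ z) →
      z ∉ range Γ := by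
    rintro z ⟨h1, h2⟩ h3
    rw [← hper.image_Icc one_pos (t₀ - 1 / 2)]
    rintro ⟨t, ht, e⟩
    rcases lt_or_ge t (t₀ - δ) with h | h
    · exact h1 ⟨t, by rw [uIcc_of_le (by linarith)]; exact ⟨ht.1, h.le⟩, e⟩
    · rcases le_or_gt t (t₀ + δ) with h' | h'
      · exact h3 t ⟨h, h'⟩ e
      · exact h2 ⟨t, by rw [uIcc_of_le (by linarith)]; exact ⟨h'.le, by linarith [ht.2]⟩, e⟩
  have hsplit : ∀ z, z ∉ range Γ → ∫ t in (0 : ℝ)..1, deriv Γ t / (Γ t - z) =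
      (∫ t in (t₀ - 1 / 2)..(t₀ - δ), deriv Γ t / (Γ t - z)) +
      (∫ t in (t₀ - δ)..(t₀ + δ), deriv Γ t / (Γ t - z)) +
      ∫ t in (t₀ + δ)..(t₀ + 1 / 2), deriv Γ t / (Γ t - z) := by
    intro z hz
    have hc := continuous_windIntegrand hΓ hz
    have hp : Function.Periodic (fun t => deriv Γ t / (Γ t - z)) 1 := by
      intro t
      have h1 : deriv Γ (t + 1) = deriv Γ t := by
        rw [← deriv_comp_add_const]
        congr 1
        exact funext hper
      simp only [h1, hper t]
    -- By periodicity the integral is taken over a period centered at `t₀`.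
    have h2 := hp.intervalIntegral_add_eq 0 (t₀ - 1 / 2)
    rw [zero_add, show t₀ - 1 / 2 + 1 = t₀ + 1 / 2 by ring] at h2
    rw [h2, intervalIntegral.integral_add_adjacent_intervals (hc.intervalIntegrable _ _)
      (hc.intervalIntegrable _ _), intervalIntegral.integral_add_adjacent_intervals
      (hc.intervalIntegrable _ _) (hc.intervalIntegrable _ _)]
  set w₁ := Complex.I * ((Γ (t₀ + δ) - x) / τ) with hw₁
  set w₀ := Complex.I * ((Γ (t₀ - δ) - x) / τ) with hw₀
  have hw₁' : 0 < w₁.im := by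
    have := hre_pos (t₀ + δ) (by rw [add_sub_cancel_left, abs_of_pos hδ]) (by linarith)
    simpa [hw₁] using this
  have hw₀' : w₀.im < 0 := by
    have := hre_neg (t₀ - δ) (by rw [sub_sub_cancel_left, abs_neg, abs_of_pos hδ]) (by linarith)
    simpa [hw₀] using this
  have hlog : ∀ w : ℂ, w.im ≠ 0 →
      Tendsto (fun s : ℝ => Complex.log (w + s)) (𝓝[>] 0) (𝓝 (Complex.log w)) := by
    intro w hw
    have h1 : Tendsto (fun s : ℝ => w + s) (𝓝 0) (𝓝 (w + (0 : ℝ))) :=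
      Continuous.tendsto (by fun_prop) 0
    rw [Complex.ofReal_zero, add_zero] at h1
    exact ((continuousAt_clog (Complex.mem_slitPlane_iff.2 (Or.inr hw))).tendsto.comp h1).mono_left
      nhdsWithin_le_nhds
  have hbl := (continuousAt_integral hΓ hl).tendsto
  have hbr := (continuousAt_integral hΓ hr).tendsto
  have hlim := ((((hbl.comp hplus).sub (hbl.comp hminus)).add
    ((hbr.comp hplus).sub (hbr.comp hminus))).add
    (((hlog w₁ hw₁'.ne').sub (hlog w₀ hw₀'.ne)).sub
      ((hlog (-w₁) (by simpa using hw₁'.ne')).sub (hlog (-w₀) (by simpa using hw₀'.ne)))))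
  -- The ends `w₁` and `w₀` of the piece lie above and below the real axis; comparing logarithms of
  -- `w` and `-w` contributes `πi` at each end.
  have hval : (Complex.log w₁ - Complex.log w₀ - (Complex.log (-w₁) - Complex.log (-w₀))) =
      2 * Real.pi * Complex.I := by
    linear_combination log_sub_log_neg_of_im_pos hw₁' - log_sub_log_neg_of_im_neg hw₀'
  rw [sub_self, sub_self, add_zero, zero_add, hval] at hlim
  have hexp := ((Complex.continuous_exp.tendsto _).comp (hlim.div_const 2))
  rw [show 2 * (Real.pi : ℂ) * Complex.I / 2 = Real.pi * Complex.I by ring,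
    Complex.exp_pi_mul_I] at hexp
  have hne := hexp.eventually_ne (show (-1 : ℂ) ≠ 1 by norm_num)
  filter_upwards [hne, hplus.eventually hfar, hminus.eventually hfar, self_mem_nhdsWithin]
    with s h1 h2 h3 h4
  have h4 : 0 < s := h4
  have s1 : ∀ t ∈ Icc (t₀ - δ) (t₀ + δ),
      Complex.I / τ * (Γ t - (x + Complex.I * τ * s)) ∈ Complex.slitPlane := by
    intro t ht
    rw [e1]
    exact hslit1 t (habs t ht) s h4
  have s2 : ∀ t ∈ Icc (t₀ - δ) (t₀ + δ),
      -Complex.I / τ * (Γ t - (x - Complex.I * τ * s)) ∈ Complex.slitPlane := by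
    intro t ht
    rw [e2]
    exact hslit2 t (habs t ht) s h4
  have r1 : x + Complex.I * τ * s ∉ range Γ := hrange _ h2 fun t ht e =>
    Complex.slitPlane_ne_zero (s1 t ht) (by rw [e, sub_self, mul_zero])
  have r2 : x - Complex.I * τ * s ∉ range Γ := hrange _ h3 fun t ht e =>
    Complex.slitPlane_ne_zero (s2 t ht) (by rw [e, sub_self, mul_zero])
  refine ⟨r1, r2, fun e => h1 ?_⟩
  have i1 := integral_eq_log hΓ (by linarith) hc1 s1
  have i2 := integral_eq_log hΓ (by linarith) hc2 s2
  rw [e1, e1, ← hw₁, ← hw₀] at i1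
  rw [e2, e2, ← hw₁, ← hw₀] at i2
  have j1 := hsplit _ r1
  have j2 := hsplit _ r2
  rw [i1] at j1
  rw [i2] at j2
  rw [windSign, windSign] at e
  have e' : Complex.exp ((∫ t in (0 : ℝ)..1, deriv Γ t / (Γ t - (x + Complex.I * τ * s))) / 2 -
      (∫ t in (0 : ℝ)..1, deriv Γ t / (Γ t - (x - Complex.I * τ * s))) / 2) = 1 := by
    rw [Complex.exp_sub, e, div_self (Complex.exp_ne_zero _)]
  rw [← e', j1, j2]
  simp only [Function.comp_apply]
  congr 1
  ring

end Plane

/-- Stereographic projection from the north pole. -/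
def stereo (y : E3) : ℂ := (1 - y 2)⁻¹ • (y 0 • (1 : ℂ) + y 1 • Complex.I)

/-- The inverse of stereographic projection. -/
def stereoInv (z : ℂ) : E3 :=
  (z.re ^ 2 + z.im ^ 2 + 1)⁻¹ • !₂[2 * z.re, 2 * z.im, z.re ^ 2 + z.im ^ 2 - 1]

theorem sum_sq_of_mem_S2 {y : E3} (hy : y ∈ S2) : y 0 ^ 2 + y 1 ^ 2 + y 2 ^ 2 = 1 := by
  have h := congrArg (fun r : ℝ => r ^ 2) (mem_S2.1 hy)
  simp only [EuclideanSpace.norm_sq_eq, Fin.sum_univ_three, Real.norm_eq_abs, sq_abs] at h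
  linarith

theorem mem_S2_of_sum_sq {y : E3} (hy : y 0 ^ 2 + y 1 ^ 2 + y 2 ^ 2 = 1) : y ∈ S2 := by
  rw [mem_S2, EuclideanSpace.norm_eq, Real.sqrt_eq_one, Fin.sum_univ_three]
  simpa using hy

theorem stereo_re (y : E3) : (stereo y).re = (1 - y 2)⁻¹ * y 0 := by
  rw [stereo, Complex.smul_re]
  simp

theorem stereo_im (y : E3) : (stereo y).im = (1 - y 2)⁻¹ * y 1 := by
  rw [stereo, Complex.smul_im]
  simp

theorem stereoInv_coord (z : ℂ) :
    stereoInv z 0 = (z.re ^ 2 + z.im ^ 2 + 1)⁻¹ * (2 * z.re) ∧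
    stereoInv z 1 = (z.re ^ 2 + z.im ^ 2 + 1)⁻¹ * (2 * z.im) ∧
    stereoInv z 2 = (z.re ^ 2 + z.im ^ 2 + 1)⁻¹ * (z.re ^ 2 + z.im ^ 2 - 1) := by
  simp [stereoInv]

theorem stereoInv_mem (z : ℂ) : stereoInv z ∈ S2 := by
  obtain ⟨h0, h1, h2⟩ := stereoInv_coord z
  have hpos : z.re ^ 2 + z.im ^ 2 + 1 ≠ 0 := by positivity
  apply mem_S2_of_sum_sq
  rw [h0, h1, h2]
  field_simp
  ring

theorem one_sub_stereoInv (z : ℂ) : 1 - stereoInv z 2 = 2 * (z.re ^ 2 + z.im ^ 2 + 1)⁻¹ := by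
  have hpos : z.re ^ 2 + z.im ^ 2 + 1 ≠ 0 := by positivity
  rw [(stereoInv_coord z).2.2]
  field_simp
  ring

theorem stereoInv_ne (z : ℂ) : stereoInv z 2 ≠ 1 := by
  have hpos : 0 < z.re ^ 2 + z.im ^ 2 + 1 := by positivity
  have h := one_sub_stereoInv z
  have : 0 < 2 * (z.re ^ 2 + z.im ^ 2 + 1)⁻¹ := by positivity
  intro e
  linarith

theorem stereo_stereoInv (z : ℂ) : stereo (stereoInv z) = z := by
  have hpos : z.re ^ 2 + z.im ^ 2 + 1 ≠ 0 := by positivity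
  obtain ⟨h0, h1, -⟩ := stereoInv_coord z
  apply Complex.ext
  · rw [stereo_re, one_sub_stereoInv, h0]
    field_simp
  · rw [stereo_im, one_sub_stereoInv, h1]
    field_simp

theorem norm_sq_stereo {y : E3} (hy : y ∈ S2) (h : y 2 ≠ 1) :
    (stereo y).re ^ 2 + (stereo y).im ^ 2 + 1 = 2 * (1 - y 2)⁻¹ := by
  have h1 : 1 - y 2 ≠ 0 := sub_ne_zero.2 h.symm
  rw [stereo_re, stereo_im]
  field_simp
  linear_combination sum_sq_of_mem_S2 hy

theorem stereoInv_stereo {y : E3} (hy : y ∈ S2) (h : y 2 ≠ 1) : stereoInv (stereo y) = y := by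
  have h1 : 1 - y 2 ≠ 0 := sub_ne_zero.2 h.symm
  obtain ⟨h0, h1', h2⟩ := stereoInv_coord (stereo y)
  have hn := norm_sq_stereo hy h
  rw [hn] at h0 h1' h2
  rw [show (stereo y).re ^ 2 + (stereo y).im ^ 2 - 1 = 2 * (1 - y 2)⁻¹ - 2 by linarith] at h2
  rw [stereo_re] at h0
  rw [stereo_im] at h1'
  ext c
  fin_cases c
  · change stereoInv (stereo y) 0 = y 0
    rw [h0]
    field_simp
  · change stereoInv (stereo y) 1 = y 1
    rw [h1']
    field_simp
  · change stereoInv (stereo y) 2 = y 2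
    rw [h2]
    field_simp
    ring

theorem contDiff_stereoInv : ContDiff ℝ ∞ stereoInv := by
  have hre : ContDiff ℝ ∞ Complex.re := Complex.reCLM.contDiff
  have him : ContDiff ℝ ∞ Complex.im := Complex.imCLM.contDiff
  have hs : ContDiff ℝ ∞ fun z : ℂ => z.re ^ 2 + z.im ^ 2 + 1 :=
    ((hre.pow 2).add (him.pow 2)).add contDiff_const
  refine (hs.inv fun z => by positivity).smul ?_
  rw [contDiff_euclidean]
  intro c
  fin_cases c
  · simpa using contDiff_const.mul hre
  · simpa using contDiff_const.mul him
  · simpa using ((hre.pow 2).add (him.pow 2)).sub contDiff_const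

theorem contDiff_stereo_comp {γ : ℝ → E3} (hγ : ContDiff ℝ ∞ γ) (h : ∀ t, γ t 2 ≠ 1) :
    ContDiff ℝ ∞ fun t => stereo (γ t) := by
  have hc := contDiff_euclidean.1 hγ
  exact ((contDiff_const.sub (hc 2)).inv fun t => sub_ne_zero.2 (h t).symm).smul
    (((hc 0).smul contDiff_const).add ((hc 1).smul contDiff_const))

theorem continuousAt_stereo {y : E3} (h : y 2 ≠ 1) : ContinuousAt stereo y := by
  have hc : ∀ c : Fin 3, Continuous fun y : E3 => y c := fun c => by fun_prop
  exact ((continuous_const.sub (hc 2)).continuousAt.inv₀ (sub_ne_zero.2 h.symm)).smul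
    (((hc 0).smul continuous_const).add ((hc 1).smul continuous_const)).continuousAt

/-- The properties of a checkerboard function of a closed curve on the sphere. -/
structure IsCheckerboard (γ : ℝ → E3) (f : E3 → Prop) : Prop where
  locally_const : ∀ y ∈ S2, y ∉ range γ → ∀ᶠ y' in 𝓝[S2] y, (f y' ↔ f y)
  changes : ∀ t₀, (∀ t, γ t = γ t₀ → ∃ n : ℤ, t = t₀ + n) → ∀ U ∈ 𝓝 (γ t₀),
    ∃ y ∈ U, ∃ z ∈ U, (y ∈ S2 ∧ y ∉ range γ ∧ f y) ∧ z ∈ S2 ∧ z ∉ range γ ∧ ¬ f z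

/-- Pull the winding sign back by stereographic projection. At the pole the function is declared
true, in agreement with the value 1 of the sign near infinity. -/
theorem exists_checkerboard_of_ne_pole {γ : ℝ → E3} (hγ : ContDiff ℝ ∞ γ)
    (hper : Function.Periodic γ 1) (hS : ∀ t, γ t ∈ S2) (hd : ∀ t, deriv γ t ≠ 0)
    (hpole : ∀ t, γ t 2 ≠ 1) : ∃ f, IsCheckerboard γ f := by
  set Γ : ℝ → ℂ := fun t => stereo (γ t) with hΓdef
  have hΓ : ContDiff ℝ ∞ Γ := contDiff_stereo_comp hγ hpole
  have hΓper : Function.Periodic Γ 1 := fun t => by simp only [hΓdef, hper t]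
  have hinv : ∀ t, stereoInv (Γ t) = γ t := fun t => stereoInv_stereo (hS t) (hpole t)
  have hΓd : ∀ t, deriv Γ t ≠ 0 := by
    intro t e
    have h1 : HasDerivAt Γ 0 t := by
      rw [← e]
      exact ((hΓ.differentiable (by simp)) t).hasDerivAt
    have h2 := ((contDiff_stereoInv.differentiable (by simp)) (Γ t)).hasFDerivAt.comp_hasDerivAt t h1
    rw [map_zero] at h2
    have h3 : stereoInv ∘ Γ = γ := funext hinv
    rw [h3] at h2
    exact hd t h2.deriv
  have hnr : ∀ y ∈ S2, y 2 ≠ 1 → y ∉ range γ → stereo y ∉ range Γ := by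
    rintro y hy h1 h2 ⟨t, ht⟩
    refine h2 ⟨t, ?_⟩
    rw [← hinv, ht, stereoInv_stereo hy h1]
  have hnr' : ∀ z, z ∉ range Γ → stereoInv z ∉ range γ := by
    rintro z hz ⟨t, ht⟩
    refine hz ⟨t, ?_⟩
    rw [hΓdef]
    simp only
    rw [ht, stereo_stereoInv]
  refine ⟨fun y => y 2 = 1 ∨ windSign Γ (stereo y) = 1, ⟨fun y hy hyr => ?_, ?_⟩⟩
  · by_cases h : y 2 = 1
    · obtain ⟨R, hR⟩ := exists_windSign_eq_one hΓ hΓper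
      have hcoord : ContinuousAt (fun y : E3 => y 2) y := by fun_prop
      -- Since `‖stereo y‖ ^ 2 + 1 = 2 / (1 - y 2)`, above this height the projection has norm
      -- greater than `R`.
      have hlt : 1 - 2 / (R ^ 2 + 2) < y 2 := by
        rw [h]
        have : 0 < 2 / (R ^ 2 + 2) := by positivity
        linarith
      have h2 := hcoord.eventually (lt_mem_nhds hlt)
      filter_upwards [mem_nhdsWithin_of_mem_nhds h2, self_mem_nhdsWithin] with y' h3 h4
      have h3 : 1 - 2 / (R ^ 2 + 2) < y' 2 := h3
      refine iff_of_true ?_ (Or.inl h)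
      by_cases h5 : y' 2 = 1
      · exact Or.inl h5
      · refine Or.inr (hR _ ?_)
        have h6 := norm_sq_stereo h4 h5
        have h7 : y' 2 < 1 := lt_of_le_of_ne
          (by nlinarith [sum_sq_of_mem_S2 h4, sq_nonneg (y' 0), sq_nonneg (y' 1)]) h5
        have h8 : R ^ 2 + 2 < 2 * (1 - y' 2)⁻¹ := by
          have h9 : 0 < 1 - y' 2 := by linarith
          rw [← div_eq_mul_inv, lt_div_iff₀ h9]
          have h10 : 1 - y' 2 < 2 / (R ^ 2 + 2) := by linarith
          rw [lt_div_iff₀ (by positivity)] at h10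
          linarith
        refine lt_of_pow_lt_pow_left₀ 2 (norm_nonneg _) ?_
        rw [← Complex.normSq_eq_norm_sq, Complex.normSq_apply]
        nlinarith
    · have h1 := (continuousAt_stereo h).eventually
        (eventually_windSign_eq hΓ hΓper (hnr y hy h hyr))
      have hcoord : ContinuousAt (fun y : E3 => y 2) y := by fun_prop
      have h2 := hcoord.eventually_ne h
      filter_upwards [mem_nhdsWithin_of_mem_nhds h1, mem_nhdsWithin_of_mem_nhds h2] with y' h3 h4
      have h4 : y' 2 ≠ 1 := h4
      have h3 : windSign Γ (stereo y') = windSign Γ (stereo y) := h3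
      simp only [h, h4, false_or, h3]
  · intro t₀ ht₀ U hU
    have hjump := windSign_jump hΓ hΓper (hΓd t₀) (by
      intro t ht e
      obtain ⟨n, rfl⟩ := ht₀ t (by rw [← hinv, e, hinv])
      have h1 : (n : ℝ) < 1 := by linarith [ht.2]
      have h2 : (-1 : ℝ) < n := by linarith [ht.1]
      have h3 : n = 0 := by
        have : n < 1 := by exact_mod_cast h1
        have : -1 < n := by exact_mod_cast h2
        omega
      rw [h3]
      simp)
    have hcont : ContinuousAt stereoInv (Γ t₀) := contDiff_stereoInv.continuous.continuousAt
    have hV : stereoInv ⁻¹' U ∈ 𝓝 (Γ t₀) := hcont (by rwa [hinv])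
    have hplus : Tendsto (fun s : ℝ => Γ t₀ + Complex.I * deriv Γ t₀ * s) (𝓝[>] 0)
        (𝓝 (Γ t₀)) := by
      have : Tendsto (fun s : ℝ => Γ t₀ + Complex.I * deriv Γ t₀ * s) (𝓝 0)
          (𝓝 (Γ t₀ + Complex.I * deriv Γ t₀ * (0 : ℝ))) := Continuous.tendsto (by fun_prop) 0
      rw [Complex.ofReal_zero, mul_zero, add_zero] at this
      exact this.mono_left nhdsWithin_le_nhds
    have hminus : Tendsto (fun s : ℝ => Γ t₀ - Complex.I * deriv Γ t₀ * s) (𝓝[>] 0)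
        (𝓝 (Γ t₀)) := by
      have : Tendsto (fun s : ℝ => Γ t₀ - Complex.I * deriv Γ t₀ * s) (𝓝 0)
          (𝓝 (Γ t₀ - Complex.I * deriv Γ t₀ * (0 : ℝ))) := Continuous.tendsto (by fun_prop) 0
      rw [Complex.ofReal_zero, mul_zero, sub_zero] at this
      exact this.mono_left nhdsWithin_le_nhds
    obtain ⟨s, ⟨⟨h1, h2, h3⟩, h4⟩, h5⟩ :=
      ((hjump.and (hplus.eventually hV)).and (hminus.eventually hV)).exists
    generalize Γ t₀ + Complex.I * deriv Γ t₀ * s = p at *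
    generalize Γ t₀ - Complex.I * deriv Γ t₀ * s = q at *
    have key : ∀ p q, p ∉ range Γ → q ∉ range Γ → stereoInv p ∈ U → stereoInv q ∈ U →
        windSign Γ p = 1 → windSign Γ q ≠ 1 →
        ∃ y ∈ U, ∃ z ∈ U, (y ∈ S2 ∧ y ∉ range γ ∧ (y 2 = 1 ∨ windSign Γ (stereo y) = 1)) ∧
          z ∈ S2 ∧ z ∉ range γ ∧ ¬ (z 2 = 1 ∨ windSign Γ (stereo z) = 1) := by
      intro p q hp hq hpU hqU h1 h2
      refine ⟨_, hpU, _, hqU, ⟨stereoInv_mem _, hnr' _ hp, Or.inr ?_⟩, stereoInv_mem _, hnr' _ hq,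
        ?_⟩
      · rwa [stereo_stereoInv]
      · rw [stereo_stereoInv]
        exact not_or.2 ⟨stereoInv_ne q, h2⟩
    rcases windSign_eq hΓ hΓper h1 with e | e
    · exact key p q h1 h2 h4 h5 e fun e' => h3 (e.trans e'.symm)
    · rcases windSign_eq hΓ hΓper h2 with e' | e'
      · exact key q p h2 h1 h5 h4 e' fun e'' => h3 (e''.trans e'.symm)
      · exact absurd (e.trans e'.symm) h3

/-- The cone over the curve is a smooth image of a plane in space, so its complement is dense;
normalize a nonzero point of the complement. -/
theorem exists_mem_S2_notMem_range {γ : ℝ → E3} (hγ : ContDiff ℝ ∞ γ) :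
    ∃ b ∈ S2, b ∉ range γ := by
  have h1 : ContDiff ℝ 1 fun p : ℝ × ℝ => p.2 • γ p.1 := by
    have h2 : ContDiff ℝ 1 γ := hγ.of_le (by simp)
    fun_prop
  have h2 := h1.dense_compl_range_of_finrank_lt_finrank (by simp)
  obtain ⟨y, hy, hy0⟩ := h2.inter_open_nonempty {0}ᶜ isOpen_compl_singleton
    ⟨EuclideanSpace.single 0 1, by simp⟩
  have hy' : ‖y‖ ≠ 0 := norm_ne_zero_iff.2 hy
  refine ⟨‖y‖⁻¹ • y, ?_, ?_⟩
  · rw [mem_S2, norm_smul, norm_inv, norm_norm, inv_mul_cancel₀ hy']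
  · rintro ⟨t, ht⟩
    refine hy0 ⟨(t, ‖y‖), ?_⟩
    simp only
    rw [ht, smul_smul, mul_inv_cancel₀ hy', one_smul]

/-- An isometry takes a point missed by the curve to the pole. A reflection will do, since
checkerboard functions do not refer to the orientation. -/
theorem exists_checkerboard {γ : ℝ → E3} (hγ : ContDiff ℝ ∞ γ)
    (hper : Function.Periodic γ 1) (hS : ∀ t, γ t ∈ S2) (hd : ∀ t, deriv γ t ≠ 0) :
    ∃ f, IsCheckerboard γ f := by
  obtain ⟨b, hb, hbr⟩ := exists_mem_S2_notMem_range hγ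
  set e : E3 := !₂[0, 0, 1] with he
  have hen : e ∈ S2 := mem_S2_of_sum_sq (by simp [he])
  obtain ⟨ρ, hρ⟩ : ∃ ρ : E3 ≃ₗᵢ[ℝ] E3, ρ b = e :=
    ⟨(Submodule.span ℝ {b - e})ᗮ.reflection, Submodule.reflection_sub
      ((mem_S2.1 hb).trans (mem_S2.1 hen).symm)⟩
  have hρS : ∀ y, ρ y ∈ S2 ↔ y ∈ S2 := fun y => by rw [mem_S2, mem_S2, ρ.norm_map]
  have hcomp : ∀ t, HasDerivAt (fun t => ρ (γ t)) (ρ (deriv γ t)) t := fun t =>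
    ρ.toContinuousLinearEquiv.hasFDerivAt.comp_hasDerivAt t
      ((hγ.differentiable (by simp)) t).hasDerivAt
  obtain ⟨f, hf⟩ := exists_checkerboard_of_ne_pole (γ := fun t => ρ (γ t))
    (ρ.toContinuousLinearEquiv.contDiff.comp hγ) (fun t => by simp only [hper t])
    (fun t => (hρS _).2 (hS t))
    (fun t h => hd t (by rwa [(hcomp t).deriv, map_eq_zero_iff ρ ρ.injective] at h))
    (by
      intro t h
      refine hbr ⟨t, ρ.injective ?_⟩
      have h1 := sum_sq_of_mem_S2 ((hρS _).2 (hS t))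
      rw [h] at h1
      have h2 : ρ (γ t) 0 = 0 := by nlinarith [sq_nonneg (ρ (γ t) 0), sq_nonneg (ρ (γ t) 1)]
      have h3 : ρ (γ t) 1 = 0 := by nlinarith [sq_nonneg (ρ (γ t) 0), sq_nonneg (ρ (γ t) 1)]
      rw [hρ, he]
      ext c
      fin_cases c
      · simpa using h2
      · simpa using h3
      · simpa using h)
  have hr : ∀ y, ρ y ∈ range (fun t => ρ (γ t)) ↔ y ∈ range γ := by
    intro y
    simp [ρ.injective.eq_iff]
  refine ⟨fun y => f (ρ y), ⟨fun y hy hyr => ?_, ?_⟩⟩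
  · have h1 := hf.locally_const (ρ y) ((hρS y).2 hy) (fun h => hyr ((hr y).1 h))
    have h2 : Tendsto ρ (𝓝[S2] y) (𝓝[S2] (ρ y)) :=
      ρ.continuous.continuousWithinAt.tendsto_nhdsWithin fun z hz => (hρS z).2 hz
    exact h2.eventually h1
  · intro t₀ ht₀ U hU
    have hU' : ρ.symm ⁻¹' U ∈ 𝓝 (ρ (γ t₀)) :=
      ρ.symm.continuous.continuousAt (by simpa using hU)
    obtain ⟨y, hy, z, hz, ⟨k1, k2, k3⟩, k4, k5, k6⟩ := hf.changes t₀
      (fun t h => ht₀ t (ρ.injective h)) _ hU'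
    have hs : ∀ y, ρ (ρ.symm y) = y := ρ.apply_symm_apply
    refine ⟨_, hy, _, hz, ⟨?_, ?_, ?_⟩, ?_, ?_, ?_⟩
    · rwa [← hρS, hs]
    · rwa [← hr, hs]
    · rwa [hs]
    · rwa [← hρS, hs]
    · rwa [← hr, hs]
    · rwa [hs]

/-! The checkerboard coloring of a diagram with one circle. -/

/-- Apply the action of `0` a number of times. -/
def flip (k : ℕ) (x : P3) : P3 := if Even k then x else qop x .zero

theorem flip_succ (k : ℕ) (x : P3) : flip (k + 1) x = qop (flip k x) .zero := by
  by_cases h : Even k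
  · rw [flip, flip, if_pos h, if_neg (by simpa [Nat.even_add_one] using h)]
  · rw [flip, flip, if_neg h, if_pos (by simpa [Nat.even_add_one] using h), qop_qop_self]

theorem orbit_flip (k : ℕ) (x : P3) : (flip k x).orbit = x.orbit := by
  rw [flip]
  split_ifs
  · rfl
  · exact orbit_qop _ _

theorem qop_of_orbit {x y : P3} (hy : y.orbit = false) : qop x y = x := by
  cases x <;> cases y <;> first | rfl | simp [P3.orbit] at hy

theorem zero_qop (x : P3) : qop .zero x = .zero := by
  cases x <;> rfl

theorem clash_flip {r : P3} (hr : r.orbit = false) : clash (r, qop r .zero) = 1 := by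
  cases r <;> first | rfl | simp [P3.orbit] at hr

open Classical in
/-- The two values of a checkerboard function, as elements of `P3`. -/
def checkRegion (f : E3 → Prop) (y : E3) : P3 := if f y then .one else .two

theorem orbit_checkRegion (f : E3 → Prop) (y : E3) : (checkRegion f y).orbit = false := by
  rw [checkRegion]
  split_ifs <;> rfl

/-- The color of a side is a value of `checkRegion` near it; composing with the orbit map reduces
this to uniqueness of side colors. -/
theorem RightColor.orbit_checkRegion {f : E3 → Prop} {x v : E3} {y : P3} (hx : ‖x‖ = 1)
    (hv : v ≠ 0) (hxv : inner ℝ x v = 0) (h : RightColor (checkRegion f) x v y) :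
    y.orbit = false := by
  have h1 : RightColor (fun z => (checkRegion f z).orbit) x v y.orbit :=
    fun α w k1 k2 k3 k4 => (h α w k1 k2 k3 k4).mono fun s e => by
      change (checkRegion f (α s)).orbit = _
      rw [e]
  have h2 : RightColor (fun z => (checkRegion f z).orbit) x v false :=
    fun α w _ _ _ _ => Eventually.of_forall fun s => MLinkoid.orbit_checkRegion f _
  exact SideColor.unique hx hv hxv (by norm_num) h1.side h2.side

section Checkerboard

variable {n : ℕ} {D : Diagram n 1} {f : E3 → Prop}

theorem circle_mem_points (s : ℝ) :
    ((.inr 0, rep (.inr 0 : Comp n 1) s) : Pt n 1) ∈ points n 1 :=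
  rep_mem (i := (.inr 0 : Comp n 1)) (mem_univ s)

theorem Diagram.range_circle_subset (D : Diagram n 1) : range (D.curve (.inr 0)) ⊆ D.image := by
  rintro _ ⟨t, rfl⟩
  exact D.curve_mem_image (i := .inr 0) (mem_univ t)

theorem IsCheckerboard.eventually_region {γ : ℝ → E3} (hf : IsCheckerboard γ f) {y : E3}
    (hy : y ∈ S2) (hy' : y ∉ range γ) :
    ∀ᶠ y' in 𝓝[S2] y, checkRegion f y' = checkRegion f y := by
  filter_upwards [hf.locally_const y hy hy'] with y' h
  by_cases hy : f y <;> simp [checkRegion, h, hy]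

theorem IsCheckerboard.region_const (hf : IsCheckerboard (D.curve (.inr 0)) f) :
    ∀ x ∈ S2 \ D.image, ∀ y ∈ connectedComponentIn (S2 \ D.image) x,
      checkRegion f y = checkRegion f x := by
  intro x hx y hy
  refine isPreconnected_connectedComponentIn.induction₂
    (fun a b => checkRegion f b = checkRegion f a) ?_
    (fun a b c _ _ _ h1 h2 => h2.trans h1) (fun a b _ _ h => h.symm)
    (mem_connectedComponentIn hx) hy
  intro a ha
  have ha' := connectedComponentIn_subset _ _ ha
  exact nhdsWithin_mono a (fun z hz => (connectedComponentIn_subset _ _ hz).1)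
    (hf.eventually_region ha'.1 fun h => ha'.2 (D.range_circle_subset h))

/-- Off the circle the checkerboard coloring is the same on both sides. -/
theorem IsCheckerboard.side_colors {γ : ℝ → E3} (hf : IsCheckerboard γ f) {x v : E3}
    (hx : x ∈ S2) (hx' : x ∉ range γ) : RightColor (checkRegion f) x v (checkRegion f x) ∧
      LeftColor (checkRegion f) x v (checkRegion f x) := by
  have key : ∀ (α : ℝ → E3) (w : E3), (∀ s, α s ∈ S2) → α 0 = x →
      HasDerivWithinAt α w (Ici 0) 0 → ∀ᶠ s in 𝓝[>] (0 : ℝ),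
        checkRegion f (α s) = checkRegion f x := by
    intro α w h1 h2 h3
    have h4 : Tendsto α (𝓝[>] 0) (𝓝[S2] x) := by
      refine tendsto_nhdsWithin_iff.2 ⟨?_, Eventually.of_forall h1⟩
      rw [← h2]
      exact h3.continuousWithinAt.mono Ioi_subset_Ici_self
    exact h4.eventually (hf.eventually_region hx hx')
  exact ⟨fun α w h1 h2 h3 _ => key α w h1 h2 h3, fun α w h1 h2 h3 _ => key α w h1 h2 h3⟩

theorem notMem_range_of_simple {a : Fin n} {t : ℝ} (ht : t ∈ allParams (.inl a : Comp n 1))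
    (ho : ¬ D.IsOver (.inl a) t) (hu : ¬ D.IsUnder (.inl a) t) :
    D.curve (.inl a) t ∉ range (D.curve (.inr 0)) := by
  rintro ⟨s, hs⟩
  have := D.eq_of_pos_eq ht ho hu (p := (.inr 0, rep (.inr 0 : Comp n 1) s))
    (circle_mem_points s) (by rw [Diagram.pos, D.curve_rep, hs])
  simp at this

theorem notMem_range_of_endpoint (a : Fin n) {t : ℝ} (ht : t = 0 ∨ t = 1) :
    D.curve (.inl a) t ∉ range (D.curve (.inr 0)) := by
  rintro ⟨s, hs⟩
  exact D.endpoint_simple a t ht (.inr 0, rep (.inr 0 : Comp n 1) s)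
    (circle_mem_points s) (by simp) (by rw [D.curve_rep, hs])

open Classical in
/-- The number of passages of an interval under the circle before a parameter. -/
def Diagram.passages (D : Diagram n 1) (a : Fin n) (t : ℝ) : ℕ :=
  (D.crossings.filter fun v => v.2.1 = .inl a ∧ v.1.1 = .inr 0 ∧ v.2.2 < t).card

theorem Diagram.passages_congr {a : Fin n} {s t : ℝ}
    (h : ∀ v ∈ D.crossings, v.2.1 = .inl a → (v.2.2 < s ↔ v.2.2 < t)) :
    D.passages a s = D.passages a t := by
  rw [passages, passages]
  congr 1
  refine Finset.filter_congr fun v hv => ?_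
  constructor
  · rintro ⟨h1, h2, h3⟩
    exact ⟨h1, h2, (h v hv h1).1 h3⟩
  · rintro ⟨h1, h2, h3⟩
    exact ⟨h1, h2, (h v hv h1).2 h3⟩

theorem Diagram.passages_before (D : Diagram n 1) (a : Fin n) (t₀ : ℝ) :
    ∀ᶠ t in 𝓝[<] t₀, D.passages a t = D.passages a t₀ := by
  have h : ∀ᶠ t in 𝓝[<] t₀, ∀ v ∈ D.crossings, (v.2.2 < t ↔ v.2.2 < t₀) := by
    refine (Filter.eventually_all_finset _).2 fun v _ => ?_
    rcases lt_or_ge v.2.2 t₀ with h | h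
    · filter_upwards [Ioo_mem_nhdsLT h] with t ht
      exact iff_of_true ht.1 h
    · filter_upwards [self_mem_nhdsWithin] with t (ht : t < t₀)
      exact iff_of_false (by linarith) (by linarith)
  filter_upwards [h] with t ht
  exact D.passages_congr fun v hv _ => ht v hv

theorem Diagram.eq_of_under_eq {m k : ℕ} {D : Diagram m k} {v w : Pt m k × Pt m k}
    (hv : v ∈ D.crossings) (hw : w ∈ D.crossings) (h : w.2 = v.2) : w = v := by
  obtain ⟨k1, k2, k3, k4⟩ := D.crossing_double w hw
  have h5 : D.pos w.1 = D.pos v.1 := by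
    rw [show D.pos v.1 = D.pos v.2 from (D.crossing_double v hv).2.2.2, ← h]
    exact k4
  rcases D.eq_or_eq_of_pos_eq hv k1 h5 with e | e
  · exact Prod.ext e h
  · exact absurd (e.trans h.symm) k3

open Classical in
theorem Diagram.passages_after {v : Pt n 1 × Pt n 1} (hv : v ∈ D.crossings) {a : Fin n}
    (ha : v.2.1 = .inl a) :
    ∀ᶠ t in 𝓝[>] v.2.2, D.passages a t =
      D.passages a v.2.2 + if v.1.1 = .inr 0 then 1 else 0 := by
  have h : ∀ᶠ t in 𝓝[>] v.2.2, ∀ w ∈ D.crossings, (w.2.2 < t ↔ w.2.2 ≤ v.2.2) := by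
    refine (Filter.eventually_all_finset _).2 fun w _ => ?_
    rcases le_or_gt w.2.2 v.2.2 with h | h
    · filter_upwards [self_mem_nhdsWithin] with t (ht : v.2.2 < t)
      exact iff_of_true (by linarith) h
    · filter_upwards [Ioo_mem_nhdsGT h] with t ht
      exact iff_of_false (not_lt.2 ht.2.le) (not_le.2 h)
  filter_upwards [h] with t ht
  have hset : D.crossings.filter (fun w => w.2.1 = .inl a ∧ w.1.1 = .inr 0 ∧ w.2.2 < t) =
      D.crossings.filter (fun w => w.2.1 = .inl a ∧ w.1.1 = .inr 0 ∧ w.2.2 < v.2.2) ∪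
      (if v.1.1 = .inr 0 then {v} else ∅) := by
    ext w
    simp only [Finset.mem_union, Finset.mem_filter]
    constructor
    · rintro ⟨hw, h1, h2, h3⟩
      rcases ((ht w hw).1 h3).lt_or_eq with h4 | h4
      · exact Or.inl ⟨hw, h1, h2, h4⟩
      · have := D.eq_of_under_eq hv hw (Prod.ext (h1.trans ha.symm) h4)
        subst this
        rw [if_pos h2]
        exact Or.inr (Finset.mem_singleton_self _)
    · rintro (⟨hw, h1, h2, h3⟩ | h1)
      · exact ⟨hw, h1, h2, (ht w hw).2 h3.le⟩
      · split_ifs at h1 with h2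
        · rw [Finset.mem_singleton] at h1
          subst h1
          exact ⟨hv, ha, h2, (ht w hv).2 le_rfl⟩
        · simp at h1
  rw [passages, hset, Finset.card_union_of_disjoint, passages]
  · split_ifs <;> simp
  · split_ifs
    · rw [Finset.disjoint_singleton_right]
      simp
    · exact Finset.disjoint_empty_right _

/-- The circle has the color `0`; an interval changes its color when it passes under the circle, and
its last arc and the region around its leg have distinct colors. -/
def checkArc (D : Diagram n 1) (f : E3 → Prop) : Comp n 1 → ℝ → P3
  | .inl a, t => flip (D.passages a t + D.passages a 1 + 1) (checkRegion f (D.curve (.inl a) 1))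
  | .inr _, _ => .zero

theorem orbit_checkArc (a : Fin n) (t : ℝ) : (checkArc D f (.inl a) t).orbit = false := by
  rw [checkArc, orbit_flip, orbit_checkRegion]

/-- The colors 1 and 2 act trivially, so only passages under the circle matter to an interval, and
there the count goes up by one. The circle keeps its color because 0 is fixed by every action. -/
theorem checkArc_crossing {v : Pt n 1 × Pt n 1} (hv : v ∈ D.crossings) :
    ∃ x, (∀ᶠ t in 𝓝[<] v.2.2, checkArc D f v.2.1 t = x) ∧
      ∀ᶠ t in 𝓝[>] v.2.2, checkArc D f v.2.1 t = qop x (checkArc D f v.1.1 v.1.2) := by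
  rcases hj : v.2.1 with a | j
  · refine ⟨_, (D.passages_before a v.2.2).mono fun t ht => by rw [checkArc, ht], ?_⟩
    filter_upwards [D.passages_after hv hj] with t ht
    rw [checkArc, ht]
    rcases hi : v.1.1 with b | i
    · rw [qop_of_orbit (orbit_checkArc b _)]
      simp
    · obtain rfl : i = 0 := Subsingleton.elim _ _
      rw [if_pos rfl, checkArc, ← flip_succ]
      congr 1
      ring
  · exact ⟨.zero, Eventually.of_forall fun _ => rfl,
      Eventually.of_forall fun _ => (zero_qop _).symm⟩

theorem IsCheckerboard.exists_color (hf : IsCheckerboard (D.curve (.inr 0)) f)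
    {v : Pt n 1 × Pt n 1} (hv : v ∈ D.crossings) : ∃ col : P3 × P3 × P3,
      col.2.2 = checkArc D f v.1.1 v.1.2 ∧
      (D.Positive v →
        (∀ᶠ t in 𝓝[<] v.2.2, checkArc D f v.2.1 t = col.2.1 ∧
          RightColor (checkRegion f) (D.curve v.2.1 t) (deriv (D.curve v.2.1) t) col.1) ∧
        ∀ᶠ t in 𝓝[>] v.2.2, checkArc D f v.2.1 t = qop col.2.1 col.2.2) ∧
      (¬ D.Positive v →
        (∀ᶠ t in 𝓝[>] v.2.2, checkArc D f v.2.1 t = col.2.1 ∧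
          RightColor (checkRegion f) (D.curve v.2.1 t) (deriv (D.curve v.2.1) t) col.1) ∧
        ∀ᶠ t in 𝓝[<] v.2.2, checkArc D f v.2.1 t = qop col.2.1 col.2.2) := by
  obtain ⟨q, hq⟩ := crossing_colors hf.region_const hv
  obtain ⟨x, hb, ha⟩ := checkArc_crossing (f := f) hv
  by_cases hpos : D.Positive v
  · have ho : 0 < orient (D.pos v.1) (D.vel v.1) (D.vel v.2) := hpos
    refine ⟨(q 1 (-1), x, checkArc D f v.1.1 v.1.2), rfl, fun _ => ⟨?_, ha⟩,
      fun h => absurd hpos h⟩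
    filter_upwards [hb, eventually_nhdsWithin_of_eventually_nhds (hq 1 (-1)).2,
      self_mem_nhdsWithin] with t h1 h2 (h3 : t < v.2.2)
    exact ⟨h1, (h2 (by linarith)).right (by linarith)⟩
  · have ho : orient (D.pos v.1) (D.vel v.1) (D.vel v.2) < 0 :=
      lt_of_le_of_ne (not_lt.1 hpos) (D.transverse_crossing hv).orient_ne
    -- At a negative crossing the specified under-arc is the outgoing one; the incoming color is
    -- recovered because all actions are involutions.
    refine ⟨(q (-1) 1, qop x (checkArc D f v.1.1 v.1.2), checkArc D f v.1.1 v.1.2), rfl,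
      fun h => absurd h hpos, fun _ => ⟨?_, by simpa only [qop_qop_self] using hb⟩⟩
    filter_upwards [ha, eventually_nhdsWithin_of_eventually_nhds (hq (-1) 1).2,
      self_mem_nhdsWithin] with t h1 h2 (h3 : v.2.2 < t)
    exact ⟨h1, (h2 (by linarith)).right (by linarith)⟩

/-- Near a simple point there are at most the two side colors, and the checkerboard function takes
both values there. So the sides carry 1 and 2, which 0 exchanges. -/
theorem IsCheckerboard.side_circle (hf : IsCheckerboard (D.curve (.inr 0)) f) {t : ℝ}
    (ho : ¬ D.IsOver (.inr 0) t) (hu : ¬ D.IsUnder (.inr 0) t) :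
    ∃ y, RightColor (checkRegion f) (D.curve (.inr 0) t) (deriv (D.curve (.inr 0)) t) y ∧
      LeftColor (checkRegion f) (D.curve (.inr 0) t) (deriv (D.curve (.inr 0)) t)
        (qop y .zero) := by
  have ht : t ∈ allParams (.inr 0 : Comp n 1) := mem_univ t
  obtain ⟨y, z, h1, h2⟩ := simple_colors hf.region_const (i := .inr 0) (mem_univ t) ho hu
  have h3 := D.eventually_image (D.curve (.inr 0) t) one_pos
  obtain ⟨a, ⟨ha1, ha2⟩, b, ⟨hb1, hb2⟩, ⟨ka1, ka2, ka3⟩, kb1, kb2, kb3⟩ := hf.changes t (by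
      intro s hs
      have h := D.eq_of_pos_eq ht ho hu (p := (.inr 0, rep (.inr 0 : Comp n 1) s))
        (circle_mem_points s) (by rw [Diagram.pos, D.curve_rep, hs])
      obtain ⟨z, hz⟩ := Int.fract_eq_fract.1 (congrArg Prod.snd h : Int.fract s = Int.fract t)
      exact ⟨z, by linarith⟩) _ (Filter.inter_mem h2 h3)
  have hout : ∀ w, w ∉ range (D.curve (.inr 0)) →
      (w ∈ D.image → ∃ p ∈ points n 1, D.pos p = D.curve (.inr 0) t ∧
        ∃ s, |s - p.2| < 1 ∧ w = D.curve p.1 s) → w ∉ D.image := by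
    intro w hw h hI
    obtain ⟨p, hp, hpe, s, -, hs⟩ := h hI
    rw [D.eq_of_pos_eq ht ho hu hp hpe] at hs
    exact hw ⟨s, hs.symm⟩
  have e1 := ha1 ⟨ka1, hout a ka2 ha2⟩
  have e2 := hb1 ⟨kb1, hout b kb2 hb2⟩
  rw [checkRegion, if_pos ka3] at e1
  rw [checkRegion, if_neg kb3] at e2
  refine ⟨y, h1.self_of_nhds.1, ?_⟩
  have hz : z = qop y .zero := by
    rcases e1 with e1 | e1 <;> rcases e2 with e2 | e2
    · exact absurd (e1.trans e2.symm) (by decide)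
    · rw [← e1, ← e2]
      rfl
    · rw [← e1, ← e2]
      rfl
    · exact absurd (e1.trans e2.symm) (by decide)
  rw [← hz]
  exact h1.self_of_nhds.2

/-- The checkerboard coloring. -/
def checkColoring (hf : IsCheckerboard (D.curve (.inr 0)) f) : Coloring P3 D where
  region := checkRegion f
  arc := checkArc D f
  color v := open Classical in
    if hv : v ∈ D.crossings then (hf.exists_color hv).choose else (.zero, .zero, .zero)
  region_const := hf.region_const
  arc_periodic _ _ := rfl
  arc_const := by
    rintro (a | j) s t hst - hu
    · rw [checkArc, checkArc, D.passages_congr]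
      intro v hv hva
      constructor
      · exact fun h => lt_of_lt_of_le h hst
      · intro h
        by_contra h'
        exact hu v.2.2 ⟨not_lt.1 h', h.le⟩ ⟨v, hv, Prod.ext hva rfl⟩
    · rfl
  side := by
    rintro (a | j) t ht ho hu
    · have ht' := innerParams_subset _ ht
      have h := hf.side_colors (v := deriv (D.curve (.inl a)) t) (D.curve_mem_S2 ht')
        (notMem_range_of_simple ht' ho hu)
      refine ⟨_, h.1, ?_⟩
      rw [qop_of_orbit (orbit_checkArc a t)]
      exact h.2
    · obtain rfl : j = 0 := Subsingleton.elim _ _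
      exact hf.side_circle ho hu
  endpoint := by
    intro a t ht
    have ht' : t ∈ allParams (.inl a : Comp n 1) := by
      change t ∈ Icc (0 : ℝ) 1
      rcases ht with rfl | rfl <;> simp
    exact ⟨_, nhdsWithin_mono _ sdiff_subset
      (hf.eventually_region (D.curve_mem_S2 ht') (notMem_range_of_endpoint a ht)),
      qop_of_orbit (orbit_checkArc a t)⟩
  color_over v hv := by
    rw [dif_pos hv]
    exact (hf.exists_color hv).choose_spec.1
  color_pos v hv := by
    rw [dif_pos hv]
    exact (hf.exists_color hv).choose_spec.2.1
  color_neg v hv := by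
    rw [dif_pos hv]
    exact (hf.exists_color hv).choose_spec.2.2

/-- The crossing color is an unspecified choice, so its entries are read back from the coloring
conditions near the crossing. -/
theorem orbit_color (hf : IsCheckerboard (D.curve (.inr 0)) f) {v : Pt n 1 × Pt n 1}
    (hv : v ∈ D.crossings) : ((checkColoring hf).color v).1.orbit = false ∧
      ∃ t, ((checkColoring hf).color v).2.1 = checkArc D f v.2.1 t := by
  set c := checkColoring hf with hc
  have key : ∀ {F : Filter ℝ} [F.NeBot], F ≤ 𝓝 v.2.2 → (∀ᶠ t in F, c.arc v.2.1 t = (c.color v).2.1 ∧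
      RightColor c.region (D.curve v.2.1 t) (deriv (D.curve v.2.1) t) (c.color v).1) →
      (c.color v).1.orbit = false ∧ ∃ t, (c.color v).2.1 = checkArc D f v.2.1 t := by
    intro F _ hF h
    obtain ⟨t, ⟨h1, h2⟩, h3⟩ :=
      (h.and (hF ((isOpen_innerParams v.2.1).mem_nhds (D.inner_under hv)))).exists
    have h3' := innerParams_subset _ h3
    exact ⟨RightColor.orbit_checkRegion (mem_S2.1 (D.curve_mem_S2 h3')) (D.deriv_ne_zero h3')
      (D.inner_deriv h3) h2, t, h1.symm⟩
  by_cases hpos : D.Positive v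
  · exact key nhdsWithin_le_nhds (c.color_pos v hv hpos).1
  · exact key nhdsWithin_le_nhds (c.color_neg v hv hpos).1

/-! ### The weight of the checkerboard coloring. -/

theorem φ_snd_of_orbit {y x z : P3} (hy : y.orbit = false) (hz : z.orbit = false) :
    (((φ y x z).2 : ℤ) : ZMod 2) = if x.orbit = true then 1 else 0 := by
  cases y <;> cases x <;> cases z <;>
    first | rfl | simp [P3.orbit] at hy hz

theorem φ_fst_of_orbit {y : P3} (hy : y.orbit = false) (x z : P3) : (φ y x z).1 = 0 := by
  cases y <;> cases x <;> cases z <;> first | rfl | simp [P3.orbit] at hy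

/-- Modulo 2 signs disappear: an over-crossing of the interval counts 1 if the under-arc is 0, that
is, belongs to the circle, and 0 otherwise. -/
theorem totalJump_checkColoring_cast (hf : IsCheckerboard (D.curve (.inr 0)) f) (a : Fin n) :
    (((checkColoring hf).totalJump (.inl a) : ℤ) : ZMod 2) =
      ((D.between (.inl a) (.inr 0)).card : ZMod 2) := by
  classical
  have hb : D.between (.inl a) (.inr 0) =
      (D.overCrossings (.inl a)).filter fun v => v.2.1 = .inr 0 := by
    ext v
    simp [Diagram.mem_between, Diagram.mem_overCrossings, and_assoc]
  rw [Coloring.totalJump, Int.cast_sum, hb, Finset.card_filter, Nat.cast_sum]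
  refine Finset.sum_congr rfl fun v hv => ?_
  obtain ⟨hv, hva⟩ := Diagram.mem_overCrossings.1 hv
  obtain ⟨hy, t, hx⟩ := orbit_color hf hv
  have hz : ((checkColoring hf).color v).2.2.orbit = false := by
    rw [(checkColoring hf).color_over v hv, hva]
    exact orbit_checkArc a _
  have hxo : ((checkColoring hf).color v).2.1.orbit = true ↔ v.2.1 = .inr 0 := by
    rw [hx]
    rcases v.2.1 with b | j
    · rw [orbit_checkArc]
      simp
    · exact iff_of_true rfl (by rw [Subsingleton.elim j 0])
  have hφ := φ_snd_of_orbit (x := ((checkColoring hf).color v).2.1) hy hz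
  rw [Coloring.jump]
  split_ifs with h1 h2 h2 <;> simp [hφ, hxo, h2]

/-- Near the leg `clash` is 1, so the total jump is 1 minus a value in `{0, 1}`; being odd, it is 1.
-/
theorem totalJump_checkColoring (hf : IsCheckerboard (D.curve (.inr 0)) f) (hD : OddLinked D)
    (a : Fin n) : (checkColoring hf).totalJump (.inl a) = 1 := by
  set c := checkColoring hf with hc
  have h1S : (1 : ℝ) ∈ allParams (.inl a : Comp n 1) := by
    change (1 : ℝ) ∈ Icc (0 : ℝ) 1
    simp
  set r := checkRegion f (D.curve (.inl a) 1) with hr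
  have hro : r.orbit = false := orbit_checkRegion _ _
  have hclosed : IsClosed (range (D.curve (.inr 0))) := by
    have hper : Function.Periodic (D.curve (.inr 0)) 1 := D.periodic 0
    rw [← hper.image_Icc one_pos 0]
    exact (isCompact_Icc.image (D.smooth _).continuous).isClosed
  have hcont := (D.smooth (.inl a)).continuous.tendsto 1
  have hin : ∀ᶠ t in 𝓝[<] (1 : ℝ), t ∈ Ioo (0 : ℝ) 1 := Ioo_mem_nhdsLT zero_lt_one
  have hcontS : Tendsto (D.curve (.inl a)) (𝓝[<] 1) (𝓝[S2] (D.curve (.inl a) 1)) := by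
    refine tendsto_nhdsWithin_iff.2 ⟨hcont.mono_left nhdsWithin_le_nhds, ?_⟩
    filter_upwards [hin] with t ht
    exact D.curve_mem_S2 (i := .inl a) (Ioo_subset_Icc_self ht)
  have hstate : ∀ᶠ t in 𝓝[<] (1 : ℝ), clash (c.state (.inl a) t) = 1 := by
    filter_upwards [hin, D.passages_before a 1,
      hcontS.eventually (hf.eventually_region (D.curve_mem_S2 h1S)
        (notMem_range_of_endpoint a (Or.inr rfl))),
      (hcont.mono_left nhdsWithin_le_nhds).eventually
        (hclosed.isOpen_compl.mem_nhds (notMem_range_of_endpoint a (Or.inr rfl)))]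
      with t k1 k2 k3 k4
    have k5 := hf.side_colors (v := deriv (D.curve (.inl a)) t)
      (D.curve_mem_S2 (i := .inl a) (Ioo_subset_Icc_self k1)) k4
    have k6 : c.arc (.inl a) t = qop r .zero := by
      change checkArc D f (.inl a) t = _
      -- Near the leg the number of flips is twice `passages` plus one, hence odd: the last arc has
      -- the nonzero color other than that of the region.
      rw [checkArc, k2, flip_succ, flip, if_pos ⟨_, rfl⟩]
    rw [c.state_eq (i := .inl a) k1 k5.1, k6, k3, clash_flip hro]
  obtain ⟨η, hη, hsub⟩ := (mem_nhdsLT_iff_exists_Ioo_subset' zero_lt_one).1 hstate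
  -- Taking `t₁` beyond `η` puts it where `clash` is known to be 1.
  obtain ⟨l, t₀, -, t₁, ht₁, hηt, -, -, -, hJ⟩ := c.totalJump_interval a hη
  have h1 : clash (c.state (.inl a) t₁) = 1 := hsub ⟨hηt, ht₁.2⟩
  rw [h1] at hJ
  have hcast := totalJump_checkColoring_cast hf a
  rw [ZMod.natCast_eq_one_iff_odd.2 (hD a)] at hcast
  rcases clash_mem (c.state (.inl a) t₀) with h0 | h0
  · rw [hJ, h0, sub_zero]
  · rw [← hc, hJ, h0, sub_self] at hcast
    simp at hcast

theorem OddLinked.exists_coloring (hD : OddLinked D) :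
    ∃ c : Coloring P3 D, c.weight φ = (0, (n : ℤ)) := by
  obtain ⟨f, hf⟩ := exists_checkerboard (D.smooth (.inr 0)) (D.periodic 0)
    (fun t => D.curve_mem_S2 (i := .inr 0) (mem_univ t))
    fun t => D.deriv_ne_zero (i := .inr 0) (mem_univ t)
  refine ⟨checkColoring hf, Prod.ext ?_ ?_⟩
  · rw [Coloring.weight, Prod.fst_sum]
    refine Finset.sum_eq_zero fun v hv => ?_
    have h := fun x z => φ_fst_of_orbit (orbit_color hf hv).1 x z
    split_ifs
    · exact h _ _
    · rw [Prod.fst_neg, h, neg_zero]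
  · rw [Coloring.weight_snd, Fintype.sum_sum_type,
      Finset.sum_congr rfl fun a _ => totalJump_checkColoring hf hD a,
      Finset.sum_eq_zero (s := (Finset.univ : Finset (Fin 1))) fun j _ =>
        (checkColoring hf).totalJump_circle j]
    simp

end Checkerboard

end MLinkoid

end

theorem theorem5p4 :
    MLinkoid.IsQuandle3Cocycle MLinkoid.φ ∧
    ∀ n : ℕ,
      (MLinkoid.M n).linkoid.crossingNumber = n ∧
      ∀ D : MLinkoid.Diagram n 1, D.linkoid = (MLinkoid.M n).linkoid →
        (∃ c : MLinkoid.Coloring MLinkoid.P3 D, c.weight MLinkoid.φ = (0, (n : ℤ))) ∧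
        ∀ c : MLinkoid.Coloring MLinkoid.P3 D,
          MLinkoid.size (c.weight MLinkoid.φ) ≤ ((MLinkoid.M n).linkoid.crossingNumber : ℤ) := by
  refine ⟨MLinkoid.isQuandle3Cocycle_φ, fun n => ⟨MLinkoid.crossingNumber_M n, fun D hD => ?_⟩⟩
  rw [MLinkoid.crossingNumber_M]
  exact ⟨((MLinkoid.oddLinked_iff_of_linkoid_eq hD).2 (MLinkoid.oddLinked_M n)).exists_coloring,
    fun c => c.size_weight_le⟩
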